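/- A \emph{structural causal model} (SCM) $G$ consists of a finite nonempty directed acyclic graph on variables with finitely many states, a probability distribution with rational values for each root (exogenous) variable, and for each other (endogenous) variable a table (structural equation) giving its state for every instantiation of its parents. It defines observational probabilities $\Pr(\mathbf y)$ and counterfactual probabilities $\Pr(\mathbf y_{\mathbf x},\mathbf w_{\mathbf v},\mathbf e)$: the probability, over the exogenous variables, that $\mathbf Y=\mathbf y$ after setting $\mathbf X=\mathbf x$, that $\mathbf W=\mathbf w$ after setting $\mathbf V=\mathbf v$, and that $\mathbf E=\mathbf e$ without intervention. \emph{Reverse-MAP.} Given an SCM, disjoint sets $\mathbf U,\mathbf E_1,\mathbf E_2$ of its variables and instantiations $\mathbf e_1,\mathbf e_2$, compute $\arg\max_{\mathbf u}\Pr(\mathbf e_1\mid\mathbf u,\mathbf e_2)$. \emph{Unit selection.} Given an SCM, a set $\mathbf U$ of exogenous variables and an objective function $$L(\mathbf u)=\sum_{i=1}^n w_i\,\Pr(\mathbf y^i_{\mathbf x^i},\mathbf w^i_{\mathbf v^i}\mid \mathbf e^i,\mathbf u),\qquad w_i\ge 0,\quad \sum_{i=1}^n w_i=1,$$ with $w_i$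 rational, where all $\mathbf X^i,\mathbf Y^i,\mathbf V^i,\mathbf W^i,\mathbf E^i$ are sets of endogenous variables and $(\mathbf X^i\cup\mathbf V^i)\cap(\mathbf Y^i\cup\mathbf W^i)=\emptyset$, compute $\arg\max_{\mathbf u}L(\mathbf u)$. In both problems $\mathbf u$ ranges over the instantiations of $\mathbf U$ for which all the conditional probabilities are defined (the conditioning events have positive probability). \emph{Objective model} $G'$ of $\langle G,L\rangle$. For each $i\le n$ take three copies $G^i,[G^i],[[G^i]]$ of $G$ that share their exogenous variables; the unit variables $\mathbf U$ are moreover shared by all $i$. In $[G^i]$ the variables $[\mathbf X^i]$ lose their incoming edges and are set to $\mathbf x^i$; in $[[G^i]]$ the variables $[[\mathbf V^i]]$ lose theirs and are set to $\mathbf v^i$. Add a root $H$ with states $h_1,\dots,h_n$ and $\Pr'(h_i)=w_i$, and make it a parent of all variables $[\mathbf Y^i]$, $[[\mathbf W^i]]$; when $H=h_i$, these obey their original structural equations, and when $H\ne h_i$, they have their states in $\mathbf y^i,\mathbf w^i$. Let $\mathbf y,\mathbf w,\mathbf x,\mathbf v,\mathbf e$ be the instantiations of $\{[\mathbf Y^i]\}_i,\{[[\mathbf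 W^i]]\}_i,\{[\mathbf X^i]\}_i,\{[[\mathbf V^i]]\}_i,\{\mathbf E^i\}_i$ (the latter in the $G^i$) given by $L$. \emph{Size} $|G|$ of an SCM: the number of its variables, plus the number of its edges, plus the number of entries of its conditional probability tables. A root with $k$ states has $k$ entries; an endogenous variable with $k$ states has $k\cdot r$ entries, where $r$ is the least number of rows of a table of its structural equation, rows being allowed to describe a parent either by a state $s$ or by ``any state other than $s$''. \textbf{Statement.} There are polynomial-time reductions in both directions between Reverse-MAP and unit selection: 1. There is a polynomial-time map from Reverse-MAP instances to unit selection instances that preserves the set of optimal instantiations $\mathbf u$ (up to renaming of the target variables), the instantiations at which the objective is defined, and its values there. 2. The map that sends a unit selection instance $(G,\mathbf U,L)$ to the Reverse-MAP instance $\arg\max_{\mathbf u}\Pr'(\mathbf y,\mathbf w\mid\mathbf x,\mathbf v,\mathbf e,\mathbf u)$ on the objective model $G'$ is computable in polynomial time and has the same preservation properties. 3. The objective model has size $O(n\cdot|G|)$, with an absolute constant. Polynomial time refers to the length of the explicit input, in which all tables are listed with one row for each instantiation of the parents. -/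

import Mathlib

/-! ### Polynomial time: structured programs over binary trees, with a step count -/

/-- Binary trees, the data on which programs operate. -/
inductive Data where
  | nil : Data
  | cons : Data → Data → Data

namespace Data

/-- Number of nodes of a tree. -/
def size : Data → ℕ
  | nil => 1
  | cons a b => a.size + b.size + 1

def head : Data → Data
  | nil => nil
  | cons a _ => a

def tail : Data → Data
  | nil => nil
  | cons _ b => b

/-- Unary numbers. They are used for state numbers, for numbers of states and for the numbers in
variable names. -/
def ofNat : ℕ → Data
  | 0 => nil
  | n + 1 => cons nil (ofNat n)

def ofList {α : Type} (enc : α → Data) : List α → Data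
  | [] => nil
  | a :: l => cons (enc a) (ofList enc l)

/-- Binary numbers, least significant bit first. They are used for the probabilities. -/
def ofNatBinary (n : ℕ) : Data :=
  ofList (fun b : Bool => if b then cons nil nil else nil) (Nat.bits n)

def ofRat (q : ℚ≥0) : Data := cons (ofNatBinary q.num) (ofNatBinary q.den)

end Data

/-- Programs of a WHILE language over trees. A program transforms one tree into another:
`cons p q` runs `p` and `q` on the same input and joins the results, `seq p q` runs `p` and then
`q`, `ite c p q` runs `p` or `q` according to whether the result of `c` is different from `nil`,
`loop c p` repeats `p` as long as the result of `c` is different from `nil`. -/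
inductive Prog where
  | id : Prog
  | nil : Prog
  | head : Prog
  | tail : Prog
  | cons : Prog → Prog → Prog
  | seq : Prog → Prog → Prog
  | ite : Prog → Prog → Prog → Prog
  | loop : Prog → Prog → Prog

/-- `Runs p x y t`: on input `x` the program `p` halts with result `y` at cost `t`. Every step that
reads, copies or discards a tree is charged the size of that tree, so the cost also bounds the
memory that is used, and a Turing machine simulates a run in time polynomial in its cost. -/
inductive Runs : Prog → Data → Data → ℕ → Prop where
  | id (x : Data) : Runs Prog.id x x x.size
  | nil (x : Data) : Runs Prog.nil x Data.nil x.size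
  | head (x : Data) : Runs Prog.head x x.head x.size
  | tail (x : Data) : Runs Prog.tail x x.tail x.size
  | cons {p q : Prog} {x a b : Data} {s t : ℕ} :
      Runs p x a s → Runs q x b t → Runs (Prog.cons p q) x (Data.cons a b) (x.size + s + t + 1)
  | seq {p q : Prog} {x y z : Data} {s t : ℕ} :
      Runs p x y s → Runs q y z t → Runs (Prog.seq p q) x z (s + t + 1)
  | iteTrue {c p q : Prog} {x d y : Data} {s t : ℕ} :
      Runs c x d s → d ≠ Data.nil → Runs p x y t → Runs (Prog.ite c p q) x y (x.size + s + t + 1)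
  | iteFalse {c p q : Prog} {x y : Data} {s t : ℕ} :
      Runs c x Data.nil s → Runs q x y t → Runs (Prog.ite c p q) x y (x.size + s + t + 1)
  | loopStop {c p : Prog} {x : Data} {s : ℕ} :
      Runs c x Data.nil s → Runs (Prog.loop c p) x x (x.size + s + 1)
  | loopStep {c p : Prog} {x d y z : Data} {r s t : ℕ} :
      Runs c x d r → d ≠ Data.nil → Runs p x y s → Runs (Prog.loop c p) y z t →
      Runs (Prog.loop c p) x z (x.size + r + s + t + 1)

/-! ### Optimization problems and their reductions -/

/-- A maximization problem. A candidate solution is a list of numbers (for the two problems below,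
the list of the states of the target variables). -/
structure OptProblem where
  Input : Type
  encode : Input → Data
  Valid : Input → Prop
  /-- the candidates at which the objective is defined -/
  Feasible : Input → List ℕ → Prop
  value : Input → List ℕ → ℚ≥0

namespace OptProblem

/-- `u` belongs to the arg max. -/
def IsArgMax (P : OptProblem) (I : P.Input) (u : List ℕ) : Prop :=
  P.Feasible I u ∧ ∀ u', P.Feasible I u' → P.value I u' ≤ P.value I u

/-- `f` is computed in polynomial time, on the valid inputs of `P`. -/
def PolyTime (P Q : OptProblem) (f : P.Input → Q.Input) : Prop :=
  ∃ (p : Prog) (b : Polynomial ℕ), ∀ I, P.Valid I →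
    ∃ t ≤ b.eval (P.encode I).size, Runs p (P.encode I) (Q.encode (f I)) t

/-- `f` is a polynomial-time reduction from `P` to `Q`: it maps valid inputs to valid inputs with
the same optimal solutions; moreover the objective functions coincide. -/
def IsPolyReduction (P Q : OptProblem) (f : P.Input → Q.Input) : Prop :=
  PolyTime P Q f ∧
  ∀ I, P.Valid I →
    Q.Valid (f I) ∧
    (∀ u, Q.IsArgMax (f I) u ↔ P.IsArgMax I u) ∧
    (∀ u, Q.Feasible (f I) u ↔ P.Feasible I u) ∧
    (∀ u, P.Feasible I u → Q.value (f I) u = P.value I u)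

end OptProblem

/-! ### Structural causal models -/

/-- Names of variables. -/
abbrev Var := List ℕ

/-- What an SCM stores for a variable. The states of a variable with `k` states are `0, …, k - 1`.
* `exo θ`: an exogenous (root) variable whose `s`-th state has probability `θ[s]`;
* `endo pa k rows`: an endogenous variable with parents `pa` and `k` states; the structural equation
  is tabulated by `rows`, and a row `(p, s)` says that `s` is the state when the parents have
  states `p`. -/
inductive Mech where
  | exo (θ : List ℚ≥0) : Mech
  | endo (pa : List Var) (k : ℕ) (rows : List (List ℕ × ℕ)) : Mech

namespace Mech

def card : Mech → ℕ
  | exo θ => θ.length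
  | endo _ k _ => k

def IsExo : Mech → Bool
  | exo _ => true
  | endo _ _ _ => false

end Mech

/-- A (partial) instantiation: variables with their states. -/
abbrev Inst := List (Var × ℕ)

/-- The variables of an instantiation. -/
abbrev Inst.vars (e : Inst) : List Var := e.map Prod.fst

/-- Structural causal models (as raw data; see `SCM.WF`). -/
abbrev SCM := List (Var × Mech)

namespace SCM

def vars (G : SCM) : List Var := G.map Prod.fst

def exoVars (G : SCM) : Finset Var := ((G.filter fun n => n.2.IsExo).map Prod.fst).toFinset

def endoVars (G : SCM) : Finset Var := ((G.filter fun n => !n.2.IsExo).map Prod.fst).toFinset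

/-- The number of states of a variable. -/
def card (G : SCM) (v : Var) : ℕ :=
  match G.lookup v with
  | some m => m.card
  | none => 0

/-- The probability of a state of an exogenous variable. -/
def prior (G : SCM) (v : Var) (s : ℕ) : ℚ≥0 :=
  match G.lookup v with
  | some (Mech.exo θ) => θ.getD s 0
  | _ => 0

/-- `s` is a list of states of the variables `V`. -/
def IsStates (G : SCM) (s : List ℕ) (V : List Var) : Prop :=
  List.Forall₂ (fun a v => a < G.card v) s V

/-- `G` is a structural causal model: its variables are distinct, the parents of a variable are
distinct variables of the model, the graph is acyclic, the endogenous variables are those with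
parents, priors are probability distributions, and each table has exactly one row for each
instantiation of the parents. -/
def WF (G : SCM) : Prop :=
  G ≠ [] ∧
  G.vars.Nodup ∧
  (∀ v θ, (v, Mech.exo θ) ∈ G → θ.sum = 1) ∧
  (∀ v pa k rows, (v, Mech.endo pa k rows) ∈ G →
    pa ≠ [] ∧ pa.Nodup ∧ pa ⊆ G.vars ∧
    (rows.map Prod.fst).Nodup ∧ (∀ p, p ∈ rows.map Prod.fst ↔ G.IsStates p pa) ∧
    ∀ r ∈ rows, r.2 < k) ∧
  ∃ rank : Var → ℕ, ∀ v pa k rows, (v, Mech.endo pa k rows) ∈ G → ∀ p ∈ pa, rank p < rank v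

/-- `e` is an instantiation of a set of variables of `G`. -/
def IsInst (G : SCM) (e : Inst) : Prop :=
  e.vars.Nodup ∧ ∀ c ∈ e, c.1 ∈ G.vars ∧ c.2 < G.card c.1

/-- `e` is an instantiation of a set of endogenous variables of `G`. -/
def IsEndoInst (G : SCM) (e : Inst) : Prop :=
  G.IsInst e ∧ ∀ c ∈ e, c.1 ∈ G.endoVars

/-- Instantiations of all exogenous variables. -/
abbrev ExoInst (G : SCM) : Type := (v : {v : Var // v ∈ G.exoVars}) → Fin (G.card v)

/-- `x` assigns to the variables of `G` the states that they have when the exogenous variables have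
states `ω` and the variables in `act` are set to their states in `act`, which overrides their
structural equations. -/
def IsSolution (G : SCM) (act : Inst) (ω : G.ExoInst) (x : Var → ℕ) : Prop :=
  ∀ v m, (v, m) ∈ G →
    match act.lookup v with
    | some s => x v = s
    | none =>
      match m with
      | Mech.exo _ => ∀ h : v ∈ G.exoVars, x v = ω ⟨v, h⟩
      | Mech.endo pa _ rows => rows.lookup (pa.map x) = some (x v)

open Classical in
/-- The counterfactual probability of a list of pairs `(act, out)`: the probability that, for each
of these pairs, the variables of `out` have their states in `out` after the variables of `act` have
been set to their states in `act`. -/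
noncomputable def prob (G : SCM) (worlds : List (Inst × Inst)) : ℚ≥0 :=
  ∑ ω : G.ExoInst, (∏ v : {v : Var // v ∈ G.exoVars}, G.prior v (ω v)) *
    if ∀ w ∈ worlds, ∃ x, G.IsSolution w.1 ω x ∧ ∀ c ∈ w.2, x c.1 = c.2 then 1 else 0

/-- The observational probability of an instantiation. -/
noncomputable def obs (G : SCM) (e : Inst) : ℚ≥0 := G.prob [([], e)]

end SCM

/-! ### The size of a model

A structural equation is stored by the rows of a table. In a row, a parent is described by one of
its states `s` or by "any state other than `s`". -/

/-- A cell of a table row. -/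
inductive Cell where
  | eq (s : ℕ) : Cell
  | ne (s : ℕ) : Cell

def Cell.Matches : Cell → ℕ → Prop
  | eq s, a => a = s
  | ne s, a => a ≠ s

/-- The table `T` with grouped rows stands for the fully expanded table `rows`: each row of the
latter is matched by some row of the former, and only by rows with the same value. -/
def Represents (T : List (List Cell × ℕ)) (rows : List (List ℕ × ℕ)) : Prop :=
  ∀ r ∈ rows,
    (∃ g ∈ T, List.Forall₂ Cell.Matches g.1 r.1) ∧
    ∀ g ∈ T, List.Forall₂ Cell.Matches g.1 r.1 → g.2 = r.2

/-- The number of rows that are needed to store a structural equation. -/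
noncomputable def rowCount (rows : List (List ℕ × ℕ)) : ℕ :=
  sInf {k | ∃ T : List (List Cell × ℕ), T.length = k ∧ Represents T rows}

/-- One unit for the variable, one for each incoming edge, and one for each entry of the conditional
probability table (a row has one entry for each state of the variable). -/
noncomputable def Mech.size : Mech → ℕ
  | exo θ => 1 + θ.length
  | endo pa k rows => 1 + pa.length + rowCount rows * k

/-- The space needed to store the structure and the parameters of `G`. -/
noncomputable def SCM.size (G : SCM) : ℕ := (G.map fun n => n.2.size).sum

/-! ### Reverse-MAP -/

structure RMAPInput where
  G : SCM
  U : List Var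
  e₁ : Inst
  e₂ : Inst

/-! ### Unit selection -/

/-- The summand `weight * Pr(y_x, w_v | e, u)` of an objective function. -/
structure Term where
  weight : ℚ≥0
  x : Inst
  y : Inst
  v : Inst
  w : Inst
  e : Inst

structure USInput where
  G : SCM
  U : List Var
  L : List Term

/-! ### Encodings of the inputs as trees -/

namespace Data

def ofVar (v : Var) : Data := ofList ofNat v

def ofInst (e : Inst) : Data := ofList (fun c : Var × ℕ => cons (ofVar c.1) (ofNat c.2)) e

def ofMech : Mech → Data
  | Mech.exo θ => cons nil (ofList ofRat θ)
  | Mech.endo pa k rows =>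
      cons (cons nil nil) (cons (ofList ofVar pa) (cons (ofNat k)
        (ofList (fun r : List ℕ × ℕ => cons (ofList ofNat r.1) (ofNat r.2)) rows)))

def ofSCM (G : SCM) : Data := ofList (fun n : Var × Mech => cons (ofVar n.1) (ofMech n.2)) G

def ofTerm (t : Term) : Data :=
  cons (ofRat t.weight) (cons (ofInst t.x) (cons (ofInst t.y) (cons (ofInst t.v)
    (cons (ofInst t.w) (ofInst t.e)))))

def ofRMAP (I : RMAPInput) : Data :=
  cons (ofSCM I.G) (cons (ofList ofVar I.U) (cons (ofInst I.e₁) (ofInst I.e₂)))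

def ofUS (I : USInput) : Data :=
  cons (ofSCM I.G) (cons (ofList ofVar I.U) (ofList ofTerm I.L))

end Data

/-- Reverse-MAP: given an SCM `G`, disjoint sets of variables `U`, `E₁`, `E₂` and instantiations
`e₁`, `e₂` of the last two, maximize `Pr(e₁ | u, e₂)` over the instantiations `u` of `U` for which
this conditional probability is defined. -/
noncomputable def RMAP : OptProblem where
  Input := RMAPInput
  encode := Data.ofRMAP
  Valid I := I.G.WF ∧ I.U.Nodup ∧ I.U ⊆ I.G.vars ∧ I.G.IsInst I.e₁ ∧ I.G.IsInst I.e₂ ∧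
    I.U.Disjoint I.e₁.vars ∧ I.U.Disjoint I.e₂.vars ∧ I.e₁.vars.Disjoint I.e₂.vars
  Feasible I u := I.G.IsStates u I.U ∧ I.G.obs (I.U.zip u ++ I.e₂) ≠ 0
  value I u := I.G.obs (I.e₁ ++ I.U.zip u ++ I.e₂) / I.G.obs (I.U.zip u ++ I.e₂)

/-- Unit selection: given an SCM `G`, a set `U` of exogenous variables, and an objective function
`L(u) = ∑ i, w i * Pr(y i _{x i}, w i _{v i} | e i, u)`, maximize `L(u)` over the instantiations `u`
of `U` for which all these conditional probabilities are defined. Treatment, outcome and evidence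
variables are endogenous, no treatment variable of a summand is an outcome variable of that
summand, and the weights sum to one. -/
noncomputable def UnitSelection : OptProblem where
  Input := USInput
  encode := Data.ofUS
  Valid I := I.G.WF ∧ I.U.Nodup ∧ (∀ v ∈ I.U, v ∈ I.G.exoVars) ∧
    (∀ t ∈ I.L,
      I.G.IsEndoInst t.x ∧ I.G.IsEndoInst t.y ∧ I.G.IsEndoInst t.v ∧ I.G.IsEndoInst t.w ∧
      I.G.IsEndoInst t.e ∧ (t.x.vars ++ t.v.vars).Disjoint (t.y.vars ++ t.w.vars)) ∧
    (I.L.map Term.weight).sum = 1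
  Feasible I u := I.G.IsStates u I.U ∧ ∀ t ∈ I.L, I.G.obs (t.e ++ I.U.zip u) ≠ 0
  value I u := (I.L.map fun t => t.weight *
    (I.G.prob [(t.x, t.y), (t.v, t.w), ([], t.e ++ I.U.zip u)] /
      I.G.obs (t.e ++ I.U.zip u))).sum

/-! ### The objective model -/

namespace Objective

/-- The mixture variable. -/
def mixVar : Var := [0]

/-- The shared copy of a unit variable. -/
def unitVar (v : Var) : Var := 1 :: v

/-- The copy of another exogenous variable in component `i`. -/
def exoVar (i : ℕ) (v : Var) : Var := 2 :: i :: v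

/-- The copy of an endogenous variable in world `j` of component `i`. World `0` carries the
evidence, worlds `1` and `2` carry the two interventions. -/
def endoVar (i j : ℕ) (v : Var) : Var := 3 :: i :: j :: v

/-- The copy of any variable of `G` in world `j` of component `i`. -/
def copyVar (G : SCM) (U : List Var) (i j : ℕ) (v : Var) : Var :=
  if v ∈ U then unitVar v else if v ∈ G.exoVars then exoVar i v else endoVar i j v

/-- The copies of the endogenous variables in world `j` of component `i` out of `n`. A variable that
is set by `act` becomes a root with that state. A variable with state `z` in `out` gets the mixture
variable as a further parent; it obeys its structural equation when the mixture variable has state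
`i` and has state `z` otherwise. -/
def world (G : SCM) (U : List Var) (n i j : ℕ) (act out : Inst) : SCM :=
  G.filterMap fun
    | (_, Mech.exo _) => none
    | (v, Mech.endo pa k rows) =>
      some (endoVar i j v,
        match act.lookup v with
        | some s => Mech.exo ((List.range k).map fun a => if a = s then 1 else 0)
        | none =>
          match out.lookup v with
          | none => Mech.endo (pa.map (copyVar G U i j)) k rows
          | some z => Mech.endo (mixVar :: pa.map (copyVar G U i j)) k
              (rows.flatMap fun r =>
                (List.range n).map fun h => (h :: r.1, if h = i then r.2 else z)))

/-- Component `i` out of `n`, for the summand `t`: a mutilated triplet model without its unit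
variables. -/
def component (G : SCM) (U : List Var) (n i : ℕ) (t : Term) : SCM :=
  (G.filterMap fun
    | (v, Mech.exo θ) => if v ∈ U then none else some (exoVar i v, Mech.exo θ)
    | (_, Mech.endo _ _ _) => none) ++
  world G U n i 0 [] [] ++ world G U n i 1 t.x t.y ++ world G U n i 2 t.v t.w

/-- The objective model. -/
def model (I : USInput) : SCM :=
  (mixVar, Mech.exo (I.L.map Term.weight)) ::
  (I.G.filterMap fun
    | (v, Mech.exo θ) => if v ∈ I.U then some (unitVar v, Mech.exo θ) else none
    | (_, Mech.endo _ _ _) => none) ++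
  I.L.zipIdx.flatMap fun c => component I.G I.U I.L.length c.2 c.1

/-- The copy of an instantiation of endogenous variables in world `j` of component `i`. -/
def copyInst (i j : ℕ) (e : Inst) : Inst := e.map fun c => (endoVar i j c.1, c.2)

/-- The Reverse-MAP problem `arg max_u Pr'(y, w | x, v, e, u)` on the objective model. -/
def toRMAP (I : USInput) : RMAPInput where
  G := model I
  U := I.U.map unitVar
  e₁ := I.L.zipIdx.flatMap fun c => copyInst c.2 1 c.1.y ++ copyInst c.2 2 c.1.w
  e₂ := I.L.zipIdx.flatMap fun c =>
    copyInst c.2 1 c.1.x ++ copyInst c.2 2 c.1.v ++ copyInst c.2 0 c.1.e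

end Objective

/-! ### Functions computed in polynomial time -/

/-! From unit selection to Reverse-MAP. Fix `u` and write `a_i = Pr(y^i_{x^i}, w^i_{v^i}, e^i | u)`
and `b_i = Pr(e^i | u)`. In the objective model the components share only `H` and the unit
variables, so they are independent given `H = h_s` and `u`. Component `s` then obeys its equations
and contributes `a_s`. Every other component has its outcomes forced, which makes them certain, and
contributes `b_i`. The intervened variables are point masses and contribute nothing. Hence the
numerator is `Pr(u) * ∑_s w_s a_s ∏_{i ≠ s} b_i` and the denominator is `Pr(u) * ∏_i b_i`, with
quotient `∑_s w_s a_s / b_s = L(u)`. The denominator vanishes exactly when some `Pr(e^i, u)` does.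

From Reverse-MAP to unit selection. Targets may be endogenous and observed variables exogenous,
which unit selection forbids. So every variable gets an endogenous copy, an independent root with
full support and as many states, and a variable telling whether root and original agree. With the
roots as unit variables and agreement as further evidence, fixing the roots to `u` fixes the
originals to `u`. Numerator and denominator both acquire the probability of the root states as a
factor, and it is nonzero and cancels.

Size. Mixing an equation with a constant costs one grouped row, "`H` is not `h_i`", and one edge.
Each world is therefore at most twice as large as `G`.

Polynomial time rests on closure properties of `PolyFn`, most of them registered for `fun_prop`; the
essential one is `PolyFn.foldl`, a loop whose accumulators stay polynomially small. Probabilities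
are handled as iterated expectations `expect` over lists of independent variables
(`SCM.WF.prob_eq`), where independence and renaming become `expect_flatMap` and `expect_map`. The
causal content is in `Objective.sol_copy`: a solution of the objective model restricts, world by
world, to solutions of `G` under interventions. -/

theorem Polynomial.eval_mono_nat (b : Polynomial ℕ) {m n : ℕ} (h : m ≤ n) : b.eval m ≤ b.eval n := by
  simp only [Polynomial.eval_eq_sum_range]
  exact Finset.sum_le_sum fun i _ => Nat.mul_le_mul_left _ (Nat.pow_le_pow_left h i)

theorem Data.size_pos (x : Data) : 1 ≤ x.size := by cases x <;> simp [Data.size]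

/-- Each constructor charges at least the size of the tree it produces. Time bounds thus serve as
bounds on intermediate results, which is what makes polynomial bounds compose. -/
theorem Runs.size_le {p : Prog} {x y : Data} {t : ℕ} (h : Runs p x y t) : y.size ≤ t := by
  induction h with
  | id x => exact le_rfl
  | nil x => exact x.size_pos
  | head x | tail x => cases x <;> simp only [Data.size, Data.head, Data.tail] <;> omega
  | cons => simp only [Data.size]; omega
  | _ => omega

/-! ### Encodings and their sizes -/

/-- Types whose elements are represented by trees. -/
class Enc (α : Type) where
  enc : α → Data

open Enc (enc)

namespace Enc

instance : Enc ℕ := ⟨Data.ofNat⟩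
instance : Enc Bool := ⟨fun b => if b then Data.cons Data.nil Data.nil else Data.nil⟩
instance : Enc Unit := ⟨fun _ => Data.nil⟩
instance : Enc ℚ≥0 := ⟨Data.ofRat⟩
instance {α β : Type} [Enc α] [Enc β] : Enc (α × β) := ⟨fun p => Data.cons (enc p.1) (enc p.2)⟩
instance {α : Type} [Enc α] : Enc (List α) := ⟨Data.ofList enc⟩
instance {α : Type} [Enc α] : Enc (Option α) := ⟨fun o => enc o.toList⟩
instance : Enc Mech := ⟨Data.ofMech⟩
instance : Enc Term := ⟨Data.ofTerm⟩
instance : Enc RMAPInput := ⟨Data.ofRMAP⟩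
instance : Enc USInput := ⟨Data.ofUS⟩

variable {α β : Type} [Enc α] [Enc β]

theorem pair (a : α) (b : β) : enc (a, b) = Data.cons (enc a) (enc b) := rfl
theorem list_cons (a : α) (l : List α) : enc (a :: l) = Data.cons (enc a) (enc l) := rfl

theorem size_pair (a : α) (b : β) : (enc (a, b)).size = (enc a).size + (enc b).size + 1 := rfl
theorem size_nil : (enc ([] : List α)).size = 1 := rfl
theorem size_cons (a : α) (l : List α) :
    (enc (a :: l)).size = (enc a).size + (enc l).size + 1 := rfl

theorem size_append (l m : List α) :
    (enc (l ++ m)).size + 1 = (enc l).size + (enc m).size := by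
  induction l with
  | nil => simp [size_nil]; omega
  | cons a l ih => simp only [List.cons_append, size_cons]; omega

theorem length_le_size (l : List α) : l.length + 1 ≤ (enc l).size := by
  induction l with
  | nil => simp [size_nil]
  | cons a l ih => simp only [List.length_cons, size_cons]; omega

theorem size_prefix_le {l m : List α} (h : l <+: m) : (enc l).size ≤ (enc m).size := by
  obtain ⟨r, rfl⟩ := h
  have := size_append l r
  have := Data.size_pos (enc r)
  omega

theorem size_mem_le {a : α} {l : List α} (h : a ∈ l) : (enc a).size ≤ (enc l).size := by
  induction l with
  | nil => simp at h
  | cons b l ih =>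
    simp only [size_cons]
    rcases List.mem_cons.1 h with rfl | h
    · omega
    · have := ih h; omega

theorem size_nat (n : ℕ) : (enc n).size = 2 * n + 1 := by
  induction n with
  | zero => rfl
  | succ n ih =>
    change (Data.cons Data.nil (enc n)).size = _
    simp only [Data.size, ih]; omega

theorem size_bool (b : Bool) : (enc b).size ≤ 3 := by cases b <;> decide

/-- Counting loops up to a unary number become loops over a list. -/
theorem nat_eq_list (n : ℕ) : enc n = enc (List.replicate n ()) := by
  induction n with
  | zero => rfl
  | succ n ih => exact congrArg (Data.cons Data.nil) ih

end Enc

/-- `f` is computed in polynomial time. -/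
@[fun_prop]
def PolyFn {α β : Type} [Enc α] [Enc β] (f : α → β) : Prop :=
  ∃ (p : Prog) (b : Polynomial ℕ), ∀ a, ∃ t ≤ b.eval (enc a).size, Runs p (enc a) (enc (f a)) t

/-! ### Polynomial time: composition, pairing and case distinction -/

namespace PolyFn

variable {α β γ σ : Type} [Enc α] [Enc β] [Enc γ] [Enc σ]

theorem size_le {f : α → β} (h : PolyFn f) :
    ∃ b : Polynomial ℕ, ∀ a, (enc (f a)).size ≤ b.eval (enc a).size := by
  obtain ⟨p, b, h⟩ := h
  refine ⟨b, fun a => ?_⟩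
  obtain ⟨t, ht, hr⟩ := h a
  exact hr.size_le.trans ht

/-- Serves all changes of type that leave the tree untouched: structures and nested pairs, options
and lists, numbers and lists of units. -/
theorem reinterpret {f : α → β} (h : ∀ a, enc (f a) = enc a) : PolyFn f :=
  ⟨Prog.id, Polynomial.X, fun a => ⟨(enc a).size, by simp, by rw [h a]; exact Runs.id _⟩⟩

@[fun_prop]
theorem id : PolyFn fun a : α => a := reinterpret fun _ => rfl

@[fun_prop]
theorem comp {f : β → γ} {g : α → β} (hf : PolyFn f) (hg : PolyFn g) :
    PolyFn fun a => f (g a) := by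
  obtain ⟨p, b, hp⟩ := hf
  obtain ⟨q, c, hq⟩ := hg
  refine ⟨Prog.seq q p, c + b.comp c + 1, fun a => ?_⟩
  obtain ⟨s, hs, hr⟩ := hq a
  obtain ⟨t, ht, hr'⟩ := hp (g a)
  refine ⟨_, ?_, Runs.seq hr hr'⟩
  have := b.eval_mono_nat (hr.size_le.trans hs)
  simp only [Polynomial.eval_add, Polynomial.eval_comp, Polynomial.eval_one]
  omega

theorem exists_runs_const (d : Data) : ∃ (p : Prog) (b : Polynomial ℕ), ∀ x : Data,
    ∃ t ≤ b.eval x.size, Runs p x d t := by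
  induction d with
  | nil => exact ⟨Prog.nil, Polynomial.X, fun x => ⟨_, by simp, Runs.nil x⟩⟩
  | cons d e hd he =>
    obtain ⟨p, b, hp⟩ := hd
    obtain ⟨q, c, hq⟩ := he
    refine ⟨Prog.cons p q, Polynomial.X + b + c + 1, fun x => ?_⟩
    obtain ⟨s, hs, hr⟩ := hp x
    obtain ⟨t, ht, hr'⟩ := hq x
    exact ⟨_, by simp; omega, Runs.cons hr hr'⟩

@[fun_prop]
theorem const (b : β) : PolyFn fun _ : α => b := by
  obtain ⟨p, c, h⟩ := exists_runs_const (enc b)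
  exact ⟨p, c, fun a => h _⟩

/-- The function whose tree is the join of two trees. -/
theorem join {δ : Type} [Enc δ] {f : α → β} {g : α → γ} {h : α → δ}
    (hf : PolyFn f) (hg : PolyFn g) (hh : ∀ a, enc (h a) = Data.cons (enc (f a)) (enc (g a))) :
    PolyFn h := by
  obtain ⟨p, b, hp⟩ := hf
  obtain ⟨q, c, hq⟩ := hg
  refine ⟨Prog.cons p q, Polynomial.X + b + c + 1, fun a => ?_⟩
  obtain ⟨s, hs, hr⟩ := hp a
  obtain ⟨t, ht, hr'⟩ := hq a
  exact ⟨_, by simp; omega, hh a ▸ Runs.cons hr hr'⟩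

@[fun_prop]
theorem prodMk {f : α → β} {g : α → γ} (hf : PolyFn f) (hg : PolyFn g) :
    PolyFn fun a => (f a, g a) := join hf hg fun _ => rfl

@[fun_prop]
theorem listCons {f : α → β} {g : α → List β} (hf : PolyFn f) (hg : PolyFn g) :
    PolyFn fun a => f a :: g a := join hf hg fun _ => rfl

theorem ofHead {f : α → β} (h : ∀ a, enc (f a) = (enc a).head) : PolyFn f :=
  ⟨Prog.head, Polynomial.X, fun a => ⟨_, by simp, h a ▸ Runs.head _⟩⟩

theorem ofTail {f : α → β} (h : ∀ a, enc (f a) = (enc a).tail) : PolyFn f :=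
  ⟨Prog.tail, Polynomial.X, fun a => ⟨_, by simp, h a ▸ Runs.tail _⟩⟩

@[fun_prop]
theorem fst {f : α → β × γ} (hf : PolyFn f) : PolyFn fun a => (f a).1 :=
  comp (ofHead (f := Prod.fst) fun _ => rfl) hf

@[fun_prop]
theorem snd {f : α → β × γ} (hf : PolyFn f) : PolyFn fun a => (f a).2 :=
  comp (ofTail (f := Prod.snd) fun _ => rfl) hf

@[fun_prop]
theorem listTail {f : α → List β} (hf : PolyFn f) : PolyFn fun a => (f a).tail :=
  comp (ofTail (f := List.tail) fun l => by cases l <;> rfl) hf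

@[fun_prop]
theorem natPred {f : α → ℕ} (hf : PolyFn f) : PolyFn fun a => (f a).pred :=
  comp (ofTail (f := Nat.pred) fun l => by cases l <;> rfl) hf

@[fun_prop]
theorem natSucc {f : α → ℕ} (hf : PolyFn f) : PolyFn fun a => f a + 1 :=
  join (const ()) hf fun _ => rfl

/-- Branching on whether a tree is different from `nil`. -/
theorem branch {δ : Type} [Enc δ] {c : α → γ} {f g h : α → δ} (hc : PolyFn c)
    (hf : PolyFn f) (hg : PolyFn g)
    (h₁ : ∀ a, enc (c a) ≠ Data.nil → h a = f a) (h₂ : ∀ a, enc (c a) = Data.nil → h a = g a) :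
    PolyFn h := by
  obtain ⟨r, d, hr⟩ := hc
  obtain ⟨p, b, hp⟩ := hf
  obtain ⟨q, e, hq⟩ := hg
  refine ⟨Prog.ite r p q, Polynomial.X + d + b + e + 1, fun a => ?_⟩
  obtain ⟨r, hr, hr'⟩ := hr a
  obtain ⟨s, hs, hs'⟩ := hp a
  obtain ⟨t, ht, ht'⟩ := hq a
  by_cases hn : enc (c a) = Data.nil
  · rw [hn] at hr'
    exact ⟨_, by simp; omega, h₂ a hn ▸ Runs.iteFalse hr' ht'⟩
  · exact ⟨_, by simp; omega, h₁ a hn ▸ Runs.iteTrue hr' hn hs'⟩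

@[fun_prop]
theorem ite {c : α → Prop} [∀ a, Decidable (c a)] {f g : α → β}
    (hc : PolyFn fun a => decide (c a)) (hf : PolyFn f) (hg : PolyFn g) :
    PolyFn fun a => if c a then f a else g a := by
  refine branch hc hf hg (fun a h => ?_) (fun a h => ?_)
  · by_cases hca : c a
    · simp [hca]
    · simp [hca, enc] at h
  · by_cases hca : c a
    · simp [hca, enc] at h
    · simp [hca]

/-- Branching on the form of a structure: `nil`, or a pair. -/
theorem cases' {δ ε : Type} [Enc δ] [Enc ε] {m : α → γ} {f h : α → δ} {g : α × ε → δ}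
    (hm : PolyFn m) (hf : PolyFn f) (hg : PolyFn g)
    (hh : ∀ a, (enc (m a) = Data.nil ∧ h a = f a) ∨
      ∃ e : ε, enc (m a) ≠ Data.nil ∧ enc (m a) = enc e ∧ h a = g (a, e)) : PolyFn h := by
  obtain ⟨r, d, hr⟩ := hm
  obtain ⟨p, b, hp⟩ := hf
  obtain ⟨q, e, hq⟩ := hg
  -- The program for `m` runs twice, as the test and to supply the matched value, which is handed to
  -- `q` together with the original input.
  refine ⟨Prog.ite r (Prog.seq (Prog.cons Prog.id r) q) p,
    (Polynomial.X + d + b + 1) + (Polynomial.X + Polynomial.X + d + 2) +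
      e.comp (Polynomial.X + d + 1), fun a => ?_⟩
  obtain ⟨r, hr, hr'⟩ := hr a
  rcases hh a with ⟨hn, he⟩ | ⟨y, hn, hy, he⟩
  · obtain ⟨s, hs, hs'⟩ := hp a
    rw [hn] at hr'
    exact ⟨_, by simp; omega, he ▸ Runs.iteFalse hr' hs'⟩
  · obtain ⟨s, hs, hs'⟩ := hq (a, y)
    rw [Enc.pair, ← hy] at hs'
    rw [Enc.size_pair, ← hy] at hs
    refine ⟨_, ?_, he ▸ Runs.iteTrue hr' hn (Runs.seq (Runs.cons (Runs.id _) hr') hs')⟩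
    have h₁ := hr'.size_le
    have := e.eval_mono_nat (m := (enc a).size + (enc (m a)).size + 1)
      (n := (enc a).size + d.eval (enc a).size + 1) (by omega)
    simp only [Polynomial.eval_add, Polynomial.eval_comp, Polynomial.eval_one, Polynomial.eval_X,
      Polynomial.eval_ofNat]
    omega

theorem listCases {δ : Type} [Enc δ] {l : α → List γ} {f : α → δ} {g : α → γ → List γ → δ}
    (hl : PolyFn l) (hf : PolyFn f) (hg : PolyFn fun p : α × γ × List γ => g p.1 p.2.1 p.2.2) :
    PolyFn fun a => List.casesOn (motive := fun _ => δ) (l a) (f a) (g a) := by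
  refine cases' hl hf hg fun a => ?_
  dsimp only
  cases l a with
  | nil => exact Or.inl ⟨rfl, rfl⟩
  | cons x l => exact Or.inr ⟨(x, l), by simp [Enc.list_cons], rfl, rfl⟩

theorem optionCases {δ : Type} [Enc δ] {o : α → Option γ} {f : α → δ} {g : α × γ → δ}
    (ho : PolyFn o) (hf : PolyFn f) (hg : PolyFn g) :
    PolyFn fun a => Option.casesOn (motive := fun _ => δ) (o a) (f a) fun x => g (a, x) := by
  have : PolyFn fun p : α × γ × List γ => g (p.1, p.2.1) :=
    comp (f := g) (g := fun p : α × γ × List γ => (p.1, p.2.1)) hg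
      (prodMk (fst id) (fst (snd id)))
  have := listCases (g := fun a x _ => g (a, x)) (comp (f := Option.toList) (reinterpret fun _ => rfl) ho) hf this
  convert this using 2 with a
  cases o a <;> rfl

/-- The head of the tree of a mechanism is a tag, `nil` exactly for an exogenous variable, and the
tail is the tree of the tuple of arguments. -/
theorem mechCases {δ : Type} [Enc δ] {m : α → Mech} {f : α × List ℚ≥0 → δ}
    {g : α × List Var × ℕ × List (List ℕ × ℕ) → δ} (hm : PolyFn m)
    (hf : PolyFn f) (hg : PolyFn g) :
    PolyFn fun a => Mech.casesOn (motive := fun _ => δ) (m a) (fun θ => f (a, θ))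
      fun pa k rows => g (a, pa, k, rows) := by
  obtain ⟨r, d, hr⟩ := hm
  obtain ⟨p, b, hp⟩ := hf
  obtain ⟨q, e, hq⟩ := hg
  refine ⟨Prog.ite (Prog.seq r Prog.head)
      (Prog.seq (Prog.cons Prog.id (Prog.seq r Prog.tail)) q)
      (Prog.seq (Prog.cons Prog.id (Prog.seq r Prog.tail)) p),
    (Polynomial.X + d + d + 2) + (Polynomial.X + Polynomial.X + d + d + 3) +
      (e.comp (Polynomial.X + d + 1) + b.comp (Polynomial.X + d + 1)), fun a => ?_⟩
  obtain ⟨r, hr, hr'⟩ := hr a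
  have h₁ := hr'.size_le
  have hargs := fun (y : Data) (hy : (enc (m a)).tail = y) =>
    hy ▸ Runs.cons (Runs.id (enc a)) (Runs.seq hr' (Runs.tail _))
  have hcond := fun (y : Data) (hy : (enc (m a)).head = y) =>
    hy ▸ Runs.seq hr' (Runs.head _)
  have hsize : (enc (m a)).tail.size ≤ (enc (m a)).size := by
    cases enc (m a) <;> simp [Data.tail, Data.size]; omega
  simp only [Polynomial.eval_add, Polynomial.eval_comp, Polynomial.eval_one, Polynomial.eval_X,
      Polynomial.eval_ofNat]
  cases hma : m a with
  | exo θ =>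
    obtain ⟨s, hs, hs'⟩ := hp (a, θ)
    have ht : (enc (m a)).tail = enc θ := by rw [hma]; rfl
    refine ⟨_, ?_, Runs.iteFalse (hcond _ (by rw [hma]; rfl)) (Runs.seq (hargs _ ht) hs')⟩
    rw [ht] at hsize
    rw [Enc.size_pair] at hs
    have := b.eval_mono_nat (m := (enc a).size + (enc θ).size + 1)
      (n := (enc a).size + d.eval (enc a).size + 1) (by omega)
    omega
  | endo pa k rows =>
    obtain ⟨s, hs, hs'⟩ := hq (a, pa, k, rows)
    have ht : (enc (m a)).tail = enc (pa, k, rows) := by rw [hma]; rfl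
    refine ⟨_, ?_, Runs.iteTrue (hcond (Data.cons Data.nil Data.nil) (by rw [hma]; rfl)) (by simp)
      (Runs.seq (hargs _ ht) hs')⟩
    rw [ht] at hsize
    rw [Enc.size_pair] at hs
    have := e.eval_mono_nat (m := (enc a).size + (enc (pa, k, rows)).size + 1)
      (n := (enc a).size + d.eval (enc a).size + 1) (by omega)
    omega

end PolyFn
-- Polynomial time: iteration over lists and the functions built from it
namespace PolyFn

variable {α β γ σ : Type} [Enc α] [Enc β] [Enc γ] [Enc σ]

/-- The loop works on the triple of parameter, accumulator and remaining list, and the remaining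
list is its own test because only the empty list is encoded by `nil`. `K` bounds the accumulators
after all prefixes and `M` bounds the whole triple, so every round has the same cost bound. -/
theorem exists_runs_foldl {g : γ → σ → α → σ} {pc pb : Prog} {bc bb : Polynomial ℕ}
    (hc : ∀ q : γ × σ × List α, ∃ t ≤ bc.eval (enc q).size, Runs pc (enc q) (enc q.2.2) t)
    (hb : ∀ q : γ × σ × α × List α, ∃ t ≤ bb.eval (enc q).size,
      Runs pb (enc q) (enc (q.1, g q.1 q.2.1 q.2.2.1, q.2.2.2)) t)
    (c : γ) (K M : ℕ) (l : List α) (s : σ)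
    (hK : ∀ l', l' <+: l → (enc (l'.foldl (g c) s)).size ≤ K)
    (hM : (enc c).size + K + (enc l).size + 2 ≤ M) :
    ∃ t ≤ (l.length + 1) * (M + bc.eval M + bb.eval M + 1),
      Runs (Prog.loop pc pb) (enc (c, s, l)) (enc (c, l.foldl (g c) s, ([] : List α))) t := by
  induction l generalizing s with
  | nil =>
    obtain ⟨t, ht, hr⟩ := hc (c, s, [])
    have h₀ : (enc s).size ≤ K := hK [] (List.prefix_refl _)
    have hs : (enc (c, s, ([] : List α))).size ≤ M := by
      simp only [Enc.size_pair]; omega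
    refine ⟨_, ?_, Runs.loopStop hr⟩
    have := bc.eval_mono_nat hs
    simp only [List.length_nil]
    omega
  | cons a l ih =>
    obtain ⟨t, ht, hr⟩ := hc (c, s, a :: l)
    obtain ⟨u, hu, hr'⟩ := hb (c, s, a, l)
    have h₀ : (enc s).size ≤ K := hK [] (List.nil_prefix)
    have hs : (enc (c, s, a :: l)).size ≤ M := by
      simp only [Enc.size_pair]; omega
    obtain ⟨v, hv, hr''⟩ := ih (g c s a)
      (fun l' hl' => hK (a :: l') (by simpa using hl'))
      (by simp only [Enc.size_cons] at hM; omega)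
    refine ⟨_, ?_, Runs.loopStep hr (by simp [Enc.list_cons]) hr' hr''⟩
    have h₁ := bc.eval_mono_nat hs
    have h₂ := bb.eval_mono_nat hs
    change u ≤ bb.eval (enc (c, s, a :: l)).size at hu
    rw [List.length_cons, Nat.succ_mul]
    change (enc (c, s, a :: l)).size + t + u + v + 1 ≤ _
    omega

/-- Iteration over a list, when the intermediate results have polynomial size. -/
theorem foldl {g : γ → σ → α → σ} {l : γ → List α} {s : γ → σ}
    (hg : PolyFn fun p : γ × σ × α => g p.1 p.2.1 p.2.2) (hl : PolyFn l) (hs : PolyFn s)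
    (hB : ∃ B : Polynomial ℕ, ∀ c l', l' <+: l c →
      (enc (l'.foldl (g c) (s c))).size ≤ B.eval (enc c).size) :
    PolyFn fun c => (l c).foldl (g c) (s c) := by
  obtain ⟨B, hB⟩ := hB
  have hb : PolyFn fun q : γ × σ × α × List α => (q.1, g q.1 q.2.1 q.2.2.1, q.2.2.2) :=
    prodMk (fst id) (prodMk (comp (f := fun p : γ × σ × α => g p.1 p.2.1 p.2.2)
      (g := fun q : γ × σ × α × List α => (q.1, q.2.1, q.2.2.1)) hg
      (prodMk (fst id) (prodMk (fst (snd id)) (fst (snd (snd id))))))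
      (snd (snd (snd id))))
  have hc : PolyFn fun q : γ × σ × List α => q.2.2 := snd (snd id)
  have hi : PolyFn fun c => (c, s c, l c) := prodMk id (prodMk hs hl)
  have ho : PolyFn fun q : γ × σ × List α => q.2.1 := fst (snd id)
  obtain ⟨d, hd⟩ := hl.size_le
  obtain ⟨pc, bc, hc⟩ := hc
  obtain ⟨pb, bb, hb⟩ := hb
  obtain ⟨p, b, hi⟩ := hi
  obtain ⟨q, e, ho⟩ := ho
  -- A bound for the triple in the loop: parameter, accumulator (`B`), remaining list (`d`) and the
  -- two pairing nodes.
  let N : Polynomial ℕ := Polynomial.X + B + d + 2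
  refine ⟨Prog.seq p (Prog.seq (Prog.loop pc pb) q),
    b + (d * (N + bc.comp N + bb.comp N + 1) + e.comp N + 1) + 1, fun c => ?_⟩
  obtain ⟨t, ht, hr⟩ := hi c
  have hN : N.eval (enc c).size = (enc c).size + B.eval (enc c).size + d.eval (enc c).size + 2 := by
    simp [N]
  have hdc := hd c
  have hBc := hB c _ (List.prefix_refl _)
  have hpos := Data.size_pos (enc (l c))
  obtain ⟨u, hu, hr'⟩ := exists_runs_foldl hc hb c (B.eval (enc c).size) (N.eval (enc c).size)
    (l c) (s c) (hB c) (by omega)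
  obtain ⟨v, hv, hr''⟩ := ho (c, (l c).foldl (g c) (s c), [])
  refine ⟨_, ?_, Runs.seq hr (Runs.seq hr' hr'')⟩
  have h₁ : v ≤ e.eval (N.eval (enc c).size) :=
    hv.trans (e.eval_mono_nat (by simp only [Enc.size_pair, Enc.size_nil]; omega))
  have h₂ := Nat.mul_le_mul_right (N.eval (enc c).size + bc.eval (N.eval (enc c).size) +
    bb.eval (N.eval (enc c).size) + 1) ((Enc.length_le_size (l c)).trans hdc)
  simp only [Polynomial.eval_add, Polynomial.eval_comp, Polynomial.eval_one, Polynomial.eval_mul]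
  omega

/-- Iteration over a list, when each step adds a polynomial amount to the result. -/
theorem foldl_of_growth {g : γ → σ → α → σ} {l : γ → List α} {s : γ → σ}
    (hg : PolyFn fun p : γ × σ × α => g p.1 p.2.1 p.2.2) (hl : PolyFn l) (hs : PolyFn s)
    (hB : ∃ B : Polynomial ℕ, ∀ c s a, (enc (g c s a)).size ≤ (enc s).size + B.eval (enc (c, a)).size) :
    PolyFn fun c => (l c).foldl (g c) (s c) := by
  obtain ⟨B, hB⟩ := hB
  obtain ⟨d, hd⟩ := hl.size_le
  obtain ⟨e, he⟩ := hs.size_le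
  -- The initial value has size at most `e`. There are at most `d` rounds, and each adds `B`
  -- evaluated at a bound for the size of a pair of the parameter and a list element.
  refine foldl hg hl hs ⟨e + d * B.comp (Polynomial.X + d + 1), fun c l' hl' => ?_⟩
  have key : ∀ m : List α, (∀ a ∈ m, a ∈ l c) → ∀ s, (enc (m.foldl (g c) s)).size ≤
      (enc s).size + m.length * B.eval ((enc c).size + d.eval (enc c).size + 1) := by
    intro m
    induction m with
    | nil => intro _ s; simp
    | cons a m ih =>
      intro hm s
      have h₁ := ih (fun b hb => hm b (List.mem_cons_of_mem _ hb)) (g c s a)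
      have h₂ := hB c s a
      have h₃ := (Enc.size_mem_le (hm a (List.mem_cons_self))).trans (hd c)
      have h₄ := B.eval_mono_nat (m := (enc (c, a)).size)
        (n := (enc c).size + d.eval (enc c).size + 1) (by rw [Enc.size_pair]; omega)
      simp only [List.foldl_cons, List.length_cons, Nat.succ_mul]
      omega
  have h₁ := key l' (fun a ha => hl'.subset ha) (s c)
  have h₂ := he c
  have h₃ := hd c
  have h₄ := Enc.length_le_size (l c)
  have h₅ := hl'.length_le
  have h₆ := Nat.mul_le_mul_right (B.eval ((enc c).size + d.eval (enc c).size + 1))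
    (show l'.length ≤ d.eval (enc c).size by omega)
  simp only [Polynomial.eval_add, Polynomial.eval_comp, Polynomial.eval_one, Polynomial.eval_mul,
    Polynomial.eval_X]
  omega

@[fun_prop]
theorem listReverse {l : γ → List α} (hl : PolyFn l) : PolyFn fun c => (l c).reverse := by
  have := foldl_of_growth (g := fun (_ : γ) (s : List α) a => a :: s) (l := l) (s := fun _ => [])
    (by fun_prop) hl (by fun_prop) ⟨Polynomial.X + 1, fun c s a => by
      simp only [Enc.size_cons, Enc.size_pair, Polynomial.eval_add, Polynomial.eval_X,
        Polynomial.eval_one]; omega⟩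
  simpa using this

@[fun_prop]
theorem listAppend {l m : γ → List α} (hl : PolyFn l) (hm : PolyFn m) :
    PolyFn fun c => l c ++ m c := by
  have := foldl_of_growth (g := fun (_ : γ) (s : List α) a => a :: s) (l := fun c => (l c).reverse)
    (s := m) (by fun_prop) (by fun_prop) hm ⟨Polynomial.X + 1, fun c s a => by
      simp only [Enc.size_cons, Enc.size_pair, Polynomial.eval_add, Polynomial.eval_X,
        Polynomial.eval_one]; omega⟩
  simpa using this

@[fun_prop]
theorem listFlatMap {l : γ → List α} {f : γ → α → List β} (hl : PolyFn l)
    (hf : PolyFn fun p : γ × α => f p.1 p.2) : PolyFn fun c => (l c).flatMap (f c) := by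
  obtain ⟨b, hb⟩ := hf.size_le
  have := foldl_of_growth (g := fun (c : γ) (s : List β) a => s ++ f c a) (l := l)
    (s := fun _ => []) (listAppend (by fun_prop) (comp (f := fun p : γ × α => f p.1 p.2)
      (g := fun p : γ × List β × α => (p.1, p.2.2)) hf (by fun_prop))) hl (by fun_prop)
    ⟨b, fun c s a => by
      have h₁ := hb (c, a)
      have h₂ := Enc.size_append s (f c a)
      dsimp only at h₁
      omega⟩
  convert this using 2 with c
  generalize hm : l c = m
  have key : ∀ (m : List α) (s : List β),
      m.foldl (fun s a => s ++ f c a) s = s ++ m.flatMap (f c) := by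
    intro m
    induction m with
    | nil => simp
    | cons a m ih => intro s; simp [ih]
  simp [key]

@[fun_prop]
theorem listMap {l : γ → List α} {f : γ → α → β} (hl : PolyFn l)
    (hf : PolyFn fun p : γ × α => f p.1 p.2) : PolyFn fun c => (l c).map (f c) := by
  have := listFlatMap (f := fun c a => [f c a]) hl (listCons hf (const []))
  convert this using 2 with c
  exact List.map_eq_flatMap

@[fun_prop]
theorem optionToList {o : γ → Option α} (ho : PolyFn o) : PolyFn fun c => (o c).toList :=
  comp (reinterpret fun _ => rfl) ho

@[fun_prop]
theorem optionSome {f : γ → α} (hf : PolyFn f) : PolyFn fun c => some (f c) :=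
  join hf (const ()) fun _ => rfl

@[fun_prop]
theorem listFilterMap {l : γ → List α} {f : γ → α → Option β} (hl : PolyFn l)
    (hf : PolyFn fun p : γ × α => f p.1 p.2) : PolyFn fun c => (l c).filterMap (f c) := by
  have := listFlatMap (f := fun c a => (f c a).toList) hl (optionToList hf)
  convert this using 2 with c
  rw [List.filterMap_eq_flatMap_toList]

@[fun_prop]
theorem listHead? {l : γ → List α} (hl : PolyFn l) : PolyFn fun c => (l c).head? := by
  have := listCases (f := fun _ => none) (g := fun _ a _ => some a) hl (const none) (by fun_prop)
  convert this using 2 with c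
  cases l c <;> rfl

@[fun_prop]
theorem boolNot {f : γ → Bool} (hf : PolyFn f) : PolyFn fun c => !(f c) := by
  refine branch hf (const false) (const true) (fun a h => ?_) (fun a h => ?_) <;>
    cases hfa : f a <;> simp [hfa, enc] at h ⊢

@[fun_prop]
theorem boolAnd {f g : γ → Bool} (hf : PolyFn f) (hg : PolyFn g) : PolyFn fun c => f c && g c := by
  refine branch hf hg (const false) (fun a h => ?_) (fun a h => ?_) <;>
    cases hfa : f a <;> simp [hfa, enc] at h ⊢

@[fun_prop]
theorem boolOr {f g : γ → Bool} (hf : PolyFn f) (hg : PolyFn g) : PolyFn fun c => f c || g c := by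
  refine branch hf (const true) hg (fun a h => ?_) (fun a h => ?_) <;>
    cases hfa : f a <;> simp [hfa, enc] at h ⊢

@[fun_prop]
theorem listAny {l : γ → List α} {f : γ → α → Bool} (hl : PolyFn l)
    (hf : PolyFn fun p : γ × α => f p.1 p.2) : PolyFn fun c => (l c).any (f c) := by
  have := foldl_of_growth (g := fun (c : γ) (s : Bool) a => s || f c a) (l := l)
    (s := fun _ => false) (boolOr (by fun_prop) (comp (f := fun p : γ × α => f p.1 p.2)
      (g := fun p : γ × Bool × α => (p.1, p.2.2)) hf (by fun_prop))) hl (by fun_prop)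
    ⟨3, fun c s a => (Enc.size_bool _).trans (by simp)⟩
  convert this using 2 with c
  have key : ∀ (m : List α) (s : Bool), m.foldl (fun s a => s || f c a) s = (s || m.any (f c)) := by
    intro m
    induction m with
    | nil => simp
    | cons a m ih => intro s; simp [ih, Bool.or_assoc]
  simp [key]

@[fun_prop]
theorem natSub {f g : γ → ℕ} (hf : PolyFn f) (hg : PolyFn g) : PolyFn fun c => f c - g c := by
  have hu : PolyFn fun c => List.replicate (g c) () :=
    comp (f := fun n => List.replicate n ()) (reinterpret fun n => (Enc.nat_eq_list n).symm) hg
  have := foldl_of_growth (g := fun (_ : γ) (s : ℕ) (_ : Unit) => s.pred) (l := fun c => _) (s := f)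
    (by fun_prop) hu hf ⟨0, fun c s a => by
      simp only [Enc.size_nat, Nat.pred_eq_sub_one, Polynomial.eval_zero]; omega⟩
  convert this using 2 with c
  have key : ∀ (n s : ℕ), (List.replicate n ()).foldl (fun s _ => s.pred) s = s - n := by
    intro n
    induction n with
    | zero => simp
    | succ n ih => intro s; simp only [List.replicate_succ, List.foldl_cons, ih]; simp; omega
  rw [key]

theorem natIsZero {f : γ → ℕ} (hf : PolyFn f) : PolyFn fun c => decide (f c = 0) := by
  refine branch hf (const false) (const true) (fun a h => ?_) (fun a h => ?_) <;>
    cases hfa : f a <;> simp [hfa, enc, Data.ofNat] at h ⊢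

@[fun_prop]
theorem natEq {f g : γ → ℕ} (hf : PolyFn f) (hg : PolyFn g) :
    PolyFn fun c => decide (f c = g c) := by
  have := boolAnd (natIsZero (natSub hf hg)) (natIsZero (natSub hg hf))
  convert this using 2 with c
  rw [← Bool.decide_and]
  congr 1
  simp only [eq_iff_iff]; omega

-- The fold over the first name consumes the second one, and a flag records agreement so far. At the
-- end nothing of the second name may be left.
@[fun_prop]
theorem varEq {f g : γ → Var} (hf : PolyFn f) (hg : PolyFn g) :
    PolyFn fun c => decide (f c = g c) := by
  have hstep : PolyFn fun p : γ × (Bool × Var) × ℕ => (p.2.1.1 && p.2.1.2.head?.any (· = p.2.2),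
      p.2.1.2.tail) := by
    have := optionCases (γ := ℕ) (o := fun p : γ × (Bool × Var) × ℕ => p.2.1.2.head?)
      (f := fun _ => false) (g := fun p => decide (p.2 = p.1.2.2)) (by fun_prop) (by fun_prop)
      (by fun_prop)
    refine prodMk (boolAnd (by fun_prop) ?_) (by fun_prop)
    convert this using 2 with p
    cases p.2.1.2.head? <;> rfl
  have := foldl_of_growth (g := fun (_ : γ) (s : Bool × Var) a =>
      (s.1 && s.2.head?.any (· = a), s.2.tail)) (l := f) (s := fun c => (true, g c)) hstep hf
      (by fun_prop) ⟨3, fun c s a => by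
        have h₁ := Enc.size_bool (s.1 && s.2.head?.any (· = a))
        have h₂ : (enc s.2.tail).size ≤ (enc s.2).size := by
          cases s.2
          · rfl
          · simp only [List.tail_cons, Enc.size_cons]; omega
        have h₃ : (enc s).size = (enc s.1).size + (enc s.2).size + 1 := rfl
        simp only [Enc.size_pair, h₃, Polynomial.eval_ofNat]
        omega⟩
  have hend : PolyFn fun q : Bool × Var => (q.1 && !(q.2.head?.any fun _ => true)) := by
    have := optionCases (γ := ℕ) (o := fun p : Bool × Var => p.2.head?)
      (f := fun _ => false) (g := fun _ => true) (by fun_prop) (by fun_prop) (by fun_prop)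
    refine boolAnd (by fun_prop) (boolNot ?_)
    convert this using 2 with p
    cases p.2.head? <;> rfl
  convert hend.comp this using 2 with c
  have key : ∀ (l m : Var) (b : Bool), (let q := l.foldl (fun (s : Bool × Var) a =>
      (s.1 && s.2.head?.any (· = a), s.2.tail)) (b, m)
      (q.1 && !(q.2.head?.any fun _ => true))) = (b && decide (l = m)) := by
    intro l
    induction l with
    | nil => intro m b; cases m <;> simp
    | cons a l ih =>
      intro m b
      rw [List.foldl_cons]
      rw [ih]
      cases m with
      | nil => simp
      | cons x m =>
        rw [Bool.eq_iff_iff]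
        simp [eq_comm (a := x), and_assoc]
        exact fun _ _ => decide_eq_true_iff
  rw [key]
  simp

@[fun_prop]
theorem varMem {f : γ → Var} {l : γ → List Var} (hf : PolyFn f) (hl : PolyFn l) :
    PolyFn fun c => decide (f c ∈ l c) := by
  have := listAny (f := fun c v => decide (v = f c)) hl
    (varEq (by fun_prop) (comp hf (by fun_prop)))
  convert this using 2 with c
  rw [Bool.eq_iff_iff]
  simp

@[fun_prop]
theorem instLookup {f : γ → Var} {l : γ → List (Var × β)} (hf : PolyFn f) (hl : PolyFn l) :
    PolyFn fun c => (l c).lookup (f c) := by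
  have : PolyFn fun c => ((l c).filterMap fun p =>
      if p.1 = f c then some p.2 else none).head? := by
    refine listHead? (listFilterMap hl (ite (varEq (by fun_prop) (comp hf (by fun_prop)))
      (by fun_prop) (by fun_prop)))
  convert this using 2 with c
  induction l c with
  | nil => rfl
  | cons p m ih =>
    obtain ⟨v, b⟩ := p
    by_cases h : v = f c
    · subst h; simp
    · have h' : (f c == v) = false := by simpa using fun e => h e.symm
      simp [List.lookup_cons, h, h', ih]

@[fun_prop]
theorem listZipIdx {l : γ → List α} (hl : PolyFn l) : PolyFn fun c => (l c).zipIdx := by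
  have key : ∀ (m : List α), m.foldl (fun (s : ℕ × List (α × ℕ)) a =>
      (s.1 + 1, s.2 ++ [(a, s.1)])) (0, []) = (m.length, m.zipIdx) := by
    intro m
    induction m using List.reverseRecOn with
    | nil => rfl
    | append_singleton m a ih => simp [ih, List.zipIdx_append]
  have hsize : ∀ (m : List α) (i : ℕ), (enc (m.zipIdx i)).size ≤
      (enc m).size + m.length * (2 * (i + m.length) + 2) := by
    intro m
    induction m with
    | nil => intro i; simp [Enc.size_nil]
    | cons a m ih =>
      intro i
      have := ih (i + 1)
      simp only [List.zipIdx_cons, Enc.size_cons, Enc.size_pair, Enc.size_nat, List.length_cons]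
      nlinarith
  obtain ⟨d, hd⟩ := hl.size_le
  -- The amount added in a round contains the running index in unary. It depends on the accumulator
  -- and not only on the element, so `foldl_of_growth` does not apply and the accumulators are
  -- bounded directly.
  have := foldl (g := fun (_ : γ) (s : ℕ × List (α × ℕ)) a => (s.1 + 1, s.2 ++ [(a, s.1)]))
    (l := l) (s := fun _ => (0, [])) (by fun_prop) hl (by fun_prop)
    ⟨2 * d + 2 + d + d * (2 * d + 2), fun c l' hl' => by
      rw [key]
      have h₁ := (Enc.size_prefix_le hl').trans (hd c)
      have h₂ := Enc.length_le_size l'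
      have h₃ := hsize l' 0
      have h₄ : l'.length * (2 * (0 + l'.length) + 2) ≤
          d.eval (enc c).size * (2 * d.eval (enc c).size + 2) :=
        Nat.mul_le_mul (by omega) (by omega)
      simp only [Enc.size_pair, Enc.size_nat, Polynomial.eval_add, Polynomial.eval_mul,
        Polynomial.eval_ofNat]
      omega⟩
  convert snd this using 2 with c
  rw [key]

@[fun_prop]
theorem listRange {f : γ → ℕ} (hf : PolyFn f) : PolyFn fun c => List.range (f c) := by
  have hu : PolyFn fun c => List.replicate (f c) () :=
    comp (f := fun n => List.replicate n ()) (reinterpret fun n => (Enc.nat_eq_list n).symm) hf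
  have : PolyFn fun c => ((List.replicate (f c) ()).zipIdx).map fun p => p.2 :=
    listMap (listZipIdx hu) (by fun_prop)
  convert this using 2 with c
  rw [List.range_eq_range']
  exact (List.length_replicate (n := f c) (a := ()) ▸
    List.zipIdx_map_snd 0 (List.replicate (f c) ())).symm

@[fun_prop]
theorem listLength {l : γ → List α} (hl : PolyFn l) : PolyFn fun c => (l c).length := by
  have : PolyFn fun c => (l c).map fun _ => () := by fun_prop
  convert comp (f := fun m : List Unit => m.length) (reinterpret fun m => ?_) this using 2 with c
  · simp
  · rw [Enc.nat_eq_list]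
    congr 1
    exact (List.eq_replicate_iff.2 ⟨rfl, fun u _ => Subsingleton.elim u ()⟩).symm

end PolyFn

/-! ### Polynomial time: mechanisms, instances and the objective model -/

namespace PolyFn

variable {γ : Type} [Enc γ]

@[fun_prop]
theorem mechExo {θ : γ → List ℚ≥0} (h : PolyFn θ) : PolyFn fun c => Mech.exo (θ c) :=
  join (const ()) h fun _ => rfl

@[fun_prop]
theorem mechEndo {pa : γ → List Var} {k : γ → ℕ} {rows : γ → List (List ℕ × ℕ)}
    (hp : PolyFn pa) (hk : PolyFn k) (hr : PolyFn rows) :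
    PolyFn fun c => Mech.endo (pa c) (k c) (rows c) :=
  join (const [()]) (prodMk hp (prodMk hk hr)) fun _ => rfl

@[fun_prop]
theorem mechIsExo {m : γ → Mech} (hm : PolyFn m) : PolyFn fun c => (m c).IsExo := by
  have := mechCases (f := fun _ => true) (g := fun _ => false) hm (const _) (const _)
  convert this using 2 with c
  cases m c <;> rfl

@[fun_prop]
theorem mechCard {m : γ → Mech} (hm : PolyFn m) : PolyFn fun c => (m c).card := by
  have := mechCases (f := fun p => p.2.length) (g := fun p => p.2.2.1) hm
    (by fun_prop) (by fun_prop)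
  convert this using 2 with c
  cases m c <;> rfl

@[fun_prop]
theorem memExoVars {G : γ → SCM} {v : γ → Var} (hG : PolyFn G) (hv : PolyFn v) :
    PolyFn fun c => decide (v c ∈ (G c).exoVars) := by
  have : PolyFn fun c => (G c).any fun n => (n.2.IsExo && decide (n.1 = v c)) :=
    listAny hG (by fun_prop)
  convert this using 2 with c
  rw [Bool.eq_iff_iff]
  rw [decide_eq_true_iff]
  simp [SCM.exoVars, and_comm]

@[fun_prop]
theorem copyVar {G : γ → SCM} {U : γ → List Var} {i j : γ → ℕ} {v : γ → Var} (hG : PolyFn G)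
    (hU : PolyFn U) (hi : PolyFn i) (hj : PolyFn j) (hv : PolyFn v) :
    PolyFn fun c => Objective.copyVar (G c) (U c) (i c) (j c) (v c) := by
  unfold Objective.copyVar Objective.unitVar Objective.exoVar Objective.endoVar
  fun_prop

@[fun_prop]
theorem world {G : γ → SCM} {U : γ → List Var} {n i j : γ → ℕ} {act out : γ → Inst}
    (hG : PolyFn G) (hU : PolyFn U) (hn : PolyFn n) (hi : PolyFn i) (hj : PolyFn j)
    (ha : PolyFn act) (ho : PolyFn out) :
    PolyFn fun c => Objective.world (G c) (U c) (n c) (i c) (j c) (act c) (out c) := by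
  refine listFilterMap hG ?_
  -- The three forms of a copied mechanism: set by the intervention (`h₁`), unchanged (`h₂`), mixed
  -- with a constant (`h₃`).
  have h₁ : PolyFn fun p : ((γ × Var × Mech) × List Var × ℕ × List (List ℕ × ℕ)) × ℕ =>
      Mech.exo (List.map (fun a => if a = p.2 then 1 else 0) (List.range p.1.2.2.1)) := by
    fun_prop
  have h₂ : PolyFn fun p : (γ × Var × Mech) × List Var × ℕ × List (List ℕ × ℕ) =>
      Mech.endo (p.2.1.map (Objective.copyVar (G p.1.1) (U p.1.1) (i p.1.1) (j p.1.1))) p.2.2.1 p.2.2.2 := by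
    fun_prop
  have h₃ : PolyFn fun p : ((γ × Var × Mech) × List Var × ℕ × List (List ℕ × ℕ)) × ℕ =>
      Mech.endo (Objective.mixVar :: p.1.2.1.map
        (Objective.copyVar (G p.1.1.1) (U p.1.1.1) (i p.1.1.1) (j p.1.1.1))) p.1.2.2.1
        (p.1.2.2.2.flatMap fun r => (List.range (n p.1.1.1)).map
          fun h => (h :: r.1, if h = i p.1.1.1 then r.2 else p.2)) := by
    fun_prop
  have h₄ := optionCases (o := fun p : (γ × Var × Mech) × List Var × ℕ × List (List ℕ × ℕ) =>
    (act p.1.1).lookup p.1.2.1) (by fun_prop) (optionCases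
      (o := fun p : (γ × Var × Mech) × List Var × ℕ × List (List ℕ × ℕ) =>
        (out p.1.1).lookup p.1.2.1) (by fun_prop) h₂ h₃) h₁
  have h₅ := mechCases (m := fun p : γ × Var × Mech => p.2.2)
    (f := fun _ => (none : Option (Var × Mech))) (by fun_prop) (by fun_prop)
    (optionSome (prodMk (f := fun p => Objective.endoVar (i p.1.1) (j p.1.1) p.1.2.1) (by unfold Objective.endoVar; fun_prop) h₄))
  convert h₅ using 2 with p
  obtain ⟨c, v, m⟩ := p
  cases m with
  | exo θ => rfl
  | endo pa k rows =>
    dsimp only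
    cases (act c).lookup v <;> cases (out c).lookup v <;> rfl

@[fun_prop]
theorem usTuple {I : γ → USInput} (h : PolyFn I) :
    PolyFn fun c => ((I c).G, (I c).U, (I c).L) :=
  comp (f := fun I : USInput => (I.G, I.U, I.L)) (reinterpret fun _ => rfl) h

@[fun_prop]
theorem usG {I : γ → USInput} (h : PolyFn I) : PolyFn fun c => (I c).G := fst (usTuple h)

@[fun_prop]
theorem usU {I : γ → USInput} (h : PolyFn I) : PolyFn fun c => (I c).U := fst (snd (usTuple h))

@[fun_prop]
theorem usL {I : γ → USInput} (h : PolyFn I) : PolyFn fun c => (I c).L := snd (snd (usTuple h))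

theorem usMk {G : γ → SCM} {U : γ → List Var} {L : γ → List Term} (hG : PolyFn G) (hU : PolyFn U)
    (hL : PolyFn L) : PolyFn fun c => USInput.mk (G c) (U c) (L c) :=
  comp (f := fun p : SCM × List Var × List Term => USInput.mk p.1 p.2.1 p.2.2)
    (reinterpret fun _ => rfl) (prodMk hG (prodMk hU hL))

theorem rmapTuple {I : γ → RMAPInput} (h : PolyFn I) :
    PolyFn fun c => ((I c).G, (I c).U, (I c).e₁, (I c).e₂) :=
  comp (f := fun I : RMAPInput => (I.G, I.U, I.e₁, I.e₂)) (reinterpret fun _ => rfl) h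

@[fun_prop]
theorem rmapG {I : γ → RMAPInput} (h : PolyFn I) : PolyFn fun c => (I c).G := fst (rmapTuple h)

@[fun_prop]
theorem rmapU {I : γ → RMAPInput} (h : PolyFn I) : PolyFn fun c => (I c).U :=
  fst (snd (rmapTuple h))

@[fun_prop]
theorem rmapE₁ {I : γ → RMAPInput} (h : PolyFn I) : PolyFn fun c => (I c).e₁ :=
  fst (snd (snd (rmapTuple h)))

@[fun_prop]
theorem rmapE₂ {I : γ → RMAPInput} (h : PolyFn I) : PolyFn fun c => (I c).e₂ :=
  snd (snd (snd (rmapTuple h)))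

theorem rmapMk {G : γ → SCM} {U : γ → List Var} {e₁ e₂ : γ → Inst} (hG : PolyFn G)
    (hU : PolyFn U) (h₁ : PolyFn e₁) (h₂ : PolyFn e₂) :
    PolyFn fun c => RMAPInput.mk (G c) (U c) (e₁ c) (e₂ c) :=
  comp (f := fun p : SCM × List Var × Inst × Inst => RMAPInput.mk p.1 p.2.1 p.2.2.1 p.2.2.2)
    (reinterpret fun _ => rfl) (prodMk hG (prodMk hU (prodMk h₁ h₂)))

theorem termTuple {t : γ → Term} (h : PolyFn t) :
    PolyFn fun c => ((t c).weight, (t c).x, (t c).y, (t c).v, (t c).w, (t c).e) :=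
  comp (f := fun t : Term => (t.weight, t.x, t.y, t.v, t.w, t.e)) (reinterpret fun _ => rfl) h

@[fun_prop]
theorem termWeight {t : γ → Term} (h : PolyFn t) : PolyFn fun c => (t c).weight :=
  fst (termTuple h)

@[fun_prop]
theorem termX {t : γ → Term} (h : PolyFn t) : PolyFn fun c => (t c).x := fst (snd (termTuple h))

@[fun_prop]
theorem termY {t : γ → Term} (h : PolyFn t) : PolyFn fun c => (t c).y :=
  fst (snd (snd (termTuple h)))

@[fun_prop]
theorem termV {t : γ → Term} (h : PolyFn t) : PolyFn fun c => (t c).v :=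
  fst (snd (snd (snd (termTuple h))))

@[fun_prop]
theorem termW {t : γ → Term} (h : PolyFn t) : PolyFn fun c => (t c).w :=
  fst (snd (snd (snd (snd (termTuple h)))))

@[fun_prop]
theorem termE {t : γ → Term} (h : PolyFn t) : PolyFn fun c => (t c).e :=
  snd (snd (snd (snd (snd (termTuple h)))))

theorem termMk {weight : γ → ℚ≥0} {x y v w e : γ → Inst} (h₀ : PolyFn weight) (h₁ : PolyFn x)
    (h₂ : PolyFn y) (h₃ : PolyFn v) (h₄ : PolyFn w) (h₅ : PolyFn e) :
    PolyFn fun c => Term.mk (weight c) (x c) (y c) (v c) (w c) (e c) :=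
  comp (f := fun p : ℚ≥0 × Inst × Inst × Inst × Inst × Inst =>
      Term.mk p.1 p.2.1 p.2.2.1 p.2.2.2.1 p.2.2.2.2.1 p.2.2.2.2.2)
    (reinterpret fun _ => rfl)
    (prodMk h₀ (prodMk h₁ (prodMk h₂ (prodMk h₃ (prodMk h₄ h₅)))))

/-- Selecting the nodes that carry a prior. -/
theorem exoNodes {G : γ → SCM} {f : γ × Var × List ℚ≥0 → Option (Var × Mech)} (hG : PolyFn G)
    (hf : PolyFn f) : PolyFn fun c => (G c).filterMap fun nd =>
      Mech.casesOn (motive := fun _ => Option (Var × Mech)) nd.2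
        (fun θ => f (c, nd.1, θ)) fun _ _ _ => none := by
  refine listFilterMap hG ?_
  exact mechCases (m := fun p : γ × Var × Mech => p.2.2)
    (f := fun q => f (q.1.1, q.1.2.1, q.2)) (g := fun _ => none)
    (by fun_prop) (by fun_prop) (by fun_prop)

@[fun_prop]
theorem component {G : γ → SCM} {U : γ → List Var} {n i : γ → ℕ} {t : γ → Term}
    (hG : PolyFn G) (hU : PolyFn U) (hn : PolyFn n) (hi : PolyFn i) (ht : PolyFn t) :
    PolyFn fun c => Objective.component (G c) (U c) (n c) (i c) (t c) := by
  have h := exoNodes (f := fun q => if q.2.1 ∈ U q.1 then none else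
      some (2 :: i q.1 :: q.2.1, Mech.exo q.2.2)) hG (by fun_prop)
  unfold Objective.component
  refine listAppend (listAppend (listAppend ?_ (by fun_prop)) (by fun_prop)) (by fun_prop)
  convert h using 3 with c nd
  obtain ⟨v, m⟩ := nd
  cases m <;> rfl

theorem model : PolyFn Objective.model := by
  have h := exoNodes (γ := USInput) (G := fun I => I.G) (f := fun q => if q.2.1 ∈ q.1.U then
      some (1 :: q.2.1, Mech.exo q.2.2) else none) (by fun_prop) (by fun_prop)
  unfold Objective.model Objective.mixVar
  refine listAppend (listCons (by fun_prop) ?_) (by fun_prop)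
  convert h using 3 with c nd
  obtain ⟨v, m⟩ := nd
  cases m <;> rfl

@[fun_prop]
theorem unitVar {v : γ → Var} (h : PolyFn v) : PolyFn fun c => Objective.unitVar (v c) := by
  unfold Objective.unitVar
  fun_prop

@[fun_prop]
theorem objectiveCopyInst {i j : γ → ℕ} {e : γ → Inst} (hi : PolyFn i) (hj : PolyFn j)
    (he : PolyFn e) : PolyFn fun c => Objective.copyInst (i c) (j c) (e c) := by
  unfold Objective.copyInst Objective.endoVar
  fun_prop

theorem toRMAP : PolyFn Objective.toRMAP :=
  rmapMk model (by fun_prop) (by fun_prop) (by fun_prop)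

end PolyFn

theorem polyTime_toRMAP : OptProblem.PolyTime UnitSelection RMAP Objective.toRMAP := by
  obtain ⟨p, b, h⟩ := PolyFn.toRMAP
  exact ⟨p, b, fun I _ => h I⟩

/-! ### From Reverse-MAP to unit selection -/

/-- A distribution on `k` states (`k ≠ 0`) without null states. -/
def dyadicPrior (k : ℕ) : List ℚ≥0 :=
  (1 / 2) ^ (k - 1) :: (List.range (k - 1)).map fun i => (1 / 2) ^ (i + 1)

namespace Targets

/-- The original of a variable. -/
def origVar (v : Var) : Var := 0 :: v

/-- An endogenous copy of a variable. -/
def copyVar (v : Var) : Var := 1 :: v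

/-- An independent exogenous variable with the states of the variable `v`. -/
def targetVar (v : Var) : Var := 2 :: v

/-- Tells whether the independent variable has the same state as the original. -/
def matchVar (v : Var) : Var := 3 :: v

def origMech : Mech → Mech
  | Mech.exo θ => Mech.exo θ
  | Mech.endo pa k rows => Mech.endo (pa.map origVar) k rows

def copyMech (v : Var) (k : ℕ) : Mech :=
  Mech.endo [origVar v] k ((List.range k).map fun a => ([a], a))

def matchMech (v : Var) (k : ℕ) : Mech :=
  Mech.endo [origVar v, targetVar v] 2 ((List.range k).flatMap fun a =>
    (List.range k).map fun b => ([a, b], if a = b then 1 else 0))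

/-- All variables receive the four nodes, whether or not they are targets; superfluous roots do not
affect the quotient. The copies exist because outcomes and evidence must be endogenous, whereas the
original instantiations may concern exogenous variables. -/
def model (G : SCM) : SCM :=
  (G.map fun n => (origVar n.1, origMech n.2)) ++
  (G.map fun n => (copyVar n.1, copyMech n.1 n.2.card)) ++
  (G.map fun n => (targetVar n.1, Mech.exo (dyadicPrior n.2.card))) ++
  G.map fun n => (matchVar n.1, matchMech n.1 n.2.card)

def copyInst (e : Inst) : Inst := e.map fun c => (copyVar c.1, c.2)

/-- The unit selection problem with one summand, whose unit variables are independent variables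
that are compared with the target variables. -/
def toUS (I : RMAPInput) : USInput where
  G := model I.G
  U := I.U.map targetVar
  L := [⟨1, [], copyInst I.e₁, [], [], copyInst I.e₂ ++ I.U.map fun v => (matchVar v, 1)⟩]

end Targets

theorem Nat.bits_two_pow (n : ℕ) : Nat.bits (2 ^ n) = List.replicate n false ++ [true] := by
  induction n with
  | zero => simp
  | succ n ih =>
    rw [pow_succ', Nat.bit0_bits _ (by positivity), ih, List.replicate_succ, List.cons_append]

/-! ### Polynomial time: the reduction from Reverse-MAP -/

namespace PolyFn

variable {γ : Type} [Enc γ]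

-- The numerator is `1` and the denominator is written in binary as `n` zeros followed by a one.
-- Dyadic priors can thus be written down without any arithmetic on binary numbers.
@[fun_prop]
theorem halfPow {n : γ → ℕ} (h : PolyFn n) : PolyFn fun c => (1 / 2 : ℚ≥0) ^ n c := by
  have hu : PolyFn fun c => (List.range (n c)).map fun _ => false := by fun_prop
  refine join (const [true]) (listAppend hu (const [true])) fun c => ?_
  have hd' : (1 / 2 : ℚ≥0).den = 2 := by
    rw [← NNRat.den_coe]; push_cast; norm_num
  have hn' : (1 / 2 : ℚ≥0).num = 1 := by
    rw [NNRat.num]; push_cast; norm_num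
  have hd : ((1 / 2 : ℚ≥0) ^ n c).den = 2 ^ n c := by
    rw [NNRat.den_pow, hd']
  have hn : ((1 / 2 : ℚ≥0) ^ n c).num = 1 := by
    rw [NNRat.num_pow, hn', one_pow]
  change Data.cons (Data.ofNatBinary _) (Data.ofNatBinary _) = _
  rw [hd, hn]
  unfold Data.ofNatBinary
  rw [Nat.bits_two_pow, List.map_const', List.length_range]
  rfl

@[fun_prop]
theorem dyadicPrior {k : γ → ℕ} (h : PolyFn k) : PolyFn fun c => dyadicPrior (k c) := by
  unfold _root_.dyadicPrior
  fun_prop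

@[fun_prop]
theorem origVar {v : γ → Var} (h : PolyFn v) : PolyFn fun c => Targets.origVar (v c) := by
  unfold Targets.origVar
  fun_prop

@[fun_prop]
theorem targetsCopyVar {v : γ → Var} (h : PolyFn v) : PolyFn fun c => Targets.copyVar (v c) := by
  unfold Targets.copyVar
  fun_prop

@[fun_prop]
theorem targetVar {v : γ → Var} (h : PolyFn v) : PolyFn fun c => Targets.targetVar (v c) := by
  unfold Targets.targetVar
  fun_prop

@[fun_prop]
theorem matchVar {v : γ → Var} (h : PolyFn v) : PolyFn fun c => Targets.matchVar (v c) := by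
  unfold Targets.matchVar
  fun_prop

@[fun_prop]
theorem targetsCopyInst {e : γ → Inst} (he : PolyFn e) :
    PolyFn fun c => Targets.copyInst (e c) := by
  unfold Targets.copyInst
  fun_prop

@[fun_prop]
theorem origMech {m : γ → Mech} (hm : PolyFn m) : PolyFn fun c => Targets.origMech (m c) := by
  have := mechCases (f := fun p => Mech.exo p.2)
    (g := fun p => Mech.endo (p.2.1.map Targets.origVar) p.2.2.1 p.2.2.2) hm (by fun_prop)
    (by fun_prop)
  convert this using 2 with c
  cases m c <;> rfl

@[fun_prop]
theorem targetsModel {G : γ → SCM} (hG : PolyFn G) : PolyFn fun c => Targets.model (G c) := by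
  unfold Targets.model Targets.matchMech Targets.copyMech
  fun_prop

theorem toUS : PolyFn Targets.toUS :=
  usMk (by fun_prop) (by fun_prop) (listCons (termMk (by fun_prop) (by fun_prop) (by fun_prop)
    (by fun_prop) (by fun_prop) (by fun_prop)) (by fun_prop))

end PolyFn

theorem polyTime_toUS : OptProblem.PolyTime RMAP UnitSelection Targets.toUS := by
  obtain ⟨p, b, h⟩ := PolyFn.toUS
  exact ⟨p, b, fun I _ => h I⟩

/-! ### Product distributions -/

/-- The expectation of `F` when the variables of `l` are drawn independently from their
distributions and the others are given by `a`. -/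
def expect : List (Var × List ℚ≥0) → ((Var → ℕ) → ℚ≥0) → (Var → ℕ) → ℚ≥0
  | [], F, a => F a
  | (v, θ) :: l, F, a =>
      ∑ s ∈ Finset.range θ.length, θ.getD s 0 * expect l F (Function.update a v s)

/-- `b` has positive probability when the variables of `l` are drawn from their distributions and
the others are given by `a`. -/
def InSupport (l : List (Var × List ℚ≥0)) (a b : Var → ℕ) : Prop :=
  (∀ v, v ∉ l.map Prod.fst → b v = a v) ∧ ∀ p ∈ l, p.2.getD (b p.1) 0 ≠ 0

/-- `F` does not depend on the variable `v`. -/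
def IndepOf (F : (Var → ℕ) → ℚ≥0) (v : Var) : Prop := ∀ a s, F (Function.update a v s) = F a

theorem List.lt_length_of_getD_ne_zero {θ : List ℚ≥0} {s : ℕ} (h : θ.getD s 0 ≠ 0) :
    s < θ.length := by
  by_contra hs
  exact h (List.getD_eq_default _ _ (not_lt.1 hs))

theorem List.lookup_eq_some_iff_mem {α β : Type} [BEq α] [LawfulBEq α] {l : List (α × β)}
    (hl : (l.map Prod.fst).Nodup) {a : α} {b : β} : l.lookup a = some b ↔ (a, b) ∈ l := by
  induction l with
  | nil => simp
  | cons p l ih =>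
    obtain ⟨c, d⟩ := p
    simp only [List.map_cons, List.nodup_cons] at hl
    by_cases h : a = c
    · subst h
      simp only [List.lookup_cons, beq_self_eq_true, List.mem_cons, Prod.mk.injEq, true_and,
        Option.some.injEq]
      refine ⟨fun h => Or.inl h.symm, ?_⟩
      rintro (h | h)
      · exact h.symm
      · exact absurd (List.mem_map_of_mem (f := Prod.fst) h) hl.1
    · have h' : (a == c) = false := by simpa using h
      simp [List.lookup_cons, h', ih hl.2, h]

theorem List.lookup_eq_none_iff_notMem {α β : Type} [BEq α] [LawfulBEq α] {l : List (α × β)}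
    {a : α} : l.lookup a = none ↔ a ∉ l.map Prod.fst := by
  induction l with
  | nil => simp
  | cons p l ih =>
    obtain ⟨c, d⟩ := p
    by_cases h : a = c
    · subst h; simp
    · have h' : (a == c) = false := by simpa using h
      simp [List.lookup_cons, h', h] at ih ⊢
      exact ih

section expect

variable {l m : List (Var × List ℚ≥0)} {F F' g : (Var → ℕ) → ℚ≥0} {a b : Var → ℕ}

theorem expect_append (l m : List (Var × List ℚ≥0)) (F : (Var → ℕ) → ℚ≥0) (a : Var → ℕ) :
    expect (l ++ m) F a = expect l (expect m F) a := by
  induction l generalizing a with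
  | nil => rfl
  | cons p l ih => simp only [List.cons_append, expect, ih]

/-- Since the names are distinct, no draw is overwritten by a later one, so a state of nonzero
weight at the time of drawing is still the state in `b`. -/
theorem expect_congr (hl : (l.map Prod.fst).Nodup) (h : ∀ b, InSupport l a b → F b = F' b) :
    expect l F a = expect l F' a := by
  induction l generalizing a with
  | nil => exact h a ⟨fun _ _ => rfl, by simp⟩
  | cons p l ih =>
    obtain ⟨v, θ⟩ := p
    simp only [List.map_cons, List.nodup_cons] at hl
    refine Finset.sum_congr rfl fun s _ => ?_
    by_cases hs : θ.getD s 0 = 0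
    · rw [hs, zero_mul, zero_mul]
    congr 1
    refine ih hl.2 fun b hb => h b ⟨fun w hw => ?_, ?_⟩
    · simp only [List.map_cons, List.mem_cons, not_or] at hw
      rw [hb.1 w hw.2, Function.update_of_ne hw.1]
    · intro q hq
      rcases List.mem_cons.1 hq with rfl | hq
      · rw [hb.1 v hl.1, Function.update_self]
        exact hs
      · exact hb.2 q hq

theorem expect_mul_left (hg : ∀ v ∈ l.map Prod.fst, IndepOf g v) :
    expect l (fun b => g b * F b) a = g a * expect l F a := by
  induction l generalizing a with
  | nil => rfl
  | cons p l ih =>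
    obtain ⟨v, θ⟩ := p
    simp only [List.map_cons, List.mem_cons, forall_eq_or_imp] at hg
    simp only [expect, Finset.mul_sum]
    refine Finset.sum_congr rfl fun s _ => ?_
    rw [ih hg.2, hg.1]
    ring

theorem List.sum_range_getD (θ : List ℚ≥0) :
    ∑ s ∈ Finset.range θ.length, θ.getD s 0 = θ.sum := by
  induction θ with
  | nil => simp
  | cons x θ ih =>
    rw [List.length_cons, Finset.sum_range_succ', List.sum_cons, ← ih, add_comm]
    simp

theorem expect_one (hl : ∀ p ∈ l, p.2.sum = 1) : expect l (fun _ => 1) a = 1 := by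
  induction l generalizing a with
  | nil => rfl
  | cons p l ih =>
    simp only [List.mem_cons, forall_eq_or_imp] at hl
    simp only [expect, ih hl.2, mul_one]
    rw [List.sum_range_getD, hl.1]

theorem expect_of_indep (hl : ∀ p ∈ l, p.2.sum = 1) (hg : ∀ v ∈ l.map Prod.fst, IndepOf g v) :
    expect l g a = g a := by
  have := expect_mul_left (F := fun _ => 1) (a := a) hg
  simpa [expect_one hl] using this

theorem IndepOf.expect {v : Var} (hF : IndepOf F v) (hv : v ∉ l.map Prod.fst) :
    IndepOf (expect l F) v := by
  intro a s
  induction l generalizing a with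
  | nil => exact hF a s
  | cons p l ih =>
    obtain ⟨w, θ⟩ := p
    simp only [List.map_cons, List.mem_cons, not_or] at hv
    simp only [_root_.expect]
    refine Finset.sum_congr rfl fun t _ => ?_
    rw [Function.update_comm hv.1, ih hv.2]

/-- Transports expectations over copies of exogenous variables inside a larger model back to the
original model. -/
theorem expect_map {f : Var → Var} (hf : Function.Injective f) :
    expect (l.map fun p => (f p.1, p.2)) (fun b => F (b ∘ f)) a = expect l F (a ∘ f) := by
  induction l generalizing a with
  | nil => rfl
  | cons p l ih =>
    simp only [List.map_cons, expect, ih, Function.update_comp_eq_of_injective _ hf]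

theorem expect_perm (h : l.Perm m) (hl : (l.map Prod.fst).Nodup) : expect l F a = expect m F a := by
  induction h generalizing a with
  | nil => rfl
  | cons p h ih =>
    simp only [List.map_cons, List.nodup_cons] at hl
    simp only [expect, ih hl.2]
  | swap p q l =>
    simp only [List.map_cons, List.nodup_cons, List.mem_cons, not_or] at hl
    simp only [expect, Finset.mul_sum]
    rw [Finset.sum_comm]
    refine Finset.sum_congr rfl fun s _ => Finset.sum_congr rfl fun t _ => ?_
    rw [Function.update_comm hl.1.1]
    ring
  | trans h₁ h₂ ih₁ ih₂ =>
    rw [ih₁ hl, ih₂ ((h₁.map Prod.fst).nodup_iff.1 hl)]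

theorem expect_ne_zero (hb : InSupport l a b) (hF : F b ≠ 0) : expect l F a ≠ 0 := by
  induction l generalizing a with
  | nil =>
    have : b = a := funext fun v => hb.1 v (by simp)
    exact this ▸ hF
  | cons p l ih =>
    obtain ⟨v, θ⟩ := p
    have h₁ : θ.getD (b v) 0 ≠ 0 := hb.2 (v, θ) (by simp)
    have h₂ : InSupport l (Function.update a v (b v)) b := by
      refine ⟨fun w hw => ?_, fun p hp => hb.2 p (by simp [hp])⟩
      by_cases h : w = v
      · subst h; simp
      · rw [Function.update_of_ne h]
        exact hb.1 w (by simp only [List.map_cons, List.mem_cons, not_or]; exact ⟨h, hw⟩)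
    intro h
    simp only [expect, Finset.sum_eq_zero_iff, Finset.mem_range, mul_eq_zero] at h
    rcases h (b v) (List.lt_length_of_getD_ne_zero h₁) with h | h
    · exact h₁ h
    · exact ih h₂ h

/-- Independence of blocks. Drawing the later blocks does not affect `F i`, which can be pulled out.
What remains does not depend on the variables of block `i` and can be pulled out in turn. -/
theorem expect_flatMap {ι : Type} {c : ι → List (Var × List ℚ≥0)} {F : ι → (Var → ℕ) → ℚ≥0}
    {is : List ι}
    (h : is.Pairwise fun i j => (∀ v ∈ (c i).map Prod.fst, IndepOf (F j) v ∧ v ∉ (c j).map Prod.fst)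
      ∧ ∀ v ∈ (c j).map Prod.fst, IndepOf (F i) v) :
    expect (is.flatMap c) (fun b => (is.map fun i => F i b).prod) a =
      (is.map fun i => expect (c i) (F i) a).prod := by
  induction is generalizing a with
  | nil => rfl
  | cons i is ih =>
    rw [List.pairwise_cons] at h
    simp only [List.flatMap_cons, List.map_cons, List.prod_cons, expect_append]
    have h₁ : expect (is.flatMap c) (fun b => F i b * (is.map fun j => F j b).prod) =
        fun b => (is.map fun j => expect (c j) (F j) b).prod * F i b := by
      funext b
      rw [expect_mul_left, ih h.2, mul_comm]
      intro v hv
      simp only [List.map_flatMap, List.mem_flatMap] at hv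
      obtain ⟨j, hj, hv⟩ := hv
      exact (h.1 j hj).2 v hv
    rw [h₁, expect_mul_left, mul_comm]
    intro v hv a s
    refine congrArg List.prod (List.map_congr_left fun j hj => ?_)
    exact ((h.1 j hj).1 v hv).1.expect ((h.1 j hj).1 v hv).2 a s

end expect

/-! ### Probabilities in causal models as expectations -/

namespace SCM

/-- The exogenous variables with their distributions. -/
def priors (G : SCM) : List (Var × List ℚ≥0) :=
  G.filterMap fun
    | (v, Mech.exo θ) => some (v, θ)
    | (_, Mech.endo _ _ _) => none

/-- `IsSolution` for states of the exogenous variables that are given by a function on all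
names. -/
def Sol (G : SCM) (act : Inst) (ω x : Var → ℕ) : Prop :=
  ∀ v m, (v, m) ∈ G →
    match act.lookup v with
    | some s => x v = s
    | none =>
      match m with
      | Mech.exo _ => x v = ω v
      | Mech.endo pa _ rows => rows.lookup (pa.map x) = some (x v)

/-- In each of the worlds, the outcome is as given. -/
def Holds (G : SCM) (worlds : List (Inst × Inst)) (ω : Var → ℕ) : Prop :=
  ∀ w ∈ worlds, ∃ x, G.Sol w.1 ω x ∧ ∀ c ∈ w.2, x c.1 = c.2

/-- Extension of a function on a finite set of variables. -/
def extend {k : Var → ℕ} (S : Finset Var) (a : Var → ℕ) (ω : (v : {v // v ∈ S}) → Fin (k v)) :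
    Var → ℕ :=
  fun v => if h : v ∈ S then ω ⟨v, h⟩ else a v

open Classical in
theorem sum_extend_insert {k : Var → ℕ} {S : Finset Var} {v : Var} (hv : v ∉ S) (a : Var → ℕ)
    (H : (Var → ℕ) → ℚ≥0) :
    ∑ ω : (w : {w // w ∈ insert v S}) → Fin (k w), H (extend _ a ω) =
      ∑ s ∈ Finset.range (k v), ∑ ω : (w : {w // w ∈ S}) → Fin (k w),
        H (extend S (Function.update a v s) ω) := by
  rw [Finset.sum_range, ← Fintype.sum_prod_type']
  let e : ((w : {w // w ∈ insert v S}) → Fin (k w)) ≃ Fin (k v) × ((w : {w // w ∈ S}) → Fin (k w)) :=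
    { toFun := fun ω => (ω ⟨v, Finset.mem_insert_self _ _⟩,
        fun w => ω ⟨w, Finset.mem_insert_of_mem w.2⟩)
      invFun := fun q w => if h : w.1 = v then ⟨q.1, by rw [h]; exact q.1.2⟩ else
        q.2 ⟨w, Finset.mem_of_mem_insert_of_ne w.2 h⟩
      left_inv := by
        intro ω
        funext w
        obtain ⟨w, hw⟩ := w
        by_cases h : w = v
        · subst h; simp
        · simp [h]
      right_inv := by
        rintro ⟨s, ω⟩
        refine Prod.ext (by simp) (funext fun w => ?_)
        have : w.1 ≠ v := fun h => hv (h ▸ w.2)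
        simp [this] }
  refine Fintype.sum_equiv e _ _ fun ω => ?_
  congr 1
  funext w
  by_cases h : w = v
  · subst h; simp [extend, hv, e]
  · by_cases hw : w ∈ S <;> simp [extend, h, hw, e]

-- Induction on the list, one variable being summed out per step by `sum_extend_insert`. The product
-- of the priors is first rewritten in terms of `extend S a ω`, so that the whole summand is a
-- function of the extended states.
open Classical in
theorem sum_extend_eq_expect {k : Var → ℕ} {pr : Var → ℕ → ℚ≥0} {l : List (Var × List ℚ≥0)}
    (hl : (l.map Prod.fst).Nodup) (hk : ∀ p ∈ l, k p.1 = p.2.length)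
    (hp : ∀ p ∈ l, ∀ s, pr p.1 s = p.2.getD s 0) (S : Finset Var)
    (hS : S = (l.map Prod.fst).toFinset) (F : (Var → ℕ) → ℚ≥0) (a : Var → ℕ) :
    ∑ ω : (v : {v // v ∈ S}) → Fin (k v), (∏ v : {v // v ∈ S}, pr v (ω v)) * F (extend S a ω) =
      expect l F a := by
  have h₀ : ∀ (S : Finset Var) (a : Var → ℕ) (ω : (v : {v // v ∈ S}) → Fin (k v)),
      ∏ v : {v // v ∈ S}, pr v (ω v) = ∏ v ∈ S, pr v (extend S a ω v) := by
    intro S a ω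
    rw [← Finset.prod_coe_sort S fun v => pr v (extend S a ω v)]
    refine Finset.prod_congr rfl fun v _ => ?_
    simp [extend]
  induction l generalizing a S with
  | nil =>
    obtain rfl : S = ∅ := by simpa using hS
    simp only [expect]
    rw [Fintype.sum_eq_single (fun v => absurd v.2 (Finset.notMem_empty v.1))]
    · have : extend _ a (fun v : {v // v ∈ (∅ : Finset Var)} => (absurd v.2 (Finset.notMem_empty v.1) : Fin (k v))) = a := by
        funext v; simp [extend]
      rw [this]
      rw [Finset.prod_eq_one, one_mul]
      intro v; exact absurd v.2 (Finset.notMem_empty v.1)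
    · intro ω hω
      exact absurd (funext fun v => absurd v.2 (Finset.notMem_empty v.1)) hω
  | cons p l ih =>
    obtain ⟨v, θ⟩ := p
    simp only [List.map_cons, List.nodup_cons] at hl
    have hv : v ∉ (l.map Prod.fst).toFinset := by simpa using hl.1
    have h₁ := sum_extend_insert (k := k) hv a fun b =>
      (∏ w ∈ insert v (l.map Prod.fst).toFinset, pr w (b w)) * F b
    simp only [List.mem_cons, forall_eq_or_imp] at hk hp
    obtain rfl : S = insert v (l.map Prod.fst).toFinset := by simpa using hS
    simp only [h₀ _ a]
    refine h₁.trans ?_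
    simp only [expect, hk.1]
    refine Finset.sum_congr rfl fun s _ => ?_
    rw [← ih hl.2 hk.2 hp.2 _ rfl, Finset.mul_sum]
    refine Finset.sum_congr rfl fun ω _ => ?_
    rw [Finset.prod_insert hv, h₀ _ (Function.update a v s), ← mul_assoc]
    congr 2
    rw [← hp.1]
    congr 1
    simp [extend, hl.1]

variable {G : SCM}

theorem mem_priors {v : Var} {θ : List ℚ≥0} : (v, θ) ∈ G.priors ↔ (v, Mech.exo θ) ∈ G := by
  simp only [priors, List.mem_filterMap]
  constructor
  · rintro ⟨⟨w, m⟩, hw, h⟩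
    cases m <;> simp at h
    obtain ⟨rfl, rfl⟩ := h
    exact hw
  · exact fun h => ⟨_, h, rfl⟩

theorem exoVars_eq (G : SCM) : G.exoVars = (G.priors.map Prod.fst).toFinset := by
  unfold exoVars priors
  congr 1
  induction G with
  | nil => rfl
  | cons n G ih =>
    obtain ⟨v, m⟩ := n
    cases m with
    | exo θ => exact congrArg (List.cons v) ih
    | endo => exact ih

theorem mem_exoVars {v : Var} : v ∈ G.exoVars ↔ ∃ θ, (v, Mech.exo θ) ∈ G := by
  simp [exoVars_eq, mem_priors]

theorem mem_endoVars {v : Var} :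
    v ∈ G.endoVars ↔ ∃ pa k rows, (v, Mech.endo pa k rows) ∈ G := by
  simp only [endoVars, List.mem_toFinset, List.mem_map, List.mem_filter]
  constructor
  · rintro ⟨⟨w, m⟩, ⟨h₁, h₂⟩, rfl⟩
    cases m with
    | exo => simp [Mech.IsExo] at h₂
    | endo pa k rows => exact ⟨pa, k, rows, h₁⟩
  · rintro ⟨pa, k, rows, h⟩
    exact ⟨_, ⟨h, rfl⟩, rfl⟩

theorem mem_vars {v : Var} : v ∈ G.vars ↔ ∃ m, (v, m) ∈ G := by
  simp [vars]

theorem priors_vars_sublist (G : SCM) : (G.priors.map Prod.fst).Sublist G.vars := by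
  unfold priors vars
  induction G with
  | nil => exact List.Sublist.refl _
  | cons n G ih =>
    obtain ⟨v, m⟩ := n
    cases m with
    | exo θ => simpa using ih
    | endo => exact (by simpa using ih : List.Sublist _ (List.map Prod.fst G)).cons v

theorem WF.nodup (h : G.WF) : G.vars.Nodup := h.2.1

theorem WF.priors_nodup (h : G.WF) : (G.priors.map Prod.fst).Nodup :=
  h.nodup.sublist G.priors_vars_sublist

theorem WF.lookup (h : G.WF) {v : Var} {m : Mech} : G.lookup v = some m ↔ (v, m) ∈ G :=
  List.lookup_eq_some_iff_mem h.nodup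

theorem WF.card (h : G.WF) {v : Var} {m : Mech} (hm : (v, m) ∈ G) : G.card v = m.card := by
  unfold SCM.card
  rw [h.lookup.2 hm]

theorem WF.mech_unique (h : G.WF) {v : Var} {m m' : Mech} (hm : (v, m) ∈ G) (hm' : (v, m') ∈ G) :
    m = m' := Option.some.inj ((h.lookup.2 hm).symm.trans (h.lookup.2 hm'))

-- Replaces dependent functions on the exogenous variables of one model by functions on all names,
-- extended by `0`. In this form models with different variables can be compared by composing with a
-- renaming.
open Classical in
theorem WF.prob_eq (h : G.WF) (worlds : List (Inst × Inst)) :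
    G.prob worlds = expect G.priors (fun ω => if G.Holds worlds ω then 1 else 0) 0 := by
  rw [← sum_extend_eq_expect (k := G.card) (pr := G.prior) h.priors_nodup ?_ ?_ G.exoVars
    G.exoVars_eq]
  · unfold prob
    refine Finset.sum_congr (by congr) fun ω _ => ?_
    congr 1
    refine if_congr (forall₂_congr fun w hw => exists_congr fun x => and_congr_left fun _ => ?_)
      rfl rfl
    refine forall₃_congr fun v m hm => ?_
    cases w.1.lookup v with
    | some s => rfl
    | none =>
      cases m with
      | exo θ =>
        have hv : v ∈ G.exoVars := mem_exoVars.2 ⟨θ, hm⟩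
        simp [extend, hv]
      | endo => rfl
  · rintro ⟨v, θ⟩ hp
    exact h.card (mem_priors.1 hp)
  · rintro ⟨v, θ⟩ hp s
    unfold prior
    rw [h.lookup.2 (mem_priors.1 hp)]

/-- Induction on the rank provided by acyclicity: equal states of the parents give equal states. -/
theorem WF.sol_unique (h : G.WF) {act : Inst} {ω x y : Var → ℕ} (hx : G.Sol act ω x)
    (hy : G.Sol act ω y) : ∀ v ∈ G.vars, x v = y v := by
  obtain ⟨-, -, -, hG, rank, hrank⟩ := h
  suffices key : ∀ N v, rank v < N → v ∈ G.vars → x v = y v from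
    fun v => key _ v (Nat.lt_succ_self _)
  intro N
  induction N with
  | zero => intro v hv; omega
  | succ N ih =>
    intro v hv hvG
    obtain ⟨m, hm⟩ := mem_vars.1 hvG
    have h₁ := hx v m hm
    have h₂ := hy v m hm
    cases hact : act.lookup v with
    | some s => simp only [hact] at h₁ h₂; rw [h₁, h₂]
    | none =>
      cases m with
      | exo θ => simp only [hact] at h₁ h₂; rw [h₁, h₂]
      | endo pa k rows =>
        simp only [hact] at h₁ h₂
        have : pa.map x = pa.map y := List.map_congr_left fun p hp =>
          ih p (by have := hrank _ _ _ _ hm p hp; omega) ((hG _ _ _ _ hm).2.2.1 hp)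
        rw [this, h₂] at h₁
        exact (Option.some.inj h₁).symm

/-- All equations are evaluated in parallel, repeatedly; after `N` rounds the variables of rank
below `N` no longer change. The case without intervention suffices, since solutions of `G` under
interventions will be read off from solutions of the objective model. -/
theorem WF.exists_sol (h : G.WF) {ω : Var → ℕ} (hω : ∀ v ∈ G.exoVars, ω v < G.card v) :
    ∃ x, G.Sol [] ω x ∧ ∀ v ∈ G.vars, x v < G.card v := by
  have hwf := h
  obtain ⟨-, -, -, hG, rank, hrank⟩ := h
  let F : (Var → ℕ) → Var → ℕ := fun x v =>
    match G.lookup v with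
    | some (Mech.endo pa _ rows) => (rows.lookup (pa.map x)).getD 0
    | _ => ω v
  have hexo : ∀ x v θ, (v, Mech.exo θ) ∈ G → F x v = ω v := by
    intro x v θ hv
    simp only [F, hwf.lookup.2 hv]
  have hendo : ∀ x v pa k rows, (v, Mech.endo pa k rows) ∈ G →
      F x v = (rows.lookup (pa.map x)).getD 0 := by
    intro x v pa k rows hv
    simp only [F, hwf.lookup.2 hv]
  have hstable : ∀ N v, v ∈ G.vars → rank v < N → F (F^[N] ω) v = F^[N] ω v := by
    intro N
    induction N with
    | zero => intro v _ hv; omega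
    | succ N ih =>
      intro v hvG hv
      obtain ⟨m, hm⟩ := mem_vars.1 hvG
      rw [Function.iterate_succ_apply']
      cases m with
      | exo θ => rw [hexo _ _ _ hm, hexo _ _ _ hm]
      | endo pa k rows =>
        rw [hendo _ _ _ _ _ hm, hendo _ _ _ _ _ hm]
        congr 2
        exact List.map_congr_left fun p hp =>
          ih p ((hG _ _ _ _ hm).2.2.1 hp) (by have := hrank _ _ _ _ hm p hp; omega)
  -- The number of rounds exceeds every rank.
  let x := F^[(G.vars.map rank).sum + 1] ω
  have hx : ∀ v ∈ G.vars, F x v = x v := fun v hv => hstable _ v hv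
    (Nat.lt_succ_of_le (List.le_sum_of_mem (List.mem_map_of_mem hv)))
  have hlt : ∀ N v, v ∈ G.vars → rank v < N → x v < G.card v := by
    intro N
    induction N with
    | zero => intro v _ hv; omega
    | succ N ih =>
      intro v hvG hv
      obtain ⟨m, hm⟩ := mem_vars.1 hvG
      rw [← hx v hvG]
      cases m with
      | exo θ => rw [hexo _ _ _ hm]; exact hω v (mem_exoVars.2 ⟨θ, hm⟩)
      | endo pa k rows =>
        obtain ⟨-, -, hpa, hnd, hkeys, hvals⟩ := hG _ _ _ _ hm
        have hst : G.IsStates (pa.map x) pa := by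
          refine List.forall₂_map_left_iff.2 (List.forall₂_same.2 fun p hp => ?_)
          exact ih p (hpa hp) (by have := hrank _ _ _ _ hm p hp; omega)
        obtain ⟨⟨p, s⟩, hr, hp⟩ := List.mem_map.1 ((hkeys _).2 hst)
        dsimp only at hp
        subst hp
        rw [hendo _ _ _ _ _ hm, (List.lookup_eq_some_iff_mem hnd).2 hr, hwf.card hm]
        exact hvals _ hr
  have hlt' : ∀ v ∈ G.vars, x v < G.card v := fun v hv => hlt _ v hv (Nat.lt_succ_self _)
  refine ⟨x, fun v m hm => ?_, hlt'⟩
  have hvG : v ∈ G.vars := mem_vars.2 ⟨m, hm⟩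
  simp only [List.lookup_nil]
  cases m with
  | exo θ => exact (hx v hvG).symm.trans (hexo _ _ _ hm)
  | endo pa k rows =>
    obtain ⟨-, -, hpa, hnd, hkeys, hvals⟩ := hG _ _ _ _ hm
    have hst : G.IsStates (pa.map x) pa :=
      List.forall₂_map_left_iff.2 (List.forall₂_same.2 fun p hp => hlt' p (hpa hp))
    obtain ⟨⟨p, s⟩, hr, hp⟩ := List.mem_map.1 ((hkeys _).2 hst)
    dsimp only at hp
    subst hp
    have h₁ := hx v hvG
    change rows.lookup (pa.map x) = some (x v)
    rw [hendo _ _ _ _ _ hm, (List.lookup_eq_some_iff_mem hnd).2 hr] at h₁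
    rw [(List.lookup_eq_some_iff_mem hnd).2 hr]
    exact congrArg some h₁

/-- Every variable has a state. -/
theorem WF.card_pos (h : G.WF) {v : Var} (hv : v ∈ G.vars) : 0 < G.card v := by
  obtain ⟨x, -, hx⟩ := h.exists_sol (ω := fun _ => 0) fun v hv => by
    obtain ⟨θ, hθ⟩ := mem_exoVars.1 hv
    rw [h.card hθ]
    have := h.2.2.1 v θ hθ
    cases θ with
    | nil => simp at this
    | cons => simp [Mech.card]
  exact (Nat.zero_le _).trans_lt (hx v hv)

end SCM

/-! ### The size of the objective model -/

theorem forall₂_matches_eq {p q : List ℕ} :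
    List.Forall₂ Cell.Matches (p.map Cell.eq) q ↔ q = p := by
  rw [List.forall₂_map_left_iff]
  constructor
  · intro h
    induction h with
    | nil => rfl
    | cons h _ ih => rw [ih, show _ = _ from h]
  · rintro rfl
    exact List.forall₂_same.2 fun _ _ => rfl

theorem exists_represents {rows : List (List ℕ × ℕ)} (h : (rows.map Prod.fst).Nodup) :
    ∃ T : List (List Cell × ℕ), T.length = rowCount rows ∧ Represents T rows := by
  refine Nat.sInf_mem (s := {k | ∃ T : List (List Cell × ℕ), T.length = k ∧ Represents T rows})
    ⟨_, rows.map fun r => (r.1.map Cell.eq, r.2), rfl, fun r hr => ⟨?_, ?_⟩⟩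
  · exact ⟨_, List.mem_map_of_mem hr, forall₂_matches_eq.2 rfl⟩
  · intro g hg hm
    obtain ⟨r', hr', rfl⟩ := List.mem_map.1 hg
    rw [forall₂_matches_eq] at hm
    have h₁ := (List.lookup_eq_some_iff_mem h (a := r.1) (b := r.2)).2 hr
    have h₂ := (List.lookup_eq_some_iff_mem h (a := r'.1) (b := r'.2)).2 hr'
    rw [hm, h₂] at h₁
    exact Option.some.inj h₁

theorem rowCount_pos {rows : List (List ℕ × ℕ)} (h : (rows.map Prod.fst).Nodup)
    (hne : rows ≠ []) : 1 ≤ rowCount rows := by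
  obtain ⟨T, hT, hr⟩ := exists_represents h
  obtain ⟨r, hr'⟩ := List.exists_mem_of_ne_nil _ hne
  obtain ⟨⟨g, hg, -⟩, -⟩ := hr r hr'
  rw [← hT]
  exact List.length_pos_of_mem hg

/-- The grouped rows of the old table are kept for mixture state `i`, and a single row covers all
other mixture states. -/
theorem rowCount_mixture_le {rows : List (List ℕ × ℕ)} (h : (rows.map Prod.fst).Nodup) {m : ℕ}
    (hm : ∀ r ∈ rows, r.1.length = m) (n i z : ℕ) :
    rowCount (rows.flatMap fun r =>
      (List.range n).map fun h => (h :: r.1, if h = i then r.2 else z)) ≤ rowCount rows + 1 := by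
  obtain ⟨T, hT, hr⟩ := exists_represents h
  -- A cell cannot say "any state". It is replaced by "any state other than `B`", where `B` occurs
  -- in no row.
  obtain ⟨B, hB⟩ : ∃ B : ℕ, ∀ r ∈ rows, ∀ a ∈ r.1, a ≠ B := by
    refine ⟨(rows.map fun r => r.1.sum).sum + 1, fun r hr a ha => ?_⟩
    have h₁ := List.le_sum_of_mem ha
    have h₂ := List.le_sum_of_mem (List.mem_map_of_mem (f := fun r : List ℕ × ℕ => r.1.sum) hr)
    omega
  refine Nat.sInf_le ⟨T.map (fun g => (Cell.eq i :: g.1, g.2)) ++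
    [(Cell.ne i :: List.replicate m (Cell.ne B), z)], by simp [hT], ?_⟩
  intro r' hr'
  simp only [List.mem_flatMap, List.mem_map, List.mem_range] at hr'
  obtain ⟨r, hrr, h, hh, rfl⟩ := hr'
  obtain ⟨⟨g, hg, hgm⟩, hu⟩ := hr r hrr
  by_cases hi : h = i
  · subst hi
    refine ⟨⟨_, List.mem_append_left _ (List.mem_map_of_mem hg),
      List.Forall₂.cons (rfl : h = h) hgm⟩, fun g' hg' hm' => ?_⟩
    rcases List.mem_append.1 hg' with hg' | hg'
    · obtain ⟨g₀, hg₀, rfl⟩ := List.mem_map.1 hg'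
      rw [List.forall₂_cons] at hm'
      simpa using hu g₀ hg₀ hm'.2
    · rw [List.mem_singleton] at hg'
      subst hg'
      rw [List.forall₂_cons] at hm'
      exact absurd rfl (show h ≠ h from hm'.1)
  · refine ⟨⟨_, List.mem_append_right _ (List.mem_singleton_self _),
      List.Forall₂.cons (show h ≠ i from hi) ?_⟩, fun g' hg' hm' => ?_⟩
    · rw [List.forall₂_iff_get]
      refine ⟨by simp [hm r hrr], fun j h₁ h₂ => ?_⟩
      simp only [List.get_eq_getElem, List.getElem_replicate]
      exact hB r hrr _ (List.getElem_mem _)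
    · rcases List.mem_append.1 hg' with hg' | hg'
      · obtain ⟨g₀, hg₀, rfl⟩ := List.mem_map.1 hg'
        rw [List.forall₂_cons] at hm'
        exact absurd (show h = i from hm'.1) hi
      · rw [List.mem_singleton] at hg'
        subst hg'
        simp [hi]

namespace SCM

variable {G : SCM}

theorem size_append (G G' : SCM) : SCM.size (G ++ G') = G.size + SCM.size G' := by
  simp [SCM.size]

theorem size_filterMap_le {f : Var × Mech → Option (Var × Mech)} {c : ℕ}
    (h : ∀ n ∈ G, ∀ n', f n = some n' → n'.2.size ≤ c * n.2.size) :
    SCM.size (G.filterMap f) ≤ c * G.size := by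
  unfold SCM.size
  induction G with
  | nil => simp
  | cons n G ih =>
    have h₁ := ih fun m hm => h m (List.mem_cons_of_mem _ hm)
    have h₂ := h n List.mem_cons_self
    cases hf : f n with
    | none =>
      rw [List.filterMap_cons_none hf, List.map_cons, List.sum_cons, Nat.mul_add]
      omega
    | some n' =>
      rw [List.filterMap_cons_some hf, List.map_cons, List.sum_cons, List.map_cons, List.sum_cons,
        Nat.mul_add]
      have := h₂ n' hf
      omega

theorem WF.endo (h : G.WF) {v : Var} {pa : List Var} {k : ℕ} {rows : List (List ℕ × ℕ)}
    (hv : (v, Mech.endo pa k rows) ∈ G) :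
    pa ≠ [] ∧ pa.Nodup ∧ pa ⊆ G.vars ∧ (rows.map Prod.fst).Nodup ∧
      (∀ p, p ∈ rows.map Prod.fst ↔ G.IsStates p pa) ∧ ∀ r ∈ rows, r.2 < k :=
  h.2.2.2.1 _ _ _ _ hv

theorem WF.rows_ne_nil (h : G.WF) {v : Var} {pa : List Var} {k : ℕ}
    {rows : List (List ℕ × ℕ)} (hv : (v, Mech.endo pa k rows) ∈ G) : rows ≠ [] := by
  obtain ⟨-, -, hpa, -, hkeys, -⟩ := h.endo hv
  rintro rfl
  have : G.IsStates (pa.map fun _ => 0) pa :=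
    List.forall₂_map_left_iff.2 (List.forall₂_same.2 fun p hp => h.card_pos (hpa hp))
  simpa using (hkeys _).2 this

end SCM

namespace Objective

/-- The unit variables of the objective model. -/
def unitNodes (G : SCM) (U : List Var) : SCM :=
  G.filterMap fun
    | (v, Mech.exo θ) => if v ∈ U then some (unitVar v, Mech.exo θ) else none
    | (_, Mech.endo _ _ _) => none

/-- The other exogenous variables of component `i`. -/
def exoNodes (G : SCM) (U : List Var) (i : ℕ) : SCM :=
  G.filterMap fun
    | (v, Mech.exo θ) => if v ∈ U then none else some (exoVar i v, Mech.exo θ)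
    | (_, Mech.endo _ _ _) => none

theorem component_eq (G : SCM) (U : List Var) (n i : ℕ) (t : Term) :
    component G U n i t = exoNodes G U i ++ world G U n i 0 [] [] ++ world G U n i 1 t.x t.y ++
      world G U n i 2 t.v t.w := rfl

theorem model_eq (I : USInput) :
    model I = (mixVar, Mech.exo (I.L.map Term.weight)) :: unitNodes I.G I.U ++
      I.L.zipIdx.flatMap fun c => component I.G I.U I.L.length c.2 c.1 := rfl

/-- A well-formed table has at least one grouped row, hence at least `k` entries. These pay for the
additional row of a mixed equation and for the prior of an intervened variable; the edge from the
mixture variable is paid for by the unit that counts the variable. -/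
theorem size_world_le {G : SCM} (hG : G.WF) (U : List Var) (n i j : ℕ) (act out : Inst) :
    (world G U n i j act out).size ≤ 2 * G.size := by
  refine SCM.size_filterMap_le fun nd hnd nd' h => ?_
  obtain ⟨v, m⟩ := nd
  cases m with
  | exo θ => simp at h
  | endo pa k rows =>
    obtain ⟨-, -, -, hnd', hkeys, -⟩ := hG.endo hnd
    have h₁ := rowCount_pos hnd' (hG.rows_ne_nil hnd)
    have h₂ : 1 * k ≤ rowCount rows * k := Nat.mul_le_mul_right k h₁
    simp only [Option.some.injEq] at h
    subst h
    cases act.lookup v with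
    | some s => simp only [Mech.size, List.length_map, List.length_range]; omega
    | none =>
      cases out.lookup v with
      | none => simp only [Mech.size, List.length_map]; omega
      | some z =>
        have h₃ := Nat.mul_le_mul_right k (rowCount_mixture_le hnd' (m := pa.length)
          (fun r hr => ((hkeys r.1).1 (List.mem_map_of_mem hr)).length_eq) n i z)
        simp only [Mech.size, List.length_cons, List.length_map]
        rw [Nat.succ_mul] at h₃
        omega

theorem size_component_le {G : SCM} (hG : G.WF) (U : List Var) (n i : ℕ) (t : Term) :
    (component G U n i t).size ≤ 7 * G.size := by
  simp only [component_eq, SCM.size_append]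
  have h₀ := size_world_le hG U n i 0 [] []
  have h₁ := size_world_le hG U n i 1 t.x t.y
  have h₂ := size_world_le hG U n i 2 t.v t.w
  have h₃ : (exoNodes G U i).size ≤ 1 * G.size := by
    refine SCM.size_filterMap_le fun nd _ nd' h => ?_
    obtain ⟨v, m⟩ := nd
    cases m with
    | exo θ =>
      by_cases hv : v ∈ U <;> simp [hv] at h
      subst h
      simp
    | endo => simp at h
  omega

theorem size_model_le {I : USInput} (hG : I.G.WF) (hL : I.L ≠ []) :
    (model I).size ≤ 10 * (I.L.length * I.G.size) := by
  have h₁ : (unitNodes I.G I.U).size ≤ 1 * I.G.size := by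
    refine SCM.size_filterMap_le fun nd _ nd' h => ?_
    obtain ⟨v, m⟩ := nd
    cases m with
    | exo θ =>
      by_cases hv : v ∈ I.U <;> simp [hv] at h
      subst h
      simp
    | endo => simp at h
  have h₂ : ∀ l : List (Term × ℕ), SCM.size (l.flatMap fun c =>
      component I.G I.U I.L.length c.2 c.1) ≤ l.length * (7 * I.G.size) := by
    intro l
    induction l with
    | nil => simp [SCM.size]
    | cons c l ih =>
      rw [List.flatMap_cons, SCM.size_append, List.length_cons, Nat.succ_mul]
      have := size_component_le hG I.U I.L.length c.2 c.1
      omega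
  have h₃ := h₂ I.L.zipIdx
  have h₄ : 1 ≤ I.G.size := by
    obtain ⟨n, hn⟩ := List.exists_mem_of_ne_nil _ hG.1
    have : n.2.size ≤ I.G.size :=
      List.le_sum_of_mem (List.mem_map_of_mem (f := fun n : Var × Mech => n.2.size) hn)
    refine le_trans ?_ this
    cases n.2 <;> simp only [Mech.size] <;> omega
  have h₅ : 1 ≤ I.L.length := List.length_pos_of_ne_nil hL
  rw [List.length_zipIdx] at h₃
  have h₆ : SCM.size ((mixVar, Mech.exo (I.L.map Term.weight)) :: unitNodes I.G I.U) ≤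
      1 + I.L.length + 1 * I.G.size :=
    le_trans (le_of_eq (by simp [SCM.size, Mech.size])) (Nat.add_le_add_left h₁ _)
  rw [model_eq, SCM.size_append]
  -- The total is at most `1 + n + |G| + 7 n |G|`, with `n` and `|G|` at least `1`.
  nlinarith

end Objective

/-! ### The objective model is a causal model -/

namespace SCM

theorem card_eq {G : SCM} (h : G.vars.Nodup) {v : Var} {m : Mech} (hm : (v, m) ∈ G) :
    G.card v = m.card := by
  unfold SCM.card
  rw [(List.lookup_eq_some_iff_mem h).2 hm]

theorem isStates_map {G G' : SCM} {f : Var → Var} {V : List Var}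
    (h : ∀ v ∈ V, G'.card (f v) = G.card v) (s : List ℕ) :
    G'.IsStates s (V.map f) ↔ G.IsStates s V := by
  unfold IsStates
  rw [List.forall₂_map_right_iff]
  constructor <;> intro hs
  · induction hs with
    | nil => exact List.Forall₂.nil
    | cons h₁ _ ih =>
      simp only [List.mem_cons, forall_eq_or_imp] at h
      exact List.Forall₂.cons (h.1 ▸ h₁) (ih h.2)
  · induction hs with
    | nil => exact List.Forall₂.nil
    | cons h₁ _ ih =>
      simp only [List.mem_cons, forall_eq_or_imp] at h
      exact List.Forall₂.cons (h.1.symm ▸ h₁) (ih h.2)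

theorem nodup_vars_filterMap {G : SCM} (h : G.vars.Nodup) {f : Var × Mech → Option (Var × Mech)}
    {g : Var → Var} (hg : Function.Injective g) (hf : ∀ n n', f n = some n' → n'.1 = g n.1) :
    (SCM.vars (G.filterMap f)).Nodup := by
  have : (SCM.vars (G.filterMap f)).Sublist (G.vars.map g) := by
    clear h
    unfold vars
    induction G with
    | nil => exact List.Sublist.refl _
    | cons n G ih =>
      cases hn : f n with
      | none => rw [List.filterMap_cons_none hn]; exact ih.cons _
      | some n' =>
        rw [List.filterMap_cons_some hn, List.map_cons, hf n n' hn]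
        exact ih.cons_cons _
  exact (h.map hg).sublist this

theorem vars_append (G G' : SCM) : SCM.vars (G ++ G') = G.vars ++ SCM.vars G' := List.map_append

theorem WF.endo_notMem_exoVars {G : SCM} (h : G.WF) {v : Var} {pa : List Var} {k : ℕ}
    {rows : List (List ℕ × ℕ)} (hv : (v, Mech.endo pa k rows) ∈ G) : v ∉ G.exoVars := by
  intro he
  obtain ⟨θ, hθ⟩ := mem_exoVars.1 he
  exact absurd (h.mech_unique hθ hv) (by simp)

theorem exists_endo_of_notMem {G : SCM} {v : Var} (hv : v ∈ G.vars) (he : v ∉ G.exoVars) :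
    ∃ pa k rows, (v, Mech.endo pa k rows) ∈ G := by
  obtain ⟨m, hm⟩ := mem_vars.1 hv
  cases m with
  | exo θ => exact absurd (mem_exoVars.2 ⟨θ, hm⟩) he
  | endo pa k rows => exact ⟨pa, k, rows, hm⟩

end SCM

/-! ### Nodes, names and well-formedness of the objective model -/

namespace Term

/-- The intervention in world `j`. -/
def act (t : Term) : ℕ → Inst
  | 0 => []
  | 1 => t.x
  | _ => t.v

/-- The outcome in the interventional world `j`. -/
def out (t : Term) : ℕ → Inst
  | 0 => []
  | 1 => t.y
  | _ => t.w

end Term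

namespace Objective

theorem unitVar_injective : Function.Injective unitVar := fun _ _ h => by simpa [unitVar] using h

theorem exoVar_injective (i : ℕ) : Function.Injective (exoVar i) :=
  fun _ _ h => by simpa [exoVar] using h

theorem endoVar_injective (i j : ℕ) : Function.Injective (endoVar i j) :=
  fun _ _ h => by simpa [endoVar] using h

theorem endoVar_eq_iff {i j i' j' : ℕ} {v v' : Var} :
    endoVar i j v = endoVar i' j' v' ↔ i = i' ∧ j = j' ∧ v = v' := by simp [endoVar]

theorem copyVar_injective (G : SCM) (U : List Var) (i j : ℕ) :
    Function.Injective (copyVar G U i j) := by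
  intro v w h
  unfold copyVar unitVar exoVar endoVar at h
  split_ifs at h <;> simp at h <;> exact h

/-- The mechanism of the copy of an endogenous variable. -/
def worldMech (G : SCM) (U : List Var) (n i j : ℕ) (act out : Inst) (v : Var) (pa : List Var)
    (k : ℕ) (rows : List (List ℕ × ℕ)) : Mech :=
  match act.lookup v with
  | some s => Mech.exo ((List.range k).map fun a => if a = s then 1 else 0)
  | none =>
    match out.lookup v with
    | none => Mech.endo (pa.map (copyVar G U i j)) k rows
    | some z => Mech.endo (mixVar :: pa.map (copyVar G U i j)) k
        (rows.flatMap fun r =>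
          (List.range n).map fun h => (h :: r.1, if h = i then r.2 else z))

theorem card_worldMech (G : SCM) (U : List Var) (n i j : ℕ) (act out : Inst) (v : Var)
    (pa : List Var) (k : ℕ) (rows : List (List ℕ × ℕ)) :
    (worldMech G U n i j act out v pa k rows).card = k := by
  unfold worldMech
  cases act.lookup v with
  | some s => simp [Mech.card]
  | none => cases out.lookup v <;> rfl

variable {G : SCM} {U : List Var} {n i j : ℕ} {act out : Inst} {t : Term} {I : USInput}
  {w : Var} {m : Mech}

theorem mem_world : (w, m) ∈ world G U n i j act out ↔ ∃ v pa k rows,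
    (v, Mech.endo pa k rows) ∈ G ∧ w = endoVar i j v ∧
      m = worldMech G U n i j act out v pa k rows := by
  unfold world
  rw [List.mem_filterMap]
  constructor
  · rintro ⟨⟨v, m'⟩, hv, h⟩
    cases m' with
    | exo θ => simp at h
    | endo pa k rows =>
      simp only [Option.some.injEq, Prod.mk.injEq] at h
      exact ⟨v, pa, k, rows, hv, h.1.symm, h.2.symm⟩
  · rintro ⟨v, pa, k, rows, hv, rfl, rfl⟩
    exact ⟨_, hv, rfl⟩

theorem mem_unitNodes : (w, m) ∈ unitNodes G U ↔ ∃ v θ,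
    (v, Mech.exo θ) ∈ G ∧ v ∈ U ∧ w = unitVar v ∧ m = Mech.exo θ := by
  unfold unitNodes
  rw [List.mem_filterMap]
  constructor
  · rintro ⟨⟨v, m'⟩, hv, h⟩
    cases m' with
    | exo θ =>
      by_cases hU : v ∈ U <;> simp [hU] at h
      exact ⟨v, θ, hv, hU, h.1.symm, h.2.symm⟩
    | endo pa k rows => simp at h
  · rintro ⟨v, θ, hv, hU, rfl, rfl⟩
    exact ⟨_, hv, by simp [hU]⟩

theorem mem_exoNodes : (w, m) ∈ exoNodes G U i ↔ ∃ v θ,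
    (v, Mech.exo θ) ∈ G ∧ v ∉ U ∧ w = exoVar i v ∧ m = Mech.exo θ := by
  unfold exoNodes
  rw [List.mem_filterMap]
  constructor
  · rintro ⟨⟨v, m'⟩, hv, h⟩
    cases m' with
    | exo θ =>
      by_cases hU : v ∈ U <;> simp [hU] at h
      exact ⟨v, θ, hv, hU, h.1.symm, h.2.symm⟩
    | endo pa k rows => simp at h
  · rintro ⟨v, θ, hv, hU, rfl, rfl⟩
    exact ⟨_, hv, by simp [hU]⟩

theorem mem_component : (w, m) ∈ component G U n i t ↔
    (w, m) ∈ exoNodes G U i ∨ ∃ j < 3, (w, m) ∈ world G U n i j (t.act j) (t.out j) := by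
  rw [component_eq]
  simp only [List.mem_append]
  constructor
  · rintro (((h | h) | h) | h)
    · exact Or.inl h
    · exact Or.inr ⟨0, by norm_num, h⟩
    · exact Or.inr ⟨1, by norm_num, h⟩
    · exact Or.inr ⟨2, by norm_num, h⟩
  · rintro (h | ⟨j, hj, h⟩)
    · exact Or.inl (Or.inl (Or.inl h))
    · interval_cases j
      · exact Or.inl (Or.inl (Or.inr h))
      · exact Or.inl (Or.inr h)
      · exact Or.inr h

theorem mem_model : (w, m) ∈ model I ↔
    (w = mixVar ∧ m = Mech.exo (I.L.map Term.weight)) ∨ (w, m) ∈ unitNodes I.G I.U ∨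
      ∃ c ∈ I.L.zipIdx, (w, m) ∈ component I.G I.U I.L.length c.2 c.1 := by
  rw [model_eq]
  simp only [List.mem_append, List.mem_cons, List.mem_flatMap, Prod.mk.injEq, or_assoc]

theorem fst_mem_of_mem_zipIdx {α : Type} {l : List α} {c : α × ℕ} (hc : c ∈ l.zipIdx) :
    c.1 ∈ l := List.fst_mem_of_mem_zipIdx hc

theorem pairwise_zipIdx {α : Type} (l : List α) :
    l.zipIdx.Pairwise fun c d => c.2 ≠ d.2 := by
  have : (l.zipIdx.map Prod.snd).Nodup := by
    rw [List.zipIdx_map_snd]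
    exact List.nodup_range'
  exact List.pairwise_map.1 this

theorem world_vars (h : w ∈ SCM.vars (world G U n i j act out)) : ∃ v, w = endoVar i j v := by
  obtain ⟨m, hm⟩ := SCM.mem_vars.1 h
  obtain ⟨v, -, -, -, -, h, -⟩ := mem_world.1 hm
  exact ⟨v, h⟩

theorem exoNodes_vars (h : w ∈ SCM.vars (exoNodes G U i)) : ∃ v, v ∉ U ∧ w = exoVar i v := by
  obtain ⟨m, hm⟩ := SCM.mem_vars.1 h
  obtain ⟨v, -, -, hU, h, -⟩ := mem_exoNodes.1 hm
  exact ⟨v, hU, h⟩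

theorem component_vars (h : w ∈ SCM.vars (component G U n i t)) :
    (∃ v, w = exoVar i v) ∨ ∃ j v, w = endoVar i j v := by
  obtain ⟨m, hm⟩ := SCM.mem_vars.1 h
  rcases mem_component.1 hm with hm | ⟨j, -, hm⟩
  · obtain ⟨v, -, hv⟩ := exoNodes_vars (SCM.mem_vars.2 ⟨m, hm⟩)
    exact Or.inl ⟨v, hv⟩
  · obtain ⟨v, hv⟩ := world_vars (SCM.mem_vars.2 ⟨m, hm⟩)
    exact Or.inr ⟨j, v, hv⟩

theorem nodup_world (hG : G.vars.Nodup) (U : List Var) (n i j : ℕ) (act out : Inst) :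
    (SCM.vars (world G U n i j act out)).Nodup := by
  refine SCM.nodup_vars_filterMap hG (endoVar_injective i j) fun nd nd' h => ?_
  obtain ⟨v, m⟩ := nd
  cases m <;> simp at h
  rw [← h]

theorem nodup_component (hG : G.vars.Nodup) (U : List Var) (n i : ℕ) (t : Term) :
    (SCM.vars (component G U n i t)).Nodup := by
  have h₀ : (SCM.vars (exoNodes G U i)).Nodup := by
    refine SCM.nodup_vars_filterMap hG (exoVar_injective i) fun nd nd' h => ?_
    obtain ⟨v, m⟩ := nd
    cases m with
    | exo θ =>
      by_cases hU : v ∈ U <;> simp [hU] at h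
      rw [← h]
    | endo => simp at h
  rw [component_eq, SCM.vars_append, SCM.vars_append, SCM.vars_append]
  refine ((h₀.append (nodup_world hG _ _ _ _ _ _) ?_).append (nodup_world hG _ _ _ _ _ _) ?_).append
    (nodup_world hG _ _ _ _ _ _) ?_
  · intro w h₁ h₂
    obtain ⟨v, -, rfl⟩ := exoNodes_vars h₁
    obtain ⟨v', h⟩ := world_vars h₂
    simp [exoVar, endoVar] at h
  · intro w h₁ h₂
    obtain ⟨v', rfl⟩ := world_vars h₂
    rcases List.mem_append.1 h₁ with h₁ | h₁
    · obtain ⟨v, -, h⟩ := exoNodes_vars h₁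
      simp [exoVar, endoVar] at h
    · obtain ⟨v, h⟩ := world_vars h₁
      simp [endoVar] at h
  · intro w h₁ h₂
    obtain ⟨v', rfl⟩ := world_vars h₂
    rcases List.mem_append.1 h₁ with h₁ | h₁
    · rcases List.mem_append.1 h₁ with h₁ | h₁
      · obtain ⟨v, -, h⟩ := exoNodes_vars h₁
        simp [exoVar, endoVar] at h
      · obtain ⟨v, h⟩ := world_vars h₁
        simp [endoVar] at h
    · obtain ⟨v, h⟩ := world_vars h₁
      simp [endoVar] at h

theorem nodup_model (hG : I.G.vars.Nodup) : (model I).vars.Nodup := by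
  have h₀ : (SCM.vars (unitNodes I.G I.U)).Nodup := by
    refine SCM.nodup_vars_filterMap hG unitVar_injective fun nd nd' h => ?_
    obtain ⟨v, m⟩ := nd
    cases m with
    | exo θ =>
      by_cases hU : v ∈ I.U <;> simp [hU] at h
      rw [← h]
    | endo => simp at h
  have hu : ∀ w ∈ SCM.vars (unitNodes I.G I.U), ∃ v, w = unitVar v := by
    intro w hw
    obtain ⟨m, hm⟩ := SCM.mem_vars.1 hw
    obtain ⟨v, -, -, -, h, -⟩ := mem_unitNodes.1 hm
    exact ⟨v, h⟩
  rw [model_eq, SCM.vars_append]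
  refine List.Nodup.append (List.nodup_cons.2 ⟨fun h => ?_, h₀⟩) ?_ ?_
  · obtain ⟨v, hv⟩ := hu _ h
    simp [mixVar, unitVar] at hv
  · unfold SCM.vars
    rw [List.map_flatMap, List.nodup_flatMap]
    refine ⟨fun c _ => nodup_component hG _ _ _ _, (pairwise_zipIdx I.L).imp fun h w h₁ h₂ => ?_⟩
    rcases component_vars h₁ with ⟨v, rfl⟩ | ⟨j, v, rfl⟩ <;>
      rcases component_vars h₂ with ⟨v', h'⟩ | ⟨j', v', h'⟩ <;>
      simp [exoVar, endoVar] at h' <;> exact h h'.1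
  · intro w h₁ h₂
    obtain ⟨m, hm⟩ := SCM.mem_vars.1 h₂
    obtain ⟨c, -, hc⟩ := List.mem_flatMap.1 hm
    have hw := component_vars (SCM.mem_vars.2 ⟨m, hc⟩)
    rcases List.mem_cons.1 h₁ with rfl | h₁
    · rcases hw with ⟨v, h⟩ | ⟨j, v, h⟩ <;> simp [mixVar, exoVar, endoVar] at h
    · obtain ⟨v', rfl⟩ := hu w h₁
      rcases hw with ⟨v, h⟩ | ⟨j, v, h⟩ <;> simp [unitVar, exoVar, endoVar] at h

section Valid

theorem valid_iff : UnitSelection.Valid I ↔ I.G.WF ∧ I.U.Nodup ∧ (∀ v ∈ I.U, v ∈ I.G.exoVars) ∧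
    (∀ t ∈ I.L,
      I.G.IsEndoInst t.x ∧ I.G.IsEndoInst t.y ∧ I.G.IsEndoInst t.v ∧ I.G.IsEndoInst t.w ∧
      I.G.IsEndoInst t.e ∧ (t.x.vars ++ t.v.vars).Disjoint (t.y.vars ++ t.w.vars)) ∧
    (I.L.map Term.weight).sum = 1 := Iff.rfl

theorem copyVar_unit {v : Var} (hv : v ∈ U) : copyVar G U i j v = unitVar v := by
  simp [copyVar, hv]

theorem copyVar_exo {v : Var} (hv : v ∉ U) (h : v ∈ G.exoVars) :
    copyVar G U i j v = exoVar i v := by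
  simp [copyVar, hv, h]

theorem copyVar_endo {v : Var} (hU : ∀ v ∈ U, v ∈ G.exoVars) (h : v ∉ G.exoVars) :
    copyVar G U i j v = endoVar i j v := by
  have : v ∉ U := fun hv => h (hU v hv)
  simp [copyVar, this, h]

variable (hI : UnitSelection.Valid I)
include hI

theorem valid_act {t : Term} (ht : t ∈ I.L) (j : ℕ) : I.G.IsEndoInst (t.act j) := by
  obtain ⟨h₁, -, h₂, -⟩ := (valid_iff.1 hI).2.2.2.1 t ht
  rcases j with _ | _ | j
  · exact ⟨⟨by simp [Term.act], by simp [Term.act]⟩, by simp [Term.act]⟩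
  · exact h₁
  · exact h₂

theorem valid_out {t : Term} (ht : t ∈ I.L) (j : ℕ) : I.G.IsEndoInst (t.out j) := by
  obtain ⟨-, h₁, -, h₂, -⟩ := (valid_iff.1 hI).2.2.2.1 t ht
  rcases j with _ | _ | j
  · exact ⟨⟨by simp [Term.out], by simp [Term.out]⟩, by simp [Term.out]⟩
  · exact h₁
  · exact h₂

theorem valid_disjoint {t : Term} (ht : t ∈ I.L) (j : ℕ) :
    (t.act j).vars.Disjoint (t.out j).vars := by
  obtain ⟨-, -, -, -, -, h⟩ := (valid_iff.1 hI).2.2.2.1 t ht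
  rcases j with _ | _ | j
  · simp [Term.act]
  · exact fun v h₁ h₂ => h (List.mem_append_left _ h₁) (List.mem_append_left _ h₂)
  · exact fun v h₁ h₂ => h (List.mem_append_right _ h₁) (List.mem_append_right _ h₂)

theorem exists_mem_model {c : Term × ℕ} (hc : c ∈ I.L.zipIdx) {j : ℕ} (hj : j < 3) {v : Var}
    (hv : v ∈ I.G.vars) :
    ∃ m, (copyVar I.G I.U c.2 j v, m) ∈ model I ∧ m.card = I.G.card v := by
  obtain ⟨hG, -, hU, -⟩ := valid_iff.1 hI
  by_cases he : v ∈ I.G.exoVars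
  · obtain ⟨θ, hθ⟩ := SCM.mem_exoVars.1 he
    refine ⟨Mech.exo θ, ?_, (hG.card hθ).symm⟩
    by_cases hvU : v ∈ I.U
    · rw [copyVar_unit hvU]
      exact mem_model.2 (Or.inr (Or.inl (mem_unitNodes.2 ⟨v, θ, hθ, hvU, rfl, rfl⟩)))
    · rw [copyVar_exo hvU he]
      exact mem_model.2 (Or.inr (Or.inr ⟨c, hc, mem_component.2 (Or.inl
        (mem_exoNodes.2 ⟨v, θ, hθ, hvU, rfl, rfl⟩))⟩))
  · obtain ⟨pa, k, rows, hm⟩ := SCM.exists_endo_of_notMem hv he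
    rw [copyVar_endo hU he]
    exact ⟨_, mem_model.2 (Or.inr (Or.inr ⟨c, hc, mem_component.2 (Or.inr ⟨j, hj,
      mem_world.2 ⟨v, pa, k, rows, hm, rfl, rfl⟩⟩)⟩)),
      (card_worldMech _ _ _ _ _ _ _ _ _ _ _).trans (hG.card hm).symm⟩

theorem card_model_copyVar {c : Term × ℕ} (hc : c ∈ I.L.zipIdx) {j : ℕ} (hj : j < 3) {v : Var}
    (hv : v ∈ I.G.vars) : (model I).card (copyVar I.G I.U c.2 j v) = I.G.card v := by
  obtain ⟨m, hm, hk⟩ := exists_mem_model hI hc hj hv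
  rw [SCM.card_eq (nodup_model (valid_iff.1 hI).1.nodup) hm, hk]

theorem card_model_mixVar : (model I).card mixVar = I.L.length := by
  rw [SCM.card_eq (nodup_model (valid_iff.1 hI).1.nodup) (mem_model.2 (Or.inl ⟨rfl, rfl⟩))]
  simp [Mech.card]

omit hI in
theorem sum_pointMass {k s : ℕ} (h : s < k) :
    ((List.range k).map fun a => if a = s then (1 : ℚ≥0) else 0).sum = 1 := by
  rw [← List.sum_toFinset _ List.nodup_range]
  simp [h]

/-- Copies of parents have as many states as the originals, so the keys of an unchanged table remain
complete. In a mixed table each key is prefixed by every state of the mixture variable. -/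
theorem wf_worldMech {c : Term × ℕ} (hc : c ∈ I.L.zipIdx) {j : ℕ} (hj : j < 3) {v : Var}
    {pa : List Var} {k : ℕ} {rows : List (List ℕ × ℕ)} (hv : (v, Mech.endo pa k rows) ∈ I.G)
    {pa' : List Var} {k' : ℕ} {rows' : List (List ℕ × ℕ)}
    (h : worldMech I.G I.U I.L.length c.2 j (c.1.act j) (c.1.out j) v pa k rows =
      Mech.endo pa' k' rows') :
    pa' ≠ [] ∧ pa'.Nodup ∧ pa' ⊆ (model I).vars ∧ (rows'.map Prod.fst).Nodup ∧
      (∀ p, p ∈ rows'.map Prod.fst ↔ (model I).IsStates p pa') ∧ ∀ r ∈ rows', r.2 < k' := by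
  have hG := (valid_iff.1 hI).1
  obtain ⟨h₁, h₂, h₃, h₄, h₅, h₆⟩ := hG.endo hv
  have hpa : pa.map (copyVar I.G I.U c.2 j) ≠ [] := by simpa using h₁
  have hnd := h₂.map (copyVar_injective I.G I.U c.2 j)
  have hsub : pa.map (copyVar I.G I.U c.2 j) ⊆ (model I).vars := by
    intro w hw
    obtain ⟨p, hp, rfl⟩ := List.mem_map.1 hw
    obtain ⟨m, hm, -⟩ := exists_mem_model hI hc hj (h₃ hp)
    exact SCM.mem_vars.2 ⟨m, hm⟩
  have hst : ∀ p, (model I).IsStates p (pa.map (copyVar I.G I.U c.2 j)) ↔ I.G.IsStates p pa :=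
    fun p => SCM.isStates_map (fun v hv => card_model_copyVar hI hc hj (h₃ hv)) p
  unfold worldMech at h
  cases ha : (c.1.act j).lookup v with
  | some s => simp [ha] at h
  | none =>
    cases ho : (c.1.out j).lookup v with
    | none =>
      simp only [ha, ho, Mech.endo.injEq] at h
      obtain ⟨rfl, rfl, rfl⟩ := h
      exact ⟨hpa, hnd, hsub, h₄, fun p => by rw [h₅, hst], h₆⟩
    | some z =>
      simp only [ha, ho, Mech.endo.injEq] at h
      obtain ⟨rfl, rfl, rfl⟩ := h
      have hkeys : (rows.flatMap fun r => (List.range I.L.length).map fun h =>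
          (h :: r.1, if h = c.2 then r.2 else z)).map Prod.fst =
          (rows.map Prod.fst).flatMap fun p => (List.range I.L.length).map fun h => h :: p := by
        simp [List.map_flatMap, List.flatMap_map, Function.comp_def]
      have hout := valid_out hI (fst_mem_of_mem_zipIdx hc) j
      have hz : z < k := by
        have := (hout.1.2 _ ((List.lookup_eq_some_iff_mem hout.1.1).1 ho)).2
        rwa [hG.card hv] at this
      refine ⟨by simp, List.nodup_cons.2 ⟨fun h => ?_, hnd⟩, ?_, ?_, fun p => ?_, ?_⟩
      · obtain ⟨p, -, hp⟩ := List.mem_map.1 h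
        unfold copyVar unitVar exoVar endoVar mixVar at hp
        split_ifs at hp <;> simp at hp
      · exact List.cons_subset.2 ⟨SCM.mem_vars.2 ⟨_, mem_model.2 (Or.inl ⟨rfl, rfl⟩)⟩, hsub⟩
      · rw [hkeys, List.nodup_flatMap]
        refine ⟨fun p _ => List.nodup_range.map fun a b h => by simpa using h,
          h₄.imp fun {p q} hpq w h₁ h₂ => ?_⟩
        obtain ⟨a, -, rfl⟩ := List.mem_map.1 h₁
        obtain ⟨b, -, h⟩ := List.mem_map.1 h₂
        simp only [List.cons.injEq] at h
        exact hpq h.2.symm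
      · rw [hkeys]
        simp only [List.mem_flatMap, h₅, ← hst]
        unfold SCM.IsStates
        cases p with
        | nil => simp
        | cons a p =>
          rw [List.forall₂_cons, card_model_mixVar hI]
          simp [and_comm]
      · intro r hr
        simp only [List.mem_flatMap, List.mem_map, List.mem_range] at hr
        obtain ⟨r, hr, h, -, rfl⟩ := hr
        dsimp only
        split_ifs
        · exact h₆ r hr
        · exact hz

theorem wf_model : (model I).WF := by
  obtain ⟨hG, -, hU, -, hw⟩ := valid_iff.1 hI
  refine ⟨by simp [model_eq], nodup_model hG.nodup, ?_, ?_, ?_⟩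
  · intro v θ hv
    rcases mem_model.1 hv with ⟨-, h⟩ | h | ⟨c, hc, h⟩
    · cases h
      exact hw
    · obtain ⟨v, θ, h, -, -, h'⟩ := mem_unitNodes.1 h
      cases h'
      exact hG.2.2.1 v _ h
    · rcases mem_component.1 h with h | ⟨j, hj, h⟩
      · obtain ⟨v, θ, h, -, -, h'⟩ := mem_exoNodes.1 h
        cases h'
        exact hG.2.2.1 v _ h
      · obtain ⟨v, pa, k, rows, hv', -, h'⟩ := mem_world.1 h
        unfold worldMech at h'
        cases ha : (c.1.act j).lookup v with
        | none => cases ho : (c.1.out j).lookup v <;> simp [ha, ho] at h'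
        | some s =>
          simp only [ha] at h'
          cases h'
          have hact := valid_act hI (fst_mem_of_mem_zipIdx hc) j
          have := (hact.1.2 _ ((List.lookup_eq_some_iff_mem hact.1.1).1 ha)).2
          rw [hG.card hv'] at this
          exact sum_pointMass this
  · intro v pa k rows hv
    rcases mem_model.1 hv with ⟨-, h⟩ | h | ⟨c, hc, h⟩
    · cases h
    · obtain ⟨v, θ, h, -, -, h'⟩ := mem_unitNodes.1 h
      cases h'
    · rcases mem_component.1 h with h | ⟨j, hj, h⟩
      · obtain ⟨v, θ, h, -, -, h'⟩ := mem_exoNodes.1 h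
        cases h'
      · obtain ⟨v, pa, k, rows, h, -, h'⟩ := mem_world.1 h
        exact wf_worldMech hI hc hj h h'.symm
  · obtain ⟨rank, hrank⟩ := hG.2.2.2.2
    -- Only names with tag `3` can have parents. The shift by one puts them above the mixture
    -- variable and the exogenous copies, all of rank `0`.
    refine ⟨fun w => match w with
      | 3 :: _ :: _ :: v => rank v + 1
      | _ => 0, ?_⟩
    intro v pa k rows hv p hp
    rcases mem_model.1 hv with ⟨-, h⟩ | h | ⟨c, hc, h⟩
    · cases h
    · obtain ⟨v, θ, h, -, -, h'⟩ := mem_unitNodes.1 h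
      cases h'
    · rcases mem_component.1 h with h | ⟨j, hj, h⟩
      · obtain ⟨v, θ, h, -, -, h'⟩ := mem_exoNodes.1 h
        cases h'
      · obtain ⟨v, pa', k', rows', hv', rfl, h'⟩ := mem_world.1 h
        have key : p = mixVar ∨ ∃ q ∈ pa', p = copyVar I.G I.U c.2 j q := by
          unfold worldMech at h'
          cases ha : (c.1.act j).lookup v with
          | some s => simp [ha] at h'
          | none =>
            cases ho : (c.1.out j).lookup v <;> simp only [ha, ho, Mech.endo.injEq] at h' <;>
              rw [h'.1] at hp
            · obtain ⟨q, hq, rfl⟩ := List.mem_map.1 hp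
              exact Or.inr ⟨q, hq, rfl⟩
            · rcases List.mem_cons.1 hp with rfl | hp
              · exact Or.inl rfl
              · obtain ⟨q, hq, rfl⟩ := List.mem_map.1 hp
                exact Or.inr ⟨q, hq, rfl⟩
        rcases key with rfl | ⟨q, hq, rfl⟩
        · simp [mixVar, endoVar]
        · have := hrank _ _ _ _ hv' q hq
          unfold copyVar unitVar exoVar endoVar
          split_ifs
          · simp
          · simp
          · simpa using this

omit hI in
theorem vars_copyInst (i j : ℕ) (e : Inst) :
    (copyInst i j e).map Prod.fst = e.vars.map (endoVar i j) := by
  simp [copyInst, Function.comp_def]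

theorem isInst_copyInst {c : Term × ℕ} (hc : c ∈ I.L.zipIdx) {j : ℕ} (hj : j < 3) {e : Inst}
    (he : I.G.IsEndoInst e) : ∀ p ∈ copyInst c.2 j e,
      p.1 ∈ (model I).vars ∧ p.2 < (model I).card p.1 := by
  obtain ⟨hG, -, hU, -, hw⟩ := valid_iff.1 hI
  intro p hp
  obtain ⟨q, hq, rfl⟩ := List.mem_map.1 hp
  obtain ⟨pa, k, rows, hm⟩ := SCM.mem_endoVars.1 (he.2 q hq)
  have h := (he.1.2 q hq)
  rw [← copyVar_endo (U := I.U) hU (hG.endo_notMem_exoVars hm), card_model_copyVar hI hc hj h.1]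
  obtain ⟨m, hm, -⟩ := exists_mem_model hI hc hj h.1
  exact ⟨SCM.mem_vars.2 ⟨m, hm⟩, h.2⟩

omit hI in
theorem nodup_flatMap_zipIdx {l : List Term} {f : Term × ℕ → Inst}
    (h₁ : ∀ c ∈ l.zipIdx, (f c).vars.Nodup)
    (h₂ : ∀ c ∈ l.zipIdx, ∀ v ∈ (f c).vars, ∃ j w, v = endoVar c.2 j w) :
    (Inst.vars (l.zipIdx.flatMap f)).Nodup := by
  unfold Inst.vars
  rw [List.map_flatMap, List.nodup_flatMap]
  refine ⟨h₁, List.Pairwise.imp_of_mem (fun {c d} hc hd h v hv hv' => ?_) (pairwise_zipIdx l)⟩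
  obtain ⟨j, w, rfl⟩ := h₂ c hc _ hv
  obtain ⟨j', w', h'⟩ := h₂ d hd _ hv'
  exact h (endoVar_eq_iff.1 h').1

omit hI in
theorem mem_vars_e₁ {v : Var} (hv : v ∈ (toRMAP I).e₁.vars) : ∃ c ∈ I.L.zipIdx, ∃ w,
    (v = endoVar c.2 1 w ∧ w ∈ c.1.y.vars) ∨ (v = endoVar c.2 2 w ∧ w ∈ c.1.w.vars) := by
  simp only [toRMAP, Inst.vars, List.map_flatMap, List.map_append, vars_copyInst, List.mem_flatMap,
    List.mem_append, List.mem_map (f := endoVar _ _)] at hv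
  obtain ⟨c, hc, ⟨w, hw, rfl⟩ | ⟨w, hw, rfl⟩⟩ := hv
  · exact ⟨c, hc, w, Or.inl ⟨rfl, hw⟩⟩
  · exact ⟨c, hc, w, Or.inr ⟨rfl, hw⟩⟩

omit hI in
theorem mem_vars_e₂ {v : Var} (hv : v ∈ (toRMAP I).e₂.vars) : ∃ c ∈ I.L.zipIdx, ∃ w,
    (v = endoVar c.2 1 w ∧ w ∈ c.1.x.vars) ∨ (v = endoVar c.2 2 w ∧ w ∈ c.1.v.vars) ∨
      v = endoVar c.2 0 w := by
  simp only [toRMAP, Inst.vars, List.map_flatMap, List.map_append, vars_copyInst, List.mem_flatMap,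
    List.mem_append, List.mem_map (f := endoVar _ _)] at hv
  obtain ⟨c, hc, (⟨w, hw, rfl⟩ | ⟨w, hw, rfl⟩) | ⟨w, hw, rfl⟩⟩ := hv
  · exact ⟨c, hc, w, Or.inl ⟨rfl, hw⟩⟩
  · exact ⟨c, hc, w, Or.inr (Or.inl ⟨rfl, hw⟩)⟩
  · exact ⟨c, hc, w, Or.inr (Or.inr rfl)⟩

theorem valid_toRMAP : RMAP.Valid (toRMAP I) := by
  obtain ⟨hG, hUn, hU, hT, hw⟩ := valid_iff.1 hI
  refine ⟨wf_model hI, hUn.map unitVar_injective, ?_, ⟨?_, ?_⟩, ⟨?_, ?_⟩, ?_, ?_, ?_⟩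
  · intro w hw
    obtain ⟨v, hv, rfl⟩ := List.mem_map.1 hw
    obtain ⟨θ, hθ⟩ := SCM.mem_exoVars.1 (hU v hv)
    exact SCM.mem_vars.2 ⟨_, mem_model.2
      (Or.inr (Or.inl (mem_unitNodes.2 ⟨v, θ, hθ, hv, rfl, rfl⟩)))⟩
  · refine nodup_flatMap_zipIdx (fun c hc => ?_) fun c hc v hv => ?_
    · obtain ⟨-, hy, -, hw, -, -⟩ := hT c.1 (fst_mem_of_mem_zipIdx hc)
      simp only [Inst.vars, List.map_append, vars_copyInst]
      refine (hy.1.1.map (endoVar_injective _ _)).append (hw.1.1.map (endoVar_injective _ _)) ?_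
      intro v h₁ h₂
      obtain ⟨a, -, rfl⟩ := List.mem_map.1 h₁
      obtain ⟨b, -, h⟩ := List.mem_map.1 h₂
      simp [endoVar] at h
    · simp only [Inst.vars, List.map_append, vars_copyInst, List.mem_append,
        List.mem_map (f := endoVar _ _)] at hv
      obtain ⟨w, -, rfl⟩ | ⟨w, -, rfl⟩ := hv <;> exact ⟨_, _, rfl⟩
  · intro p hp
    obtain ⟨c, hc, hp⟩ := List.mem_flatMap.1 hp
    obtain ⟨-, hy, -, hw, -, -⟩ := hT c.1 (fst_mem_of_mem_zipIdx hc)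
    rcases List.mem_append.1 hp with hp | hp
    · exact isInst_copyInst hI hc (by norm_num) hy p hp
    · exact isInst_copyInst hI hc (by norm_num) hw p hp
  · refine nodup_flatMap_zipIdx (fun c hc => ?_) fun c hc v hv => ?_
    · obtain ⟨hx, -, hv, -, he, -⟩ := hT c.1 (fst_mem_of_mem_zipIdx hc)
      simp only [Inst.vars, List.map_append, vars_copyInst]
      refine ((hx.1.1.map (endoVar_injective _ _)).append (hv.1.1.map (endoVar_injective _ _))
        ?_).append (he.1.1.map (endoVar_injective _ _)) ?_
      · intro v h₁ h₂
        obtain ⟨a, -, rfl⟩ := List.mem_map.1 h₁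
        obtain ⟨b, -, h⟩ := List.mem_map.1 h₂
        simp [endoVar] at h
      · intro v h₁ h₂
        obtain ⟨b, -, rfl⟩ := List.mem_map.1 h₂
        rcases List.mem_append.1 h₁ with h₁ | h₁ <;> obtain ⟨a, -, h⟩ := List.mem_map.1 h₁ <;>
          simp [endoVar] at h
    · simp only [Inst.vars, List.map_append, vars_copyInst, List.mem_append,
        List.mem_map (f := endoVar _ _)] at hv
      obtain (⟨w, -, rfl⟩ | ⟨w, -, rfl⟩) | ⟨w, -, rfl⟩ := hv <;> exact ⟨_, _, rfl⟩
  · intro p hp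
    obtain ⟨c, hc, hp⟩ := List.mem_flatMap.1 hp
    obtain ⟨hx, -, hv, -, he, -⟩ := hT c.1 (fst_mem_of_mem_zipIdx hc)
    rcases List.mem_append.1 hp with hp | hp
    · rcases List.mem_append.1 hp with hp | hp
      · exact isInst_copyInst hI hc (by norm_num) hx p hp
      · exact isInst_copyInst hI hc (by norm_num) hv p hp
    · exact isInst_copyInst hI hc (by norm_num) he p hp
  · intro v h₁ h₂
    obtain ⟨u, -, rfl⟩ := List.mem_map.1 h₁
    obtain ⟨c, -, w, ⟨h, -⟩ | ⟨h, -⟩⟩ := mem_vars_e₁ h₂ <;> simp [unitVar, endoVar] at h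
  · intro v h₁ h₂
    obtain ⟨u, -, rfl⟩ := List.mem_map.1 h₁
    obtain ⟨c, -, w, ⟨h, -⟩ | ⟨h, -⟩ | h⟩ := mem_vars_e₂ h₂ <;> simp [unitVar, endoVar] at h
  · intro v h₁ h₂
    -- The index determines the summand. A variable that is both outcome and condition lies in a
    -- single world of a single component, and this contradicts the disjointness required of that
    -- summand.
    have key : ∀ c ∈ I.L.zipIdx, ∀ d ∈ I.L.zipIdx, c.2 = d.2 → c.1 = d.1 := by
      intro c hc d hd h
      have h₁ := List.mem_zipIdx_iff_getElem?.1 hc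
      have h₂ := List.mem_zipIdx_iff_getElem?.1 hd
      rw [h, h₂] at h₁
      exact (Option.some.inj h₁).symm
    obtain ⟨c, hc, w, h₃⟩ := mem_vars_e₁ h₁
    obtain ⟨d, hd, w', h₄⟩ := mem_vars_e₂ h₂
    have hdisj := (hT c.1 (fst_mem_of_mem_zipIdx hc)).2.2.2.2.2
    rcases h₃ with ⟨rfl, h₃⟩ | ⟨rfl, h₃⟩ <;> rcases h₄ with ⟨h, h₄⟩ | ⟨h, h₄⟩ | h <;>
      obtain ⟨hi, hj, rfl⟩ := endoVar_eq_iff.1 h <;> simp at hj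
    · exact hdisj (List.mem_append_left _ (key c hc d hd hi ▸ h₄)) (List.mem_append_left _ h₃)
    · exact hdisj (List.mem_append_right _ (key c hc d hd hi ▸ h₄)) (List.mem_append_right _ h₃)

end Valid

end Objective

/-! ### Conditioning on the unit variables -/

open Classical in
/-- The indicator of a proposition. -/
noncomputable def ind (p : Prop) : ℚ≥0 := if p then 1 else 0

theorem ind_true {p : Prop} (h : p) : ind p = 1 := if_pos h

theorem ind_false {p : Prop} (h : ¬p) : ind p = 0 := if_neg h

theorem ind_and (p q : Prop) : ind (p ∧ q) = ind p * ind q := by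
  by_cases hp : p <;> by_cases hq : q <;> simp [ind, hp, hq]

theorem ind_forall_mem {ι : Type} (l : List ι) (p : ι → Prop) :
    ind (∀ c ∈ l, p c) = (l.map fun c => ind (p c)).prod := by
  induction l with
  | nil => exact ind_true (by simp)
  | cons c l ih => rw [List.map_cons, List.prod_cons, ← ih, ← ind_and, List.forall_mem_cons]

/-- The states are as listed. -/
def Agrees (e : Inst) (ω : Var → ℕ) : Prop := ∀ p ∈ e, ω p.1 = p.2

/-- The states of the variables `U` are `u`, the other states are `0`. -/
def assign (U : List Var) (u : List ℕ) (v : Var) : ℕ := ((U.zip u).lookup v).getD 0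

theorem eq_assign {U : List Var} {u : List ℕ} (hu : U.length = u.length) {a : Var → ℕ}
    (h₀ : ∀ v, v ∉ U → a v = 0) (h : Agrees (U.zip u) a) : a = assign U u := by
  have hz : (U.zip u).map Prod.fst = U := List.map_fst_zip hu.le
  funext v
  unfold assign
  cases hv : (U.zip u).lookup v with
  | none =>
    rw [List.lookup_eq_none_iff_notMem, hz] at hv
    exact h₀ v hv
  | some s =>
    obtain ⟨l₁, l₂, h', -⟩ := List.lookup_eq_some_iff.1 hv
    exact h (v, s) (by rw [h']; simp)

theorem agrees_indep {e : Inst} {v : Var} (hv : v ∉ e.vars) :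
    IndepOf (fun ω => ind (Agrees e ω)) v := by
  intro a s
  dsimp only
  congr 1
  refine propext (forall₂_congr fun p hp => ?_)
  rw [Function.update_of_ne]
  rintro rfl
  exact hv (List.mem_map_of_mem hp)

theorem zip_vars_subset (U : List Var) (u : List ℕ) : Inst.vars (U.zip u) ⊆ U := by
  intro v hv
  obtain ⟨p, hp, rfl⟩ := List.mem_map.1 hv
  exact (List.of_mem_zip (a := p.1) (b := p.2) hp).1

namespace SCM

variable {G : SCM} {U : List Var} {u : List ℕ}

/-- The variables of `U` with their distributions. -/
def unitPriors (G : SCM) (U : List Var) : List (Var × List ℚ≥0) :=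
  G.priors.filter fun p => decide (p.1 ∈ U)

/-- The exogenous variables outside `U` with their distributions. -/
def restPriors (G : SCM) (U : List Var) : List (Var × List ℚ≥0) :=
  G.priors.filter fun p => !decide (p.1 ∈ U)

/-- The probability that the variables `U` have states `u`. -/
noncomputable def unitProb (G : SCM) (U : List Var) (u : List ℕ) : ℚ≥0 :=
  expect (G.unitPriors U) (fun ω => ind (Agrees (U.zip u) ω)) 0

/-- The probability of an event when the variables `U` have states `u`. -/
noncomputable def probGiven (G : SCM) (U : List Var) (u : List ℕ) (A : (Var → ℕ) → Prop) : ℚ≥0 :=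
  expect (G.restPriors U) (fun ω => ind (A ω)) (assign U u)

theorem WF.prob_eq_ind (h : G.WF) (worlds : List (Inst × Inst)) :
    G.prob worlds = expect G.priors (fun ω => ind (G.Holds worlds ω)) 0 := h.prob_eq worlds

theorem unitPriors_vars {p : Var × List ℚ≥0} (hp : p ∈ G.unitPriors U) : p.1 ∈ U := by
  simpa using (List.mem_filter.1 hp).2

theorem restPriors_vars {p : Var × List ℚ≥0} (hp : p ∈ G.restPriors U) : p.1 ∉ U := by
  simpa using (List.mem_filter.1 hp).2

theorem WF.nodup_unitPriors (h : G.WF) (U : List Var) :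
    ((G.unitPriors U).map Prod.fst).Nodup :=
  h.priors_nodup.sublist (List.filter_sublist.map _)

theorem WF.nodup_restPriors (h : G.WF) (U : List Var) :
    ((G.restPriors U).map Prod.fst).Nodup :=
  h.priors_nodup.sublist (List.filter_sublist.map _)

/-- The variables of `U` are drawn first. The event that they have states `u` is then decided, and
where it holds the states drawn so far are exactly `assign U u`. This is `Pr(u) * Pr(A | u)` in a
form that also makes sense when `Pr(u) = 0`. -/
theorem WF.expect_and (h : G.WF) (hu : U.length = u.length) (A : (Var → ℕ) → Prop) :
    expect G.priors (fun ω => ind (Agrees (U.zip u) ω ∧ A ω)) 0 =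
      G.unitProb U u * G.probGiven U u A := by
  rw [← expect_perm (List.filter_append_perm (fun p => decide (p.1 ∈ U)) G.priors)
    (((List.filter_append_perm _ _).map Prod.fst).nodup_iff.2 h.priors_nodup), expect_append]
  have h₁ : expect (G.restPriors U) (fun ω => ind (Agrees (U.zip u) ω ∧ A ω)) =
      fun b => ind (Agrees (U.zip u) b) * expect (G.restPriors U) (fun ω => ind (A ω)) b := by
    funext b
    simp only [ind_and]
    refine expect_mul_left fun v hv => agrees_indep fun hv' => ?_
    obtain ⟨p, hp, rfl⟩ := List.mem_map.1 hv
    exact restPriors_vars hp (zip_vars_subset _ _ hv')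
  change expect (G.unitPriors U) (expect (G.restPriors U) _) 0 = _
  rw [h₁, mul_comm, unitProb, ← expect_mul_left (g := fun _ => G.probGiven U u A)
    fun _ _ _ _ => rfl]
  refine expect_congr (h.nodup_unitPriors U) fun b hb => ?_
  by_cases hA : Agrees (U.zip u) b
  · rw [probGiven, ← eq_assign hu (fun v hv => ?_) hA, mul_comm]
    refine hb.1 v fun hv' => ?_
    obtain ⟨p, hp, rfl⟩ := List.mem_map.1 hv'
    exact hv (unitPriors_vars hp)
  · rw [ind_false hA, zero_mul, mul_zero]

/-- Without intervention an exogenous variable has its drawn state in every solution, so the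
instantiation of the units is a condition on `ω` alone. -/
theorem holds_append_units (hU : ∀ v ∈ U, v ∈ G.exoVars) (ws : List (Inst × Inst))
    (e : Inst) (ω : Var → ℕ) :
    G.Holds (ws ++ [([], e ++ U.zip u)]) ω ↔
      Agrees (U.zip u) ω ∧ G.Holds (ws ++ [([], e)]) ω := by
  have key : ∀ x, G.Sol [] ω x → ∀ v ∈ U, x v = ω v := by
    intro x hx v hv
    obtain ⟨θ, hθ⟩ := mem_exoVars.1 (hU v hv)
    simpa using hx v _ hθ
  unfold Holds
  simp only [List.forall_mem_append, List.forall_mem_singleton]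
  constructor
  · rintro ⟨h, x, hx, he, hxU⟩
    exact ⟨fun p hp => (key x hx _ (zip_vars_subset _ _ (List.mem_map_of_mem hp))).symm.trans
      (hxU p hp), h, x, hx, he⟩
  · rintro ⟨hA, h, x, hx, he⟩
    exact ⟨h, x, hx, he, fun p hp =>
      (key x hx _ (zip_vars_subset _ _ (List.mem_map_of_mem hp))).trans (hA p hp)⟩

theorem priors_append (G G' : SCM) : SCM.priors (G ++ G') = G.priors ++ SCM.priors G' :=
  List.filterMap_append

theorem priors_flatMap {ι : Type} (l : List ι) (f : ι → SCM) :
    SCM.priors (l.flatMap f) = l.flatMap fun c => (f c).priors := List.filterMap_flatMap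

theorem priors_filterMap {f : Var × Mech → Option (Var × Mech)} {g : Var → Var} {q : Var → Bool}
    (h₁ : ∀ v θ, f (v, Mech.exo θ) = if q v then some (g v, Mech.exo θ) else none)
    (h₂ : ∀ v pa k rows, f (v, Mech.endo pa k rows) = none) :
    SCM.priors (G.filterMap f) =
      (G.priors.filter fun p => q p.1).map fun p => (g p.1, p.2) := by
  unfold priors
  induction G with
  | nil => rfl
  | cons n G ih =>
    obtain ⟨v, m⟩ := n
    cases m with
    | endo pa k rows =>
      rw [List.filterMap_cons_none (h₂ _ _ _ _), ih]
      rfl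
    | exo θ =>
      cases hq : q v
      · rw [List.filterMap_cons_none (by rw [h₁, hq]; rfl), ih]
        simp [hq]
      · rw [List.filterMap_cons_some (by rw [h₁, hq]; rfl)]
        simp [hq, ih]

end SCM

/-! ### Independence of the components given the mixture state and the units -/

namespace Objective

open SCM

variable {G : SCM} {U : List Var} {u : List ℕ} {n i : ℕ} {t : Term} {I : USInput}

theorem priors_unitNodes (G : SCM) (U : List Var) :
    (unitNodes G U).priors = (G.unitPriors U).map fun p => (unitVar p.1, p.2) :=
  priors_filterMap (q := fun v => decide (v ∈ U)) (fun v _ => by by_cases h : v ∈ U <;> simp [h])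
    fun _ _ _ _ => rfl

theorem priors_exoNodes (G : SCM) (U : List Var) (i : ℕ) :
    (exoNodes G U i).priors = (G.restPriors U).map fun p => (exoVar i p.1, p.2) :=
  priors_filterMap (q := fun v => !decide (v ∈ U)) (fun v _ => by by_cases h : v ∈ U <;> simp [h])
    fun _ _ _ _ => rfl

/-- The variables of component `i` that are set by an intervention. -/
def actPriors (G : SCM) (U : List Var) (n i : ℕ) (t : Term) : List (Var × List ℚ≥0) :=
  (world G U n i 0 [] []).priors ++ (world G U n i 1 t.x t.y).priors ++
    (world G U n i 2 t.v t.w).priors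

theorem priors_component (G : SCM) (U : List Var) (n i : ℕ) (t : Term) :
    (component G U n i t).priors =
      ((G.restPriors U).map fun p => (exoVar i p.1, p.2)) ++ actPriors G U n i t := by
  simp only [component_eq, priors_append, priors_exoNodes, actPriors, List.append_assoc]

theorem priors_model (I : USInput) : (model I).priors =
    (mixVar, I.L.map Term.weight) :: (((I.G.unitPriors I.U).map fun p => (unitVar p.1, p.2)) ++
      I.L.zipIdx.flatMap fun c => (component I.G I.U I.L.length c.2 c.1).priors) := by
  rw [model_eq, priors_append, priors_flatMap, ← priors_unitNodes]
  rfl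

theorem actPriors_vars {v : Var} (hv : v ∈ (actPriors G U n i t).map Prod.fst) :
    ∃ j < 3, ∃ w, v = endoVar i j w := by
  have key : ∀ j act out, v ∈ (world G U n i j act out).priors.map Prod.fst →
      ∃ w, v = endoVar i j w :=
    fun j act out h => world_vars ((priors_vars_sublist _).subset h)
  simp only [actPriors, List.map_append, List.mem_append] at hv
  rcases hv with (h | h) | h
  · exact ⟨0, by norm_num, key _ _ _ h⟩
  · exact ⟨1, by norm_num, key _ _ _ h⟩
  · exact ⟨2, by norm_num, key _ _ _ h⟩

theorem component_priors_vars {v : Var}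
    (hv : v ∈ (component G U n i t).priors.map Prod.fst) :
    (∃ w, v = exoVar i w) ∨ ∃ j < 3, ∃ w, v = endoVar i j w := by
  rw [priors_component, List.map_append, List.mem_append] at hv
  rcases hv with hv | hv
  · rw [List.map_map] at hv
    obtain ⟨p, -, rfl⟩ := List.mem_map.1 hv
    exact Or.inl ⟨_, rfl⟩
  · exact Or.inr (actPriors_vars hv)

theorem comp_copyVar_update {j : ℕ} {v : Var} (h : ∀ w, copyVar G U i j w ≠ v) (b : Var → ℕ)
    (s : ℕ) : Function.update b v s ∘ copyVar G U i j = b ∘ copyVar G U i j := by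
  funext w
  simp [Function.update_of_ne (h w)]

/-- The indicator of an event of component `i` that depends on the mixture variable. -/
noncomputable def mixInd (G : SCM) (U : List Var) (P Q : Term → (Var → ℕ) → Prop) (c : Term × ℕ)
    (b : Var → ℕ) : ℚ≥0 :=
  if b mixVar = c.2 then ind (P c.1 (b ∘ copyVar G U c.2 3))
  else ind (Q c.1 (b ∘ copyVar G U c.2 3))

theorem mixInd_indep {P Q : Term → (Var → ℕ) → Prop} {c : Term × ℕ} {v : Var} (h₀ : v ≠ mixVar)
    (h : ∀ w, copyVar G U c.2 3 w ≠ v) : IndepOf (mixInd G U P Q c) v := by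
  intro b s
  unfold mixInd
  rw [comp_copyVar_update h, Function.update_of_ne h₀.symm]

theorem mixInd_indep_of_ne {P Q : Term → (Var → ℕ) → Prop} {c : Term × ℕ} {v : Var} {i : ℕ}
    (hi : c.2 ≠ i) (hv : (∃ w, v = exoVar i w) ∨ ∃ j < 3, ∃ w, v = endoVar i j w) :
    IndepOf (mixInd G U P Q c) v := by
  refine mixInd_indep ?_ fun w => ?_
  · rcases hv with ⟨w, rfl⟩ | ⟨j, -, w, rfl⟩ <;> simp [mixVar, exoVar, endoVar]
  · unfold copyVar unitVar exoVar endoVar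
    rcases hv with ⟨w, rfl⟩ | ⟨j, -, w, rfl⟩ <;> split_ifs <;> simp [exoVar, endoVar, hi]

/-- Events of a component read states through `copyVar G U c.2 3`. World `3` does not exist in the
model, so none of the variables set by interventions is read and their priors sum out. The exogenous
copies that remain are renamed back to those of `G`. -/
theorem expect_component (hG : G.WF) (P Q : Term → (Var → ℕ) → Prop) (c : Term × ℕ)
    (hact : ∀ p ∈ actPriors G U n c.2 c.1, p.2.sum = 1) (b : Var → ℕ) :
    expect (component G U n c.2 c.1).priors (mixInd G U P Q c) b =
      if b mixVar = c.2 then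
        expect (G.restPriors U) (fun ω => ind (P c.1 ω)) (b ∘ copyVar G U c.2 3)
      else expect (G.restPriors U) (fun ω => ind (Q c.1 ω)) (b ∘ copyVar G U c.2 3) := by
  rw [priors_component, expect_append]
  have h₁ : expect (actPriors G U n c.2 c.1) (mixInd G U P Q c) = mixInd G U P Q c := by
    funext a
    refine expect_of_indep hact fun v hv => ?_
    obtain ⟨j, hj, w, rfl⟩ := actPriors_vars hv
    refine mixInd_indep (by simp [mixVar, endoVar]) fun w' => ?_
    unfold copyVar unitVar exoVar endoVar
    split_ifs <;> simp
    intro h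
    omega
  have h₂ : ((G.restPriors U).map fun p => (exoVar c.2 p.1, p.2)) =
      (G.restPriors U).map fun p => (copyVar G U c.2 3 p.1, p.2) := by
    refine List.map_congr_left fun p hp => ?_
    rw [copyVar_exo (restPriors_vars hp)]
    exact mem_exoVars.2 ⟨p.2, mem_priors.1 (List.mem_of_mem_filter hp)⟩
  have hnd : (((G.restPriors U).map fun p => (exoVar c.2 p.1, p.2)).map Prod.fst).Nodup := by
    rw [List.map_map]
    have := (hG.nodup_restPriors U).map (exoVar_injective c.2)
    rwa [List.map_map] at this
  have hmix : ∀ a, InSupport ((G.restPriors U).map fun p => (exoVar c.2 p.1, p.2)) b a →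
      a mixVar = b mixVar := by
    intro a ha
    refine ha.1 _ fun h => ?_
    rw [List.map_map] at h
    obtain ⟨p, -, hp⟩ := List.mem_map.1 h
    simp [mixVar, exoVar] at hp
  rw [h₁]
  by_cases hb : b mixVar = c.2
  · rw [if_pos hb, ← expect_map (copyVar_injective G U c.2 3), ← h₂]
    refine expect_congr hnd fun a ha => ?_
    rw [mixInd, hmix a ha, if_pos hb]
  · rw [if_neg hb, ← expect_map (copyVar_injective G U c.2 3), ← h₂]
    refine expect_congr hnd fun a ha => ?_
    rw [mixInd, hmix a ha, if_neg hb]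

theorem actPriors_sum (hI : UnitSelection.Valid I) {c : Term × ℕ} (hc : c ∈ I.L.zipIdx) :
    ∀ p ∈ actPriors I.G I.U I.L.length c.2 c.1, p.2.sum = 1 := by
  rintro ⟨v, θ⟩ hp
  refine (wf_model hI).2.2.1 v θ (mem_priors.1 ?_)
  rw [priors_model]
  refine List.mem_cons_of_mem _ (List.mem_append_right _ (List.mem_flatMap.2 ⟨c, hc, ?_⟩))
  rw [priors_component]
  exact List.mem_append_right _ hp

/-- The order of drawing is mixture variable, units, components. For a fixed mixture state `s` and
units `u` the components are independent blocks, and component `s` is the one evaluated with `P`. -/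
theorem expect_model (hI : UnitSelection.Valid I) (hu : I.U.length = u.length)
    (P Q : Term → (Var → ℕ) → Prop) :
    expect (model I).priors (fun α => ind (Agrees ((I.U.map unitVar).zip u) α) *
        (I.L.zipIdx.map fun c => mixInd I.G I.U P Q c α).prod) 0 =
      ∑ s ∈ Finset.range (I.L.map Term.weight).length, (I.L.map Term.weight).getD s 0 *
        (I.G.unitProb I.U u * (I.L.zipIdx.map fun c => if s = c.2
          then I.G.probGiven I.U u (P c.1) else I.G.probGiven I.U u (Q c.1)).prod) := by
  have hG := (valid_iff.1 hI).1
  rw [priors_model, expect]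
  refine Finset.sum_congr rfl fun s _ => congrArg _ ?_
  rw [expect_append]
  have h₁ : expect (I.L.zipIdx.flatMap fun c => (component I.G I.U I.L.length c.2 c.1).priors)
      (fun α => ind (Agrees ((I.U.map unitVar).zip u) α) *
        (I.L.zipIdx.map fun c => mixInd I.G I.U P Q c α).prod) = fun b =>
      ind (Agrees ((I.U.map unitVar).zip u) b) * (I.L.zipIdx.map fun c =>
        expect (component I.G I.U I.L.length c.2 c.1).priors (mixInd I.G I.U P Q c) b).prod := by
    funext b
    rw [expect_mul_left, expect_flatMap]
    · refine (pairwise_zipIdx I.L).imp fun {c d} hcd => ⟨fun v hv => ⟨?_, fun hv' => ?_⟩,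
        fun v hv => ?_⟩
      · exact mixInd_indep_of_ne hcd.symm (component_priors_vars hv)
      · rcases component_priors_vars hv with ⟨w, rfl⟩ | ⟨j, -, w, rfl⟩ <;>
          rcases component_priors_vars hv' with ⟨w', h⟩ | ⟨j', -, w', h⟩ <;>
          simp [exoVar, endoVar] at h <;> exact hcd h.1
      · exact mixInd_indep_of_ne hcd (component_priors_vars hv)
    · intro v hv
      refine agrees_indep fun hv' => ?_
      obtain ⟨w, -, rfl⟩ := List.mem_map.1 (zip_vars_subset _ _ hv')
      rw [List.map_flatMap, List.mem_flatMap] at hv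
      obtain ⟨c, -, hv⟩ := hv
      rcases component_priors_vars hv with ⟨w', h⟩ | ⟨j', -, w', h⟩ <;>
        simp [unitVar, exoVar, endoVar] at h
  have hvars : ((I.G.unitPriors I.U).map fun p => (unitVar p.1, p.2)).map Prod.fst =
      ((I.G.unitPriors I.U).map Prod.fst).map unitVar := by
    simp [Function.comp_def]
  have hnd : (((I.G.unitPriors I.U).map fun p => (unitVar p.1, p.2)).map Prod.fst).Nodup := by
    rw [hvars]
    exact (hG.nodup_unitPriors I.U).map unitVar_injective
  have hzip : (I.U.map unitVar).zip u = (I.U.zip u).map fun p => (unitVar p.1, p.2) := by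
    rw [List.zip_map_left]
    rfl
  have h₂ : expect ((I.G.unitPriors I.U).map fun p => (unitVar p.1, p.2))
      (fun b => ind (Agrees ((I.U.map unitVar).zip u) b)) (Function.update 0 mixVar s) =
      I.G.unitProb I.U u := by
    have h := expect_map (l := I.G.unitPriors I.U) (a := Function.update 0 mixVar s)
      (F := fun ω => ind (Agrees (I.U.zip u) ω)) unitVar_injective
    have h' : Function.update (0 : Var → ℕ) mixVar s ∘ unitVar = 0 := by
      funext v
      simp [unitVar, mixVar]
    rw [h'] at h
    rw [unitProb, ← h]
    congr 1
    funext b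
    rw [hzip]
    simp only [Agrees, List.forall_mem_map]
    rfl
  rw [h₁, ← h₂, mul_comm, ← expect_mul_left (l := (I.G.unitPriors I.U).map _)
    (g := fun _ => (I.L.zipIdx.map fun c => if s = c.2
          then I.G.probGiven I.U u (P c.1) else I.G.probGiven I.U u (Q c.1)).prod)
    fun _ _ _ _ => rfl]
  refine expect_congr hnd fun b hb => ?_
  by_cases hA : Agrees ((I.U.map unitVar).zip u) b
  swap
  · rw [ind_false hA, zero_mul, mul_zero]
  rw [mul_comm]
  congr 2
  refine List.map_congr_left fun c hc => ?_
  rw [expect_component hG P Q c (actPriors_sum hI hc)]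
  have hb₀ : b mixVar = s := by
    rw [hb.1, Function.update_self]
    rw [hvars]
    intro h
    obtain ⟨v, -, hv⟩ := List.mem_map.1 h
    simp [unitVar, mixVar] at hv
  -- At this stage only the mixture variable and the units have been drawn. All other names,
  -- including those of the fictitious world `3`, still have state `0`.
  have hbu : b ∘ copyVar I.G I.U c.2 3 = assign I.U u := by
    refine eq_assign hu (fun v hv => ?_) fun p hp => ?_
    · rw [Function.comp_apply, hb.1, Function.update_of_ne]
      · rfl
      · unfold copyVar unitVar exoVar endoVar mixVar
        split_ifs <;> simp
      · rw [hvars]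
        intro h
        obtain ⟨w, hw, hv'⟩ := List.mem_map.1 h
        obtain ⟨q, hq, rfl⟩ := List.mem_map.1 hw
        rw [← copyVar_unit (G := I.G) (i := c.2) (j := 3) (unitPriors_vars hq)] at hv'
        exact hv (copyVar_injective _ _ _ _ hv' ▸ unitPriors_vars hq)
    · rw [Function.comp_apply, copyVar_unit (zip_vars_subset _ _ (List.mem_map_of_mem hp))]
      exact hA (unitVar p.1, p.2) (hzip ▸ List.mem_map_of_mem hp)
  rw [hb₀, hbu]
  rfl

end Objective

/-! ### The value of the objective model -/

/-- Equal feasible sets and equal values on them force equal sets of maximizers. -/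
theorem OptProblem.isPolyReduction_of {P Q : OptProblem} {f : P.Input → Q.Input}
    (hf : OptProblem.PolyTime P Q f)
    (h : ∀ I, P.Valid I → Q.Valid (f I) ∧ (∀ u, Q.Feasible (f I) u ↔ P.Feasible I u) ∧
      ∀ u, P.Feasible I u → Q.value (f I) u = P.value I u) : OptProblem.IsPolyReduction P Q f := by
  refine ⟨hf, fun I hI => ?_⟩
  obtain ⟨h₁, h₂, h₃⟩ := h I hI
  refine ⟨h₁, fun u => ?_, h₂, h₃⟩
  unfold OptProblem.IsArgMax
  rw [h₂]
  refine and_congr_right fun hu => forall_congr' fun u' => ?_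
  rw [h₂]
  refine forall_congr' fun hu' => ?_
  rw [h₃ u hu, h₃ u' hu']

namespace SCM

variable {G : SCM}

theorem WF.lt_card_of_inSupport (h : G.WF) {α : Var → ℕ} (hα : InSupport G.priors 0 α) :
    ∀ v ∈ G.exoVars, α v < G.card v := by
  intro v hv
  obtain ⟨θ, hθ⟩ := mem_exoVars.1 hv
  rw [h.card hθ]
  exact List.lt_length_of_getD_ne_zero (hα.2 (v, θ) (mem_priors.2 hθ))

/-- By uniqueness the existential quantifier in `Holds` can be tested on any solution at hand. -/
theorem WF.exists_sol_iff (h : G.WF) {act out : Inst} {ω x : Var → ℕ} (hx : G.Sol act ω x)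
    (hout : ∀ p ∈ out, p.1 ∈ G.vars) :
    (∃ x, G.Sol act ω x ∧ ∀ c ∈ out, x c.1 = c.2) ↔ Agrees out x :=
  ⟨fun ⟨_, hy, hc⟩ p hp => (h.sol_unique hx hy _ (hout p hp)).trans (hc p hp),
    fun hc => ⟨x, hx, hc⟩⟩

theorem agrees_append {e e' : Inst} {x : Var → ℕ} :
    Agrees (e ++ e') x ↔ Agrees e x ∧ Agrees e' x := List.forall_mem_append

theorem holds_cons {w : Inst × Inst} {ws : List (Inst × Inst)} {ω : Var → ℕ} :
    G.Holds (w :: ws) ω ↔ (∃ x, G.Sol w.1 ω x ∧ ∀ c ∈ w.2, x c.1 = c.2) ∧ G.Holds ws ω :=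
  List.forall_mem_cons

theorem holds_nil {ω : Var → ℕ} : G.Holds [] ω := by simp [Holds]

end SCM

namespace Term

/-- The worlds in which the outcomes of `t` and its evidence are observed. -/
def worlds (t : Term) : List (Inst × Inst) := [(t.x, t.y), (t.v, t.w), ([], t.e)]

/-- The world in which the evidence of `t` is observed. -/
def evidenceWorlds (t : Term) : List (Inst × Inst) := [([], t.e)]

end Term

namespace Objective

open SCM

variable {I : USInput} {α x : Var → ℕ} {c : Term × ℕ} {j : ℕ} {u : List ℕ}

/-! ### Solutions of the objective model, world by world -/

section Events

variable (hI : UnitSelection.Valid I) (hα : InSupport (model I).priors 0 α)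
  (hx : (model I).Sol [] α x) (hc : c ∈ I.L.zipIdx)
include hI

theorem agrees_copyInst {e : Inst} (he : I.G.IsEndoInst e) (i j : ℕ) :
    Agrees (copyInst i j e) x ↔ Agrees e (x ∘ copyVar I.G I.U i j) := by
  obtain ⟨hG, -, hU, -⟩ := valid_iff.1 hI
  unfold Agrees copyInst
  rw [List.forall_mem_map]
  refine forall₂_congr fun p hp => ?_
  obtain ⟨pa, k, rows, hm⟩ := SCM.mem_endoVars.1 (he.2 p hp)
  rw [Function.comp_apply, copyVar_endo hU (hG.endo_notMem_exoVars hm)]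

include hα hx hc

/-- In a component not selected by the mixture variable, an outcome variable is constant, exactly as
if it had been set by an intervention. The states in world `j` therefore solve `G` under `act` in
the selected component and under `act ++ out` in the others. -/
theorem sol_copy (hj : j < 3) :
    I.G.Sol (if α mixVar = c.2 then c.1.act j else c.1.act j ++ c.1.out j)
      (α ∘ copyVar I.G I.U c.2 3) (x ∘ copyVar I.G I.U c.2 j) := by
  obtain ⟨hG, -, hU, -⟩ := valid_iff.1 hI
  have hact := valid_act hI (fst_mem_of_mem_zipIdx hc) j
  have hout := valid_out hI (fst_mem_of_mem_zipIdx hc) j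
  intro v m hm
  cases m with
  | exo θ =>
    have hv : v ∈ I.G.exoVars := mem_exoVars.2 ⟨θ, hm⟩
    have hn : ∀ e : Inst, I.G.IsEndoInst e → e.lookup v = none := by
      intro e he
      rw [List.lookup_eq_none_iff_notMem]
      intro h
      obtain ⟨p, hp, rfl⟩ := List.mem_map.1 h
      obtain ⟨pa, k, rows, hm'⟩ := SCM.mem_endoVars.1 (he.2 p hp)
      exact hG.endo_notMem_exoVars hm' hv
    have hl : (if α mixVar = c.2 then c.1.act j else c.1.act j ++ c.1.out j).lookup v = none := by
      split_ifs
      · exact hn _ hact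
      · rw [List.lookup_append, hn _ hact, hn _ hout]
        rfl
    simp only [hl, Function.comp_apply]
    by_cases hvU : v ∈ I.U
    · rw [copyVar_unit hvU, copyVar_unit hvU]
      exact hx (unitVar v) (Mech.exo θ)
        (mem_model.2 (Or.inr (Or.inl (mem_unitNodes.2 ⟨v, θ, hm, hvU, rfl, rfl⟩))))
    · rw [copyVar_exo hvU hv, copyVar_exo hvU hv]
      exact hx (exoVar c.2 v) (Mech.exo θ) (mem_model.2 (Or.inr (Or.inr ⟨c, hc,
        mem_component.2 (Or.inl (mem_exoNodes.2 ⟨v, θ, hm, hvU, rfl, rfl⟩))⟩)))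
  | endo pa k rows =>
    have hnode : (endoVar c.2 j v, worldMech I.G I.U I.L.length c.2 j (c.1.act j) (c.1.out j) v pa
        k rows) ∈ model I :=
      mem_model.2 (Or.inr (Or.inr ⟨c, hc, mem_component.2 (Or.inr ⟨j, hj,
        mem_world.2 ⟨v, pa, k, rows, hm, rfl, rfl⟩⟩)⟩))
    have hxv := hx _ _ hnode
    have hcv : copyVar I.G I.U c.2 j v = endoVar c.2 j v :=
      copyVar_endo hU (hG.endo_notMem_exoVars hm)
    simp only [List.lookup_nil] at hxv
    unfold worldMech at hxv hnode
    cases ha : (c.1.act j).lookup v with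
    | some s =>
      have hl : (if α mixVar = c.2 then c.1.act j else c.1.act j ++ c.1.out j).lookup v =
          some s := by
        split_ifs
        · exact ha
        · rw [List.lookup_append, ha]
          rfl
      simp only [ha] at hxv hnode
      -- The variable is a root with all its mass on `s`, and `α` lies in the support.
      have hs := hα.2 _ (mem_priors.2 hnode)
      have hlt := List.lt_length_of_getD_ne_zero hs
      simp only [List.getD_eq_getElem _ _ hlt, List.getElem_map, List.getElem_range, ne_eq,
        ite_eq_right_iff, one_ne_zero, imp_false, not_not] at hs
      simp only [hl, Function.comp_apply, hcv]
      exact hxv.trans hs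
    | none =>
      cases ho : (c.1.out j).lookup v with
      | none =>
        have hl : (if α mixVar = c.2 then c.1.act j else c.1.act j ++ c.1.out j).lookup v =
            none := by
          split_ifs
          · exact ha
          · rw [List.lookup_append, ha, ho]
            rfl
        simp only [ha, ho, List.map_map] at hxv
        simp only [hl, Function.comp_apply, hcv]
        exact hxv
      | some z =>
        have hmix : x mixVar = α mixVar :=
          hx mixVar (Mech.exo (I.L.map Term.weight)) (mem_model.2 (Or.inl ⟨rfl, rfl⟩))
        simp only [ha, ho, List.map_cons, List.map_map, hmix] at hxv
        -- The row that was used starts with the mixture state, which decides between the original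
        -- value and `z`.
        obtain ⟨l₁, l₂, hl', -⟩ := List.lookup_eq_some_iff.1 hxv
        have hmem : (α mixVar :: pa.map (x ∘ copyVar I.G I.U c.2 j), x (endoVar c.2 j v)) ∈
            rows.flatMap fun r => (List.range I.L.length).map fun h =>
              (h :: r.1, if h = c.2 then r.2 else z) := by
          rw [hl']
          simp
        simp only [List.mem_flatMap, List.mem_map, Prod.mk.injEq, List.cons.injEq] at hmem
        obtain ⟨r, hr, h, -, ⟨rfl, h₁⟩, h₂⟩ := hmem
        by_cases hh : α mixVar = c.2
        · simp only [if_pos hh, ha] at h₂ ⊢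
          have hr' := (List.lookup_eq_some_iff_mem (hG.endo hm).2.2.2.1 (a := r.1) (b := r.2)).2 hr
          rw [h₁, h₂, ← hcv] at hr'
          exact hr'
        · simp only [if_neg hh] at h₂ ⊢
          have hl : (c.1.act j ++ c.1.out j).lookup v = some z := by
            rw [List.lookup_append, ha, ho]
            rfl
          simp only [hl, Function.comp_apply, hcv]
          exact h₂.symm

theorem agrees_act (hj : j < 3) : Agrees (copyInst c.2 j (c.1.act j)) x := by
  have hact := valid_act hI (fst_mem_of_mem_zipIdx hc) j
  rw [agrees_copyInst hI hact]
  intro p hp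
  obtain ⟨m, hm⟩ := mem_vars.1 (hact.1.2 p hp).1
  have h := sol_copy hI hα hx hc hj p.1 m hm
  have ha : (c.1.act j).lookup p.1 = some p.2 := (List.lookup_eq_some_iff_mem hact.1.1).2 hp
  have hl : (if α mixVar = c.2 then c.1.act j else c.1.act j ++ c.1.out j).lookup p.1 =
      some p.2 := by
    split_ifs
    · exact ha
    · rw [List.lookup_append, ha]
      rfl
  simpa only [hl] using h

theorem agrees_out_of_ne (hj : j < 3) (hmix : α mixVar ≠ c.2) :
    Agrees (copyInst c.2 j (c.1.out j)) x := by
  have hout := valid_out hI (fst_mem_of_mem_zipIdx hc) j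
  rw [agrees_copyInst hI hout]
  intro p hp
  obtain ⟨m, hm⟩ := mem_vars.1 (hout.1.2 p hp).1
  have h := sol_copy hI hα hx hc hj p.1 m hm
  have ha : (c.1.act j).lookup p.1 = none := by
    rw [List.lookup_eq_none_iff_notMem]
    exact fun h => valid_disjoint hI (fst_mem_of_mem_zipIdx hc) j h (List.mem_map_of_mem hp)
  have hl : (if α mixVar = c.2 then c.1.act j else c.1.act j ++ c.1.out j).lookup p.1 =
      some p.2 := by
    rw [if_neg hmix, List.lookup_append, ha, (List.lookup_eq_some_iff_mem hout.1.1).2 hp]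
    rfl
  simpa only [hl] using h

theorem agrees_out_of_eq (hj : j < 3) (hmix : α mixVar = c.2) :
    Agrees (copyInst c.2 j (c.1.out j)) x ↔ ∃ y, I.G.Sol (c.1.act j)
      (α ∘ copyVar I.G I.U c.2 3) y ∧ ∀ p ∈ c.1.out j, y p.1 = p.2 := by
  have hout := valid_out hI (fst_mem_of_mem_zipIdx hc) j
  have h := sol_copy hI hα hx hc hj
  rw [if_pos hmix] at h
  rw [agrees_copyInst hI hout, (valid_iff.1 hI).1.exists_sol_iff h fun p hp => (hout.1.2 p hp).1]

theorem agrees_evidence : Agrees (copyInst c.2 0 c.1.e) x ↔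
    I.G.Holds c.1.evidenceWorlds (α ∘ copyVar I.G I.U c.2 3) := by
  have he := ((valid_iff.1 hI).2.2.2.1 c.1 (fst_mem_of_mem_zipIdx hc)).2.2.2.2.1
  have h := sol_copy hI hα hx hc (j := 0) (by norm_num)
  -- In world `0` both `act` and `out` are empty, so the mixture variable plays no role.
  have h' : I.G.Sol [] (α ∘ copyVar I.G I.U c.2 3) (x ∘ copyVar I.G I.U c.2 0) := by
    convert h using 1
    split_ifs <;> rfl
  rw [agrees_copyInst hI he, Term.evidenceWorlds, holds_cons,
    (valid_iff.1 hI).1.exists_sol_iff h' fun p hp => (he.1.2 p hp).1]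
  exact (and_iff_left holds_nil).symm

theorem agrees_component : (Agrees (copyInst c.2 1 c.1.y ++ copyInst c.2 2 c.1.w) x ∧
    Agrees (copyInst c.2 0 c.1.e) x) ↔ if α mixVar = c.2
      then I.G.Holds c.1.worlds (α ∘ copyVar I.G I.U c.2 3)
      else I.G.Holds c.1.evidenceWorlds (α ∘ copyVar I.G I.U c.2 3) := by
  rw [agrees_append, agrees_evidence hI hα hx hc]
  by_cases hmix : α mixVar = c.2
  · rw [if_pos hmix, Term.worlds, holds_cons, holds_cons]
    have h₁ := agrees_out_of_eq hI hα hx hc (j := 1) (by norm_num) hmix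
    have h₂ := agrees_out_of_eq hI hα hx hc (j := 2) (by norm_num) hmix
    rw [and_assoc]
    exact and_congr h₁ (and_congr h₂ Iff.rfl)
  · rw [if_neg hmix]
    exact and_iff_right ⟨agrees_out_of_ne hI hα hx hc (j := 1) (by norm_num) hmix,
      agrees_out_of_ne hI hα hx hc (j := 2) (by norm_num) hmix⟩

omit hc

omit hα in
theorem agrees_units : Agrees ((I.U.map unitVar).zip u) x ↔
    Agrees ((I.U.map unitVar).zip u) α := by
  refine forall₂_congr fun p hp => ?_
  obtain ⟨v, hv, hp'⟩ := List.mem_map.1 (zip_vars_subset _ _ (List.mem_map_of_mem hp))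
  obtain ⟨θ, hθ⟩ := mem_exoVars.1 ((valid_iff.1 hI).2.2.1 v hv)
  have := hx (unitVar v) (Mech.exo θ)
    (mem_model.2 (Or.inr (Or.inl (mem_unitNodes.2 ⟨v, θ, hθ, hv, rfl, rfl⟩))))
  rw [← hp']
  exact Eq.congr_left this

/-- The conditions on intervened variables hold automatically on the support, so only the evidence
remains. -/
theorem agrees_e₂ : Agrees (toRMAP I).e₂ x ↔
    ∀ c ∈ I.L.zipIdx, Agrees (copyInst c.2 0 c.1.e) x := by
  unfold Agrees toRMAP
  simp only [List.forall_mem_flatMap]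
  refine forall₂_congr fun c hc => ?_
  change Agrees (_ ++ _ ++ _) x ↔ _
  rw [agrees_append, agrees_append]
  exact and_iff_right ⟨agrees_act hI hα hx hc (j := 1) (by norm_num),
    agrees_act hI hα hx hc (j := 2) (by norm_num)⟩

end Events

/-! ### Numerator and denominator in the objective model -/

section Value

variable (hI : UnitSelection.Valid I)
include hI

theorem inst_vars_subset (u : List ℕ) : ∀ p ∈ (toRMAP I).e₁ ++ (toRMAP I).U.zip u ++ (toRMAP I).e₂,
    p.1 ∈ (model I).vars := by
  obtain ⟨-, -, hU, h₁, h₂, -⟩ := valid_toRMAP hI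
  intro p hp
  rcases List.mem_append.1 hp with hp | hp
  · rcases List.mem_append.1 hp with hp | hp
    · exact (h₁.2 p hp).1
    · exact hU (zip_vars_subset _ _ (List.mem_map_of_mem hp))
  · exact (h₂.2 p hp).1

omit hI in
theorem ind_mix (P Q : Term → (Var → ℕ) → Prop) (c : Term × ℕ) (α : Var → ℕ) :
    ind (if α mixVar = c.2 then P c.1 (α ∘ copyVar I.G I.U c.2 3)
      else Q c.1 (α ∘ copyVar I.G I.U c.2 3)) = mixInd I.G I.U P Q c α := by
  unfold mixInd
  split_ifs <;> rfl

/-- The numerator `Pr(u) * ∑_s w_s a_s ∏_{i ≠ s} b_i`, obtained from `expect_model` with the full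
event of a summand as `P` and its evidence alone as `Q`. -/
theorem obs_e₁ (hu : I.U.length = u.length) :
    (model I).obs ((toRMAP I).e₁ ++ (toRMAP I).U.zip u ++ (toRMAP I).e₂) =
      ∑ s ∈ Finset.range (I.L.map Term.weight).length, (I.L.map Term.weight).getD s 0 *
        (I.G.unitProb I.U u * (I.L.zipIdx.map fun c => if s = c.2
          then I.G.probGiven I.U u (I.G.Holds c.1.worlds)
          else I.G.probGiven I.U u (I.G.Holds c.1.evidenceWorlds)).prod) := by
  have hG' := wf_model hI
  rw [SCM.obs, hG'.prob_eq_ind, ← expect_model hI hu (fun t => I.G.Holds t.worlds)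
    fun t => I.G.Holds t.evidenceWorlds]
  refine expect_congr hG'.priors_nodup fun α hα => ?_
  obtain ⟨x, hx, -⟩ := hG'.exists_sol (hG'.lt_card_of_inSupport hα)
  simp only [← ind_mix, ← ind_forall_mem, ← ind_and]
  refine congrArg ind (propext ?_)
  rw [holds_cons, hG'.exists_sol_iff hx (inst_vars_subset hI u), and_iff_left holds_nil,
    agrees_append, agrees_append, and_right_comm, and_comm]
  refine and_congr (agrees_units hI hx) ?_
  rw [agrees_e₂ hI hα hx]
  have h₁ : Agrees (toRMAP I).e₁ x ↔ ∀ c ∈ I.L.zipIdx,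
      Agrees (copyInst c.2 1 c.1.y ++ copyInst c.2 2 c.1.w) x := List.forall_mem_flatMap
  rw [h₁, ← forall₂_and]
  exact forall₂_congr fun c hc => agrees_component hI hα hx hc

theorem obs_e₂ (hu : I.U.length = u.length) :
    (model I).obs ((toRMAP I).U.zip u ++ (toRMAP I).e₂) = I.G.unitProb I.U u *
      (I.L.map fun t => I.G.probGiven I.U u (I.G.Holds t.evidenceWorlds)).prod := by
  have hG' := wf_model hI
  -- With the same event in both cases the product no longer depends on the mixture state, and the
  -- weights sum to one.
  have h := expect_model hI hu (fun t => I.G.Holds t.evidenceWorlds)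
    fun t => I.G.Holds t.evidenceWorlds
  have hz : (I.L.zipIdx.map fun c =>
      I.G.probGiven I.U u (I.G.Holds c.1.evidenceWorlds)).prod =
      (I.L.map fun t => I.G.probGiven I.U u (I.G.Holds t.evidenceWorlds)).prod := by
    congr 1
    conv_rhs => rw [← List.zipIdx_map_fst 0 I.L, List.map_map]
    rfl
  simp only [ite_self, hz] at h
  rw [← Finset.sum_mul, List.sum_range_getD, (valid_iff.1 hI).2.2.2.2, one_mul] at h
  rw [SCM.obs, hG'.prob_eq_ind, ← h]
  refine expect_congr hG'.priors_nodup fun α hα => ?_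
  obtain ⟨x, hx, -⟩ := hG'.exists_sol (hG'.lt_card_of_inSupport hα)
  simp only [← ind_mix, ← ind_forall_mem, ← ind_and, ite_self]
  refine congrArg ind (propext ?_)
  rw [holds_cons, hG'.exists_sol_iff hx (fun p hp => inst_vars_subset hI u p (by
    rw [List.append_assoc]; exact List.mem_append_right _ hp)), and_iff_left holds_nil,
    agrees_append]
  refine and_congr (agrees_units hI hx) ?_
  rw [agrees_e₂ hI hα hx]
  exact forall₂_congr fun c hc => agrees_evidence hI hα hx hc

theorem prob_worlds (hu : I.U.length = u.length) (t : Term) :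
    I.G.prob [(t.x, t.y), (t.v, t.w), ([], t.e ++ I.U.zip u)] =
      I.G.unitProb I.U u * I.G.probGiven I.U u (I.G.Holds t.worlds) := by
  obtain ⟨hG, -, hU, -⟩ := valid_iff.1 hI
  rw [hG.prob_eq_ind, ← hG.expect_and hu]
  congr 1
  funext ω
  rw [← List.singleton_append, ← List.singleton_append (l := [_]), ← List.append_assoc,
    holds_append_units hU]
  rfl

theorem obs_evidence (hu : I.U.length = u.length) (t : Term) :
    I.G.obs (t.e ++ I.U.zip u) =
      I.G.unitProb I.U u * I.G.probGiven I.U u (I.G.Holds t.evidenceWorlds) := by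
  obtain ⟨hG, -, hU, -⟩ := valid_iff.1 hI
  rw [SCM.obs, hG.prob_eq_ind, ← hG.expect_and hu]
  congr 1
  funext ω
  rw [← List.nil_append [_], holds_append_units hU]
  rfl

-- Exchanging the factor of index `s` multiplies the product by `a / b` at that place. The offset
-- `k` is there for the induction, as the tail is numbered from `k + 1`.
omit hI in
theorem prod_zipIdx_ite (L : List Term) (a b : Term → ℚ≥0) (k s : ℕ) (hb : ∀ t ∈ L, b t ≠ 0) :
    ((L.zipIdx k).map fun c => if s = c.2 then a c.1 else b c.1).prod =
      (L.map b).prod * if h : k ≤ s ∧ s - k < L.length then a L[s - k] / b L[s - k] else 1 := by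
  induction L generalizing k with
  | nil => simp
  | cons t L ih =>
    simp only [List.mem_cons, forall_eq_or_imp] at hb
    rw [List.zipIdx_cons, List.map_cons, List.prod_cons, ih (k + 1) hb.2, List.map_cons,
      List.prod_cons]
    have hbt := hb.1
    by_cases hs : s = k
    · subst hs
      simp
      field_simp
    · simp only [hs, if_false]
      by_cases h : k + 1 ≤ s
      · obtain ⟨d, rfl⟩ := Nat.exists_eq_add_of_le h
        have h₁ : k + 1 + d - k = d + 1 := by omega
        have h₂ : k + 1 + d - (k + 1) = d := by omega
        have h₃ : k ≤ k + 1 + d := by omega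
        simp only [h₁, h₂, h₃, h, true_and, List.length_cons, Nat.add_lt_add_iff_right,
          List.getElem_cons_succ, mul_assoc]
      · have h₁ : ¬ k ≤ s := by omega
        simp [h, h₁]

theorem feasible_iff : RMAP.Feasible (toRMAP I) u ↔ UnitSelection.Feasible I u := by
  obtain ⟨hG, -, hU, -, hw⟩ := valid_iff.1 hI
  -- With no summand, feasibility would not require `Pr(u) ≠ 0` on the side of unit selection.
  have hL : I.L ≠ [] := by
    rintro h
    simp [h] at hw
  change ((model I).IsStates u (I.U.map unitVar) ∧ (model I).obs _ ≠ 0) ↔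
    (I.G.IsStates u I.U ∧ ∀ t ∈ I.L, I.G.obs (t.e ++ I.U.zip u) ≠ 0)
  rw [SCM.isStates_map (G := I.G)]
  · refine and_congr_right fun hs => ?_
    have hu : I.U.length = u.length := hs.length_eq.symm
    rw [obs_e₂ hI hu]
    simp only [obs_evidence hI hu, ne_eq, mul_eq_zero, not_or, List.prod_eq_zero_iff, List.mem_map,
      not_exists, not_and]
    obtain ⟨t, ht⟩ := List.exists_mem_of_ne_nil _ hL
    exact ⟨fun h t ht => ⟨h.1, h.2 t ht⟩, fun h => ⟨(h t ht).1, fun t ht => (h t ht).2⟩⟩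
  · intro v hv
    obtain ⟨θ, hθ⟩ := mem_exoVars.1 (hU v hv)
    rw [hG.card hθ, (wf_model hI).card (mem_model.2 (Or.inr (Or.inl
      (mem_unitNodes.2 ⟨v, θ, hθ, hv, rfl, rfl⟩))))]

theorem value_eq (hf : UnitSelection.Feasible I u) :
    RMAP.value (toRMAP I) u = UnitSelection.value I u := by
  obtain ⟨hs, hf⟩ := hf
  have hu : I.U.length = u.length := hs.length_eq.symm
  change (model I).obs ((toRMAP I).e₁ ++ (toRMAP I).U.zip u ++ (toRMAP I).e₂) /
      (model I).obs ((toRMAP I).U.zip u ++ (toRMAP I).e₂) =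
    (I.L.map fun t => t.weight * (I.G.prob [(t.x, t.y), (t.v, t.w), ([], t.e ++ I.U.zip u)] /
      I.G.obs (t.e ++ I.U.zip u))).sum
  have hL : I.L ≠ [] := by
    have hw := (valid_iff.1 hI).2.2.2.2
    rintro h
    simp [h] at hw
  obtain ⟨t, ht⟩ := List.exists_mem_of_ne_nil _ hL
  simp only [obs_evidence hI hu, ne_eq, mul_eq_zero, not_or] at hf
  have hπ := (hf t ht).1
  have hb : ∀ t ∈ I.L, I.G.probGiven I.U u (I.G.Holds t.evidenceWorlds) ≠ 0 :=
    fun t ht => (hf t ht).2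
  have hB : (I.L.map fun t => I.G.probGiven I.U u (I.G.Holds t.evidenceWorlds)).prod ≠ 0 := by
    simp only [ne_eq, List.prod_eq_zero_iff, List.mem_map, not_exists, not_and]
    exact hb
  rw [obs_e₁ hI hu, obs_e₂ hI hu, div_eq_iff (mul_ne_zero hπ hB)]
  -- The factor `Pr(u)` cancels in every summand of `L`, and the sums are then compared term by
  -- term.
  simp only [prob_worlds hI hu, obs_evidence hI hu, mul_div_mul_left _ _ hπ]
  rw [← List.sum_range_getD, List.length_map, List.length_map, Finset.sum_mul]
  refine Finset.sum_congr rfl fun s hs => ?_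
  rw [Finset.mem_range] at hs
  rw [prod_zipIdx_ite I.L (fun t => I.G.probGiven I.U u (I.G.Holds t.worlds))
    (fun t => I.G.probGiven I.U u (I.G.Holds t.evidenceWorlds)) 0 s hb]
  rw [List.getD_eq_getElem _ _ (by simpa using hs), List.getD_eq_getElem _ _ (by simpa using hs)]
  simp only [List.getElem_map, Nat.sub_zero, Nat.zero_le, true_and, hs, dif_pos]
  ring

end Value

theorem isPolyReduction_toRMAP :
    OptProblem.IsPolyReduction UnitSelection RMAP Objective.toRMAP :=
  OptProblem.isPolyReduction_of polyTime_toRMAP fun _ hI =>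
    ⟨valid_toRMAP hI, fun _ => feasible_iff hI, fun _ => value_eq hI⟩

end Objective

/-! ### Correctness of the reduction from Reverse-MAP -/

theorem length_dyadicPrior {k : ℕ} (hk : 0 < k) : (dyadicPrior k).length = k := by
  simp [dyadicPrior]
  omega

theorem sum_dyadicPrior (k : ℕ) : (dyadicPrior k).sum = 1 := by
  unfold dyadicPrior
  rw [List.sum_cons]
  generalize k - 1 = n
  induction n with
  | zero => simp
  | succ n ih =>
    -- The first entry `(1 / 2) ^ n` is split into two equal halves, one of which becomes the new
    -- last entry.
    have h : (1 / 2 : ℚ≥0) ^ (n + 1) + (1 / 2) ^ (n + 1) = (1 / 2) ^ n := by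
      rw [pow_succ, ← mul_add]
      norm_num
    rw [List.range_succ, List.map_append, List.sum_append, List.map_singleton, List.sum_singleton]
    refine Eq.trans ?_ ih
    rw [← h, add_assoc, add_comm (List.sum _)]

theorem getD_dyadicPrior_ne_zero {k s : ℕ} (h : s < k) : (dyadicPrior k).getD s 0 ≠ 0 := by
  have hs : s < (dyadicPrior k).length := by rwa [length_dyadicPrior (by omega)]
  rw [List.getD_eq_getElem _ _ hs]
  have key : ∀ q ∈ dyadicPrior k, q ≠ 0 := by
    intro q hq
    rcases List.mem_cons.1 hq with rfl | hq
    · positivity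
    · obtain ⟨i, -, rfl⟩ := List.mem_map.1 hq
      positivity
  exact key _ (List.getElem_mem hs)

theorem forall_eq_and_agrees_zip {U : List Var} {u : List ℕ} (hu : U.length = u.length)
    {a b : Var → ℕ} :
    (∀ v ∈ U, a v = b v) ∧ Agrees (U.zip u) b ↔ Agrees (U.zip u) a ∧ Agrees (U.zip u) b := by
  refine and_congr_left fun hb => ⟨fun h p hp => ?_, fun h v hv => ?_⟩
  · rw [h _ (zip_vars_subset _ _ (List.mem_map_of_mem hp)), hb p hp]
  · rw [← List.map_fst_zip (l₁ := U) (l₂ := u) hu.le] at hv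
    obtain ⟨p, hp, rfl⟩ := List.mem_map.1 hv
    rw [h p hp, hb p hp]

namespace Targets

open SCM

variable {G : SCM} {w : Var} {m : Mech} {I : RMAPInput} {u : List ℕ}

theorem origVar_injective : Function.Injective origVar := fun _ _ h => by simpa [origVar] using h

theorem copyVar_injective : Function.Injective copyVar := fun _ _ h => by simpa [copyVar] using h

theorem targetVar_injective : Function.Injective targetVar :=
  fun _ _ h => by simpa [targetVar] using h

theorem matchVar_injective : Function.Injective matchVar :=
  fun _ _ h => by simpa [matchVar] using h

theorem mem_model : (w, m) ∈ model G ↔ ∃ v m', (v, m') ∈ G ∧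
    ((w = origVar v ∧ m = origMech m') ∨ (w = copyVar v ∧ m = copyMech v m'.card) ∨
      (w = targetVar v ∧ m = Mech.exo (dyadicPrior m'.card)) ∨
      (w = matchVar v ∧ m = matchMech v m'.card)) := by
  simp only [model, List.mem_append, List.mem_map, Prod.mk.injEq, Prod.exists]
  constructor
  · rintro (((⟨v, m', h, rfl, rfl⟩ | ⟨v, m', h, rfl, rfl⟩) | ⟨v, m', h, rfl, rfl⟩) |
      ⟨v, m', h, rfl, rfl⟩) <;> refine ⟨v, m', h, ?_⟩ <;> simp
  · rintro ⟨v, m', h, ⟨rfl, rfl⟩ | ⟨rfl, rfl⟩ | ⟨rfl, rfl⟩ | ⟨rfl, rfl⟩⟩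
    · exact Or.inl (Or.inl (Or.inl ⟨v, m', h, rfl, rfl⟩))
    · exact Or.inl (Or.inl (Or.inr ⟨v, m', h, rfl, rfl⟩))
    · exact Or.inl (Or.inr ⟨v, m', h, rfl, rfl⟩)
    · exact Or.inr ⟨v, m', h, rfl, rfl⟩

theorem nodup_model (hG : G.vars.Nodup) : (model G).vars.Nodup := by
  have hv : (model G).vars = G.vars.map origVar ++ G.vars.map copyVar ++ G.vars.map targetVar ++
      G.vars.map matchVar := by
    simp [model, vars, Function.comp_def]
  rw [hv]
  refine (((hG.map origVar_injective).append (hG.map copyVar_injective) ?_).append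
    (hG.map targetVar_injective) ?_).append (hG.map matchVar_injective) ?_
  all_goals
    intro v h₁ h₂
    simp only [List.mem_append, List.mem_map] at h₁ h₂
    obtain ⟨b, -, rfl⟩ := h₂
  · obtain ⟨a, -, h⟩ := h₁
    simp [origVar, copyVar] at h
  · obtain ⟨a, -, h⟩ | ⟨a, -, h⟩ := h₁ <;> simp [origVar, copyVar, targetVar] at h
  · obtain (⟨a, -, h⟩ | ⟨a, -, h⟩) | ⟨a, -, h⟩ := h₁ <;>
      simp [origVar, copyVar, targetVar, matchVar] at h

theorem mem_orig {v : Var} (h : (v, m) ∈ G) : (origVar v, origMech m) ∈ model G :=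
  mem_model.2 ⟨v, m, h, Or.inl ⟨rfl, rfl⟩⟩

theorem mem_copy {v : Var} (h : (v, m) ∈ G) : (copyVar v, copyMech v m.card) ∈ model G :=
  mem_model.2 ⟨v, m, h, Or.inr (Or.inl ⟨rfl, rfl⟩)⟩

theorem mem_target {v : Var} (h : (v, m) ∈ G) :
    (targetVar v, Mech.exo (dyadicPrior m.card)) ∈ model G :=
  mem_model.2 ⟨v, m, h, Or.inr (Or.inr (Or.inl ⟨rfl, rfl⟩))⟩

theorem mem_match {v : Var} (h : (v, m) ∈ G) : (matchVar v, matchMech v m.card) ∈ model G :=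
  mem_model.2 ⟨v, m, h, Or.inr (Or.inr (Or.inr ⟨rfl, rfl⟩))⟩

theorem card_origMech (m : Mech) : (origMech m).card = m.card := by cases m <;> rfl

theorem card_orig (hG : G.WF) {v : Var} (hv : v ∈ G.vars) :
    (model G).card (origVar v) = G.card v := by
  obtain ⟨m, hm⟩ := mem_vars.1 hv
  rw [card_eq (nodup_model hG.nodup) (mem_orig hm), card_origMech, hG.card hm]

theorem card_target (hG : G.WF) {v : Var} (hv : v ∈ G.vars) :
    (model G).card (targetVar v) = G.card v := by
  obtain ⟨m, hm⟩ := mem_vars.1 hv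
  rw [card_eq (nodup_model hG.nodup) (mem_target hm), hG.card hm]
  exact length_dyadicPrior (hG.card hm ▸ hG.card_pos hv)

theorem wf_model (hG : G.WF) : (model G).WF := by
  have horig : ∀ {v m}, (v, m) ∈ G → (model G).card (origVar v) = m.card :=
    fun h => (card_orig hG (mem_vars.2 ⟨_, h⟩)).trans (hG.card h)
  have htarget : ∀ {v m}, (v, m) ∈ G → (model G).card (targetVar v) = m.card :=
    fun h => (card_target hG (mem_vars.2 ⟨_, h⟩)).trans (hG.card h)
  refine ⟨?_, nodup_model hG.nodup, ?_, ?_, ?_⟩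
  · obtain ⟨⟨v, m⟩, hn⟩ := List.exists_mem_of_ne_nil _ hG.1
    exact List.ne_nil_of_mem (mem_orig hn)
  · intro v θ hv
    obtain ⟨v, m, hm, ⟨-, h⟩ | ⟨-, h⟩ | ⟨-, h⟩ | ⟨-, h⟩⟩ := mem_model.1 hv
    · cases m with
      | exo θ' => cases h; exact hG.2.2.1 _ _ hm
      | endo => cases h
    · cases h
    · cases h
      exact sum_dyadicPrior _
    · cases h
  · intro v pa k rows hv
    obtain ⟨v, m, hm, ⟨-, h⟩ | ⟨-, h⟩ | ⟨-, h⟩ | ⟨-, h⟩⟩ := mem_model.1 hv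
    · cases m with
      | exo θ' => cases h
      | endo pa k rows =>
        cases h
        obtain ⟨h₁, h₂, h₃, h₄, h₅, h₆⟩ := hG.endo hm
        refine ⟨by simpa using h₁, h₂.map origVar_injective, fun w hw => ?_, h₄, fun p => ?_, h₆⟩
        · obtain ⟨q, hq, rfl⟩ := List.mem_map.1 hw
          obtain ⟨m, hm⟩ := mem_vars.1 (h₃ hq)
          exact mem_vars.2 ⟨_, mem_orig hm⟩
        · rw [h₅, isStates_map fun v hv => card_orig hG (h₃ hv)]
    · cases h
      refine ⟨by simp, by simp, ?_, ?_, fun p => ?_, ?_⟩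
      · simpa using mem_vars.2 ⟨_, mem_orig hm⟩
      · rw [List.map_map]
        exact List.nodup_range.map fun a b h => by simpa using h
      · unfold IsStates
        rcases p with _ | ⟨a, _ | ⟨b, p⟩⟩ <;> simp [horig hm]
      · simp
    · cases h
    · cases h
      refine ⟨by simp, by simp [origVar, targetVar], ?_, ?_, fun p => ?_, ?_⟩
      · simp only [List.cons_subset, List.nil_subset, and_true]
        exact ⟨mem_vars.2 ⟨_, mem_orig hm⟩, mem_vars.2 ⟨_, mem_target hm⟩⟩
      · rw [List.map_flatMap, List.nodup_flatMap]
        refine ⟨fun a _ => ?_, List.nodup_range.imp fun {a b} hab p h₁ h₂ => ?_⟩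
        · rw [List.map_map]
          exact List.nodup_range.map fun a b h => by simpa using h
        · simp only [List.map_map, List.mem_map, Function.comp_apply] at h₁ h₂
          obtain ⟨c, -, rfl⟩ := h₁
          obtain ⟨d, -, h⟩ := h₂
          simp only [List.cons.injEq] at h
          exact hab h.1.symm
      · unfold IsStates
        rcases p with _ | ⟨a, _ | ⟨b, _ | ⟨c, p⟩⟩⟩ <;>
          simp [horig hm, htarget hm]
      · intro r hr
        simp only [List.mem_flatMap, List.mem_map] at hr
        obtain ⟨a, -, b, -, rfl⟩ := hr
        dsimp only
        split_ifs <;> norm_num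
  · obtain ⟨rank, hrank⟩ := hG.2.2.2.2
    -- Copies and comparisons lie one above their originals; the independent roots have rank `0`.
    refine ⟨fun w => match w with
      | 0 :: v => rank v
      | 1 :: v => rank v + 1
      | 3 :: v => rank v + 1
      | _ => 0, ?_⟩
    intro v pa k rows hv p hp
    obtain ⟨v, m, hm, ⟨rfl, h⟩ | ⟨rfl, h⟩ | ⟨rfl, h⟩ | ⟨rfl, h⟩⟩ := mem_model.1 hv
    · cases m with
      | exo θ' => cases h
      | endo pa k rows =>
        cases h
        obtain ⟨q, hq, rfl⟩ := List.mem_map.1 hp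
        exact hrank _ _ _ _ hm q hq
    · cases h
      obtain rfl := List.mem_singleton.1 hp
      exact Nat.lt_succ_self _
    · cases h
    · cases h
      simp only [List.mem_cons, List.not_mem_nil, or_false] at hp
      rcases hp with rfl | rfl
      · exact Nat.lt_succ_self _
      · exact Nat.succ_pos _

theorem priors_eq_nil (l : SCM) {f : Var × Mech → Var × Mech}
    (h : ∀ n, ∃ pa k rows, (f n).2 = Mech.endo pa k rows) : SCM.priors (l.map f) = [] := by
  unfold priors
  rw [List.filterMap_eq_nil_iff]
  intro n hn
  obtain ⟨n', -, rfl⟩ := List.mem_map.1 hn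
  obtain ⟨pa, k, rows, h'⟩ := h n'
  rcases hf : f n' with ⟨v, m⟩
  rw [hf] at h'
  dsimp only at h'
  subst h'
  rfl

/-- The distributions of the target variables. -/
def targetPriors (G : SCM) : List (Var × List ℚ≥0) :=
  G.map fun n => (n.1, dyadicPrior n.2.card)

theorem priors_model (G : SCM) : (model G).priors =
    (G.priors.map fun p => (origVar p.1, p.2)) ++
      (targetPriors G).map fun p => (targetVar p.1, p.2) := by
  unfold model
  rw [priors_append, priors_append, priors_append,
    priors_eq_nil G (f := fun n => (copyVar n.1, copyMech n.1 n.2.card)) fun n => ⟨_, _, _, rfl⟩,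
    priors_eq_nil G (f := fun n => (matchVar n.1, matchMech n.1 n.2.card)) fun n => ⟨_, _, _, rfl⟩,
    List.append_nil, List.append_nil]
  congr 1
  · unfold priors
    induction G with
    | nil => rfl
    | cons n G ih =>
      obtain ⟨v, m⟩ := n
      cases m with
      | exo θ => exact congrArg (List.cons _) ih
      | endo => exact ih
  · unfold priors targetPriors
    induction G with
    | nil => rfl
    | cons n G ih => exact congrArg (List.cons _) ih

/-- The independent roots and the original exogenous variables are drawn separately, so an event
about the former and an event about the latter are independent. -/
theorem expect_model (hG : G.WF) (A B : (Var → ℕ) → Prop) :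
    expect (model G).priors (fun α => ind (A (α ∘ targetVar)) * ind (B (α ∘ origVar))) 0 =
      expect (targetPriors G) (fun ω => ind (A ω)) 0 * expect G.priors (fun ω => ind (B ω)) 0 := by
  rw [priors_model, expect_append]
  have h₁ : expect ((targetPriors G).map fun p => (targetVar p.1, p.2))
      (fun α => ind (A (α ∘ targetVar)) * ind (B (α ∘ origVar))) = fun b =>
      ind (B (b ∘ origVar)) * expect (targetPriors G) (fun ω => ind (A ω)) (b ∘ targetVar) := by
    funext b
    rw [← expect_map (F := fun ω => ind (A ω)) targetVar_injective,
      ← expect_mul_left (g := fun b => ind (B (b ∘ origVar)))]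
    · simp only [mul_comm]
    · intro v hv a s
      have : Function.update a v s ∘ origVar = a ∘ origVar := by
        funext w
        rw [List.map_map] at hv
        obtain ⟨p, -, rfl⟩ := List.mem_map.1 hv
        exact Function.update_of_ne (by simp [origVar, targetVar]) _ _
      simp only [this]
  have h₂ := expect_map (l := G.priors) (F := fun ω => ind (B ω)) (a := 0) origVar_injective
  have h₃ : (0 : Var → ℕ) ∘ origVar = 0 := rfl
  rw [h₃] at h₂
  rw [h₁, ← h₂, ← expect_mul_left
    (g := fun _ => expect (targetPriors G) (fun ω => ind (A ω)) 0) fun _ _ _ _ => rfl]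
  have hnd : ((G.priors.map fun p => (origVar p.1, p.2)).map Prod.fst).Nodup := by
    have := hG.priors_nodup.map origVar_injective
    rw [List.map_map] at this ⊢
    exact this
  refine expect_congr hnd fun b hb => ?_
  have : b ∘ targetVar = 0 := by
    funext v
    refine hb.1 _ fun h => ?_
    rw [List.map_map] at h
    obtain ⟨p, -, hp⟩ := List.mem_map.1 h
    simp [origVar, targetVar] at hp
  rw [this, mul_comm]

/-! ### Solutions of the model with independent target variables -/

section Solution

variable {α x : Var → ℕ} (hG : G.WF) (hx : (model G).Sol [] α x)
include hx

theorem sol_orig : G.Sol [] (α ∘ origVar) (x ∘ origVar) := by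
  intro v m hm
  have h := hx _ _ (mem_orig hm)
  simp only [List.lookup_nil] at h ⊢
  cases m with
  | exo θ => exact h
  | endo pa k rows =>
    simp only [origMech, List.map_map] at h
    exact h

theorem eq_copy {v : Var} (hv : v ∈ G.vars) : x (copyVar v) = x (origVar v) := by
  obtain ⟨m, hm⟩ := mem_vars.1 hv
  have h := hx _ _ (mem_copy hm)
  simp only [List.lookup_nil, copyMech, List.map_cons, List.map_nil] at h
  obtain ⟨l₁, l₂, hl, -⟩ := List.lookup_eq_some_iff.1 h
  have hmem : ([x (origVar v)], x (copyVar v)) ∈ (List.range m.card).map fun a => ([a], a) := by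
    rw [hl]
    simp
  simp only [List.mem_map, Prod.mk.injEq, List.cons.injEq, and_true] at hmem
  obtain ⟨a, -, h₁, h₂⟩ := hmem
  rw [← h₁, ← h₂]

theorem eq_target {v : Var} (hv : v ∈ G.vars) : x (targetVar v) = α (targetVar v) := by
  obtain ⟨m, hm⟩ := mem_vars.1 hv
  exact hx _ _ (mem_target hm)

theorem match_eq_one {v : Var} (hv : v ∈ G.vars) :
    x (matchVar v) = 1 ↔ x (origVar v) = x (targetVar v) := by
  obtain ⟨m, hm⟩ := mem_vars.1 hv
  have h := hx _ _ (mem_match hm)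
  simp only [List.lookup_nil, matchMech, List.map_cons, List.map_nil] at h
  obtain ⟨l₁, l₂, hl, -⟩ := List.lookup_eq_some_iff.1 h
  have hmem : ([x (origVar v), x (targetVar v)], x (matchVar v)) ∈ (List.range m.card).flatMap
      fun a => (List.range m.card).map fun b => ([a, b], if a = b then 1 else 0) := by
    rw [hl]
    simp
  simp only [List.mem_flatMap, List.mem_map, Prod.mk.injEq, List.cons.injEq, and_true] at hmem
  obtain ⟨a, -, b, -, ⟨h₁, h₂⟩, h₃⟩ := hmem
  rw [← h₁, ← h₂, ← h₃]
  simp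

theorem agrees_copyInst {e : Inst} (he : G.IsInst e) :
    Agrees (copyInst e) x ↔ Agrees e (x ∘ origVar) := by
  unfold Agrees copyInst
  rw [List.forall_mem_map]
  refine forall₂_congr fun p hp => ?_
  rw [eq_copy hx (he.2 p hp).1]
  rfl

/-- Once root and original are known to agree, fixing the roots to `u` fixes the originals too. The
event thus separates into one about the roots and one about the originals. -/
theorem agrees_targets {U : List Var} (hU : U ⊆ G.vars) (hu : U.length = u.length) :
    Agrees (U.map fun v => (matchVar v, 1)) x ∧ Agrees ((U.map targetVar).zip u) x ↔
      Agrees (U.zip u) (α ∘ targetVar) ∧ Agrees (U.zip u) (x ∘ origVar) := by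
  have h₁ : Agrees (U.map fun v => (matchVar v, 1)) x ↔
      ∀ v ∈ U, (x ∘ origVar) v = (α ∘ targetVar) v := by
    unfold Agrees
    rw [List.forall_mem_map]
    refine forall₂_congr fun v hv => ?_
    rw [match_eq_one hx (hU hv), eq_target hx (hU hv)]
    rfl
  have h₂ : Agrees ((U.map targetVar).zip u) x ↔ Agrees (U.zip u) (α ∘ targetVar) := by
    unfold Agrees
    rw [List.zip_map_left, List.forall_mem_map]
    refine forall₂_congr fun p hp => ?_
    change x (targetVar p.1) = p.2 ↔ _
    rw [eq_target hx (hU (zip_vars_subset _ _ (List.mem_map_of_mem hp)))]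
    rfl
  rw [h₁, h₂, forall_eq_and_agrees_zip hu, and_comm]

end Solution

theorem valid_iff : RMAP.Valid I ↔ I.G.WF ∧ I.U.Nodup ∧ I.U ⊆ I.G.vars ∧ I.G.IsInst I.e₁ ∧
    I.G.IsInst I.e₂ ∧ I.U.Disjoint I.e₁.vars ∧ I.U.Disjoint I.e₂.vars ∧
    I.e₁.vars.Disjoint I.e₂.vars := Iff.rfl

theorem isEndoInst_copyInst (hG : G.WF) {e : Inst} (he : G.IsInst e) :
    (model G).IsEndoInst (copyInst e) := by
  refine ⟨⟨?_, fun p hp => ?_⟩, fun p hp => ?_⟩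
  · have : Inst.vars (copyInst e) = e.vars.map copyVar := by
      simp [copyInst, Function.comp_def]
    rw [this]
    exact he.1.map copyVar_injective
  all_goals
    obtain ⟨q, hq, rfl⟩ := List.mem_map.1 hp
    obtain ⟨m, hm⟩ := mem_vars.1 (he.2 q hq).1
  · refine ⟨mem_vars.2 ⟨_, mem_copy hm⟩, ?_⟩
    rw [(wf_model hG).card (mem_copy hm)]
    exact hG.card hm ▸ (he.2 q hq).2
  · exact mem_endoVars.2 ⟨_, _, _, mem_copy hm⟩

theorem isEndoInst_evidence (hI : RMAP.Valid I) :
    (model I.G).IsEndoInst (copyInst I.e₂ ++ I.U.map fun v => (matchVar v, 1)) := by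
  obtain ⟨hG, hUn, hU, -, he, -⟩ := valid_iff.1 hI
  have h := isEndoInst_copyInst hG he
  have hv : (I.U.map fun v => (matchVar v, 1)).map Prod.fst = I.U.map matchVar := by
    simp [Function.comp_def]
  refine ⟨⟨?_, fun p hp => ?_⟩, fun p hp => ?_⟩
  · rw [Inst.vars, List.map_append]
    refine h.1.1.append (by rw [hv]; exact hUn.map matchVar_injective) ?_
    intro v h₁ h₂
    obtain ⟨p, hp, rfl⟩ := List.mem_map.1 h₁
    obtain ⟨q, -, rfl⟩ := List.mem_map.1 hp
    rw [hv] at h₂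
    obtain ⟨v, -, h'⟩ := List.mem_map.1 h₂
    simp [matchVar, copyVar] at h'
  · rcases List.mem_append.1 hp with hp | hp
    · exact h.1.2 p hp
    · obtain ⟨v, hv, rfl⟩ := List.mem_map.1 hp
      obtain ⟨m, hm⟩ := mem_vars.1 (hU hv)
      refine ⟨mem_vars.2 ⟨_, mem_match hm⟩, ?_⟩
      rw [(wf_model hG).card (mem_match hm)]
      exact Nat.one_lt_two
  · rcases List.mem_append.1 hp with hp | hp
    · exact h.2 p hp
    · obtain ⟨v, hv, rfl⟩ := List.mem_map.1 hp
      obtain ⟨m, hm⟩ := mem_vars.1 (hU hv)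
      exact mem_endoVars.2 ⟨_, _, _, mem_match hm⟩

/-! ### Numerator and denominator after the reduction from Reverse-MAP -/

section Value

variable (hI : RMAP.Valid I)
include hI

theorem valid_toUS : UnitSelection.Valid (toUS I) := by
  obtain ⟨hG, hUn, hU, he₁, -⟩ := valid_iff.1 hI
  have hnil : (model I.G).IsEndoInst [] := ⟨⟨by simp, by simp⟩, by simp⟩
  refine ⟨wf_model hG, hUn.map targetVar_injective, ?_, ?_, by simp [toUS]⟩
  · intro v hv
    obtain ⟨w, hw, rfl⟩ := List.mem_map.1 hv
    obtain ⟨m, hm⟩ := mem_vars.1 (hU hw)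
    exact mem_exoVars.2 ⟨_, mem_target hm⟩
  · intro t ht
    obtain rfl := List.mem_singleton.1 ht
    exact ⟨hnil, isEndoInst_copyInst hG he₁, hnil, hnil, isEndoInst_evidence hI, by simp⟩

/-- The probability that the target variables have states `u`. -/
noncomputable def targetProb (G : SCM) (U : List Var) (u : List ℕ) : ℚ≥0 :=
  expect (targetPriors G) (fun ω => ind (Agrees (U.zip u) ω)) 0

/-- Here full support of the dyadic priors matters: no feasible `u` is lost, and the factor can be
cancelled. The state `assign I.U u` witnesses positivity. -/
theorem targetProb_ne_zero (hu : I.G.IsStates u I.U) : targetProb I.G I.U u ≠ 0 := by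
  obtain ⟨hG, hUn, hU, -⟩ := valid_iff.1 hI
  have hz : (I.U.zip u).map Prod.fst = I.U := List.map_fst_zip hu.length_eq.symm.le
  have hz' : ((I.U.zip u).map Prod.fst).Nodup := hz.symm ▸ hUn
  refine expect_ne_zero (b := assign I.U u) ⟨fun v hv => ?_, fun p hp => ?_⟩ ?_
  · have : (I.U.zip u).lookup v = none := by
      rw [List.lookup_eq_none_iff_notMem, hz]
      intro h
      obtain ⟨m, hm⟩ := mem_vars.1 (hU h)
      refine hv ?_
      rw [targetPriors, List.map_map]
      exact List.mem_map.2 ⟨_, hm, rfl⟩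
    simp [assign, this]
  · obtain ⟨⟨v, m⟩, hm, rfl⟩ := List.mem_map.1 hp
    refine getD_dyadicPrior_ne_zero ?_
    change assign I.U u v < m.card
    rw [← hG.card hm]
    unfold assign
    cases h : (I.U.zip u).lookup v with
    | none => exact hG.card_pos (mem_vars.2 ⟨m, hm⟩)
    | some s =>
      have hmem := (List.lookup_eq_some_iff_mem hz').1 h
      exact (List.forall₂_iff_zip.1 hu).2 (by
        rw [← List.zip_swap]
        exact List.mem_map.2 ⟨_, hmem, rfl⟩)
  · rw [ind_true]
    · exact one_ne_zero
    · intro p hp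
      unfold assign
      rw [(List.lookup_eq_some_iff_mem hz').2 (show (p.1, p.2) ∈ _ from hp)]
      rfl

theorem evidence_iff {α x : Var → ℕ} (hx : (model I.G).Sol [] α x)
    (hu : I.U.length = u.length) :
    Agrees (copyInst I.e₂ ++ (I.U.map fun v => (matchVar v, 1)) ++ (I.U.map targetVar).zip u) x ↔
      Agrees (I.U.zip u) (α ∘ targetVar) ∧ Agrees (I.U.zip u ++ I.e₂) (x ∘ origVar) := by
  obtain ⟨hG, -, hU, he₁, he₂, -⟩ := valid_iff.1 hI
  rw [agrees_append, agrees_append, and_assoc, agrees_targets hx hU hu, agrees_copyInst hx he₂,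
    agrees_append]
  tauto

theorem evidence_vars : ∀ p ∈ copyInst I.e₂ ++ (I.U.map fun v => (matchVar v, 1)) ++
    (I.U.map targetVar).zip u, p.1 ∈ (model I.G).vars := by
  intro p hp
  rcases List.mem_append.1 hp with hp | hp
  · exact ((isEndoInst_evidence hI).1.2 p hp).1
  · obtain ⟨v, hv, h⟩ := List.mem_map.1 (zip_vars_subset _ _ (List.mem_map_of_mem hp))
    obtain ⟨m, hm⟩ := mem_vars.1 ((valid_iff.1 hI).2.2.1 hv)
    rw [← h]
    exact mem_vars.2 ⟨_, mem_target hm⟩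

theorem inst_vars : ∀ p ∈ I.e₁ ++ I.U.zip u ++ I.e₂, p.1 ∈ I.G.vars := by
  obtain ⟨-, -, hU, he₁, he₂, -⟩ := valid_iff.1 hI
  intro p hp
  rcases List.mem_append.1 hp with hp | hp
  · rcases List.mem_append.1 hp with hp | hp
    · exact (he₁.2 p hp).1
    · exact hU (zip_vars_subset _ _ (List.mem_map_of_mem hp))
  · exact (he₂.2 p hp).1

/-- By `evidence_iff` the event is a conjunction of a condition on the roots and the Reverse-MAP
condition on the originals, so `expect_model` gives the product. -/
theorem obs_evidence (hu : I.U.length = u.length) :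
    (model I.G).obs (copyInst I.e₂ ++ (I.U.map fun v => (matchVar v, 1)) ++
      (I.U.map targetVar).zip u) = targetProb I.G I.U u * I.G.obs (I.U.zip u ++ I.e₂) := by
  have hG := (valid_iff.1 hI).1
  have hG' := wf_model hG
  rw [obs, hG'.prob_eq_ind, obs, hG.prob_eq_ind, targetProb, ← expect_model hG]
  refine expect_congr hG'.priors_nodup fun α hα => ?_
  obtain ⟨x, hx, -⟩ := hG'.exists_sol (hG'.lt_card_of_inSupport hα)
  rw [← ind_and]
  refine congrArg ind (propext ?_)
  rw [holds_cons, hG'.exists_sol_iff hx (evidence_vars hI), and_iff_left holds_nil, holds_cons,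
    hG.exists_sol_iff (sol_orig hx) (fun p hp => inst_vars hI (u := u) p (by
      rw [List.append_assoc]; exact List.mem_append_right _ hp)), and_iff_left holds_nil]
  exact evidence_iff hI hx hu

theorem prob_outcome (hu : I.U.length = u.length) :
    (model I.G).prob [([], copyInst I.e₁), ([], []),
      ([], copyInst I.e₂ ++ (I.U.map fun v => (matchVar v, 1)) ++ (I.U.map targetVar).zip u)] =
      targetProb I.G I.U u * I.G.obs (I.e₁ ++ I.U.zip u ++ I.e₂) := by
  obtain ⟨hG, -, -, he₁, -⟩ := valid_iff.1 hI
  have hG' := wf_model hG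
  rw [hG'.prob_eq_ind, obs, hG.prob_eq_ind, targetProb, ← expect_model hG]
  refine expect_congr hG'.priors_nodup fun α hα => ?_
  obtain ⟨x, hx, -⟩ := hG'.exists_sol (hG'.lt_card_of_inSupport hα)
  rw [← ind_and]
  refine congrArg ind (propext ?_)
  rw [holds_cons, holds_cons, holds_cons, hG'.exists_sol_iff hx (evidence_vars hI),
    hG'.exists_sol_iff hx (fun p hp => ((isEndoInst_copyInst hG he₁).1.2 p hp).1),
    hG'.exists_sol_iff hx (by simp), and_iff_left holds_nil, holds_cons,
    hG.exists_sol_iff (sol_orig hx) (inst_vars hI), and_iff_left holds_nil]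
  dsimp only
  rw [evidence_iff hI hx hu, agrees_copyInst hx he₁, List.append_assoc,
    agrees_append (e := I.e₁)]
  have : Agrees [] x := by simp [Agrees]
  tauto

theorem feasible_iff : UnitSelection.Feasible (toUS I) u ↔ RMAP.Feasible I u := by
  obtain ⟨hG, -, hU, -⟩ := valid_iff.1 hI
  change ((model I.G).IsStates u (I.U.map targetVar) ∧ ∀ t ∈ (toUS I).L, (model I.G).obs
    (t.e ++ (I.U.map targetVar).zip u) ≠ 0) ↔ (I.G.IsStates u I.U ∧ _)
  rw [isStates_map fun v hv => card_target hG (hU hv)]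
  refine and_congr_right fun hu => ?_
  change (∀ t ∈ [_], _) ↔ _
  rw [List.forall_mem_singleton, obs_evidence hI hu.length_eq.symm]
  simp [targetProb_ne_zero hI hu]

theorem value_eq (hf : RMAP.Feasible I u) : UnitSelection.value (toUS I) u = RMAP.value I u := by
  have hu := hf.1
  change (1 * ((model I.G).prob _ / (model I.G).obs _) + 0 : ℚ≥0) = I.G.obs _ / I.G.obs _
  rw [one_mul, add_zero]
  refine (congrArg₂ _ (prob_outcome hI hu.length_eq.symm)
    (obs_evidence hI hu.length_eq.symm)).trans ?_
  exact mul_div_mul_left _ _ (targetProb_ne_zero hI hu)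

end Value

theorem isPolyReduction_toUS : OptProblem.IsPolyReduction RMAP UnitSelection toUS :=
  OptProblem.isPolyReduction_of polyTime_toUS fun _ hI =>
    ⟨valid_toUS hI, fun _ => feasible_iff hI, fun _ => value_eq hI⟩

end Targets

theorem mainTheorem4 :
    (∃ f : RMAPInput → USInput, OptProblem.IsPolyReduction RMAP UnitSelection f) ∧
    OptProblem.IsPolyReduction UnitSelection RMAP Objective.toRMAP ∧
    (∃ C : ℕ, ∀ I : USInput, UnitSelection.Valid I →
      (Objective.model I).size ≤ C * (I.L.length * I.G.size)) := by
  refine ⟨⟨_, Targets.isPolyReduction_toUS⟩, Objective.isPolyReduction_toRMAP, 10, fun I hI => ?_⟩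
  refine Objective.size_model_le (Objective.valid_iff.1 hI).1 fun h => ?_
  -- An empty objective function is excluded, since its weights would sum to zero.
  have hw := (Objective.valid_iff.1 hI).2.2.2.2
  simp [h] at hw
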